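/- Let $r\le p\le q$ be integers with $r\ge 3$, $\frac1r+\frac1p+\frac1q<1$ and $(r,p,q)\notin\{(3,4,4),(4,4,4),(5,5,5)\}$. Let $T$ be a triangle in the hyperbolic plane $\mathbf H$ (with hyperbolic distance $d$) with angles $\pi/r,\pi/p,\pi/q$, let $\Gamma_0$ be the group generated by the reflections in the sides of $T$, and let $\Gamma(r,p,q)$ be the subgroup of orientation-preserving elements of $\Gamma_0$. In each triangle of the tiling $\{gT: g\in\Gamma_0\}$ consider the point at which the inscribed circle touches the side joining the vertices of angles $\pi/r$ and $\pi/p$; let $\mathcal E^*$ be the set of all these points. Two points of $\mathcal E^*$ are called neighbours if, for some vertex $v$ of the tiling of angle $\pi/r$ (respectively $\pi/p$), they are the points of $\mathcal E^*$ of two triangles of the tiling having $v$ as their vertex of that angle (so that they lie on a common circle centred at $v$), and they are seen from $v$ under the angle $2\pi/r$ (respectively $2\pi/p$). (If some of $r,p,q$ coincide, the three vertices of $T$ are nevertheless distinguished, and the vertices of $gT$ are labelled accordingly.) Let $D^*$ be the path distance of the resulting graph on $\mathcal E^*$, and for $\gamma\in\Gamma(r,p,q)$ put $\lambda^*(\gamma)=\inf\{D^*(x,\gamma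 x): x\in\mathcal E^*\}$. Then every hyperbolic element $\gamma\in\Gamma(r,p,q)$ with $\lambda^*(\gamma)\ge 5$ has translation length $$\inf_{x\in\mathbf H} d(x,\gamma x) \;>\; l_0 = 2\,\operatorname{arccosh}\!\Big(2\cos\frac{\pi}{p}\cos\frac{\pi}{q}+\cos\frac{\pi}{r}\Big).$$ -/

import Mathlib

open scoped UpperHalfPlane MatrixGroups

noncomputable section

namespace TriangleSpectrum

/-! Geometry of the upper half-plane `ℍ` with Mathlib's hyperbolic distance. -/

/-- The geodesic segment `[x, y]`. -/
def segment (x y : ℍ) : Set ℍ :=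
  {z | dist x z + dist z y = dist x y}

/-- The complete geodesic `(x y)` through two distinct points: the points `z` that lie between
`x` and `y`, or such that `x` lies between `z` and `y`, or `y` between `x` and `z`. -/
def line (x y : ℍ) : Set ℍ :=
  {z | z ∈ segment x y ∨ x ∈ segment z y ∨ y ∈ segment x z}

/-- The Cayley transform, a conformal map of `ℍ` onto the unit disc that sends `v` to `0`.
It maps the geodesic rays issued from `v` onto the radii of the disc. -/
def cayley (v x : ℍ) : ℂ :=
  ((x : ℂ) - (v : ℂ)) / ((x : ℂ) - (starRingEnd ℂ) (v : ℂ))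

/-- The (unoriented) angle at `v` between the geodesic rays from `v` through `x` and `y`,
in `[0, π]`. -/
def hypAngle (v x y : ℍ) : ℝ :=
  InnerProductGeometry.angle (cayley v x) (cayley v y)

/-- `σ` is the reflection in the geodesic `(x y)`: the nontrivial isometry of `ℍ` that fixes this
geodesic pointwise. -/
def IsReflection (x y : ℍ) (σ : ℍ ≃ᵢ ℍ) : Prop :=
  σ ≠ 1 ∧ ∀ z ∈ line x y, σ z = z

/-- The action of `SL(2, ℝ)` on `ℍ` by Möbius transformations, as isometries. -/
def moebius : SL(2, ℝ) →* (ℍ ≃ᵢ ℍ) where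
  toFun g := IsometryEquiv.constSMul g
  map_one' := by ext z; simp
  map_mul' g h := by ext z; simp [mul_smul]

/-- The orientation-preserving isometries of `ℍ`, that is, `PSL(2, ℝ)`. -/
def directIsometries : Subgroup (ℍ ≃ᵢ ℍ) :=
  moebius.range

/-- Hyperbolic isometries: those given by a matrix of `SL(2, ℝ)` with two distinct real
eigenvalues. -/
def IsHyperbolic (γ : ℍ ≃ᵢ ℍ) : Prop :=
  ∃ g : SL(2, ℝ), moebius g = γ ∧ (g : Matrix (Fin 2) (Fin 2) ℝ).IsHyperbolic

/-- The translation length `inf {d(x, γ x) ; x ∈ ℍ}`. -/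
def translationLength (γ : ℍ ≃ᵢ ℍ) : ℝ :=
  ⨅ x : ℍ, dist x (γ x)

/-! Triangles and their reflection groups. -/

/-- A triangle of `ℍ`, given by its three vertices. -/
structure Triangle where
  /-- the first vertex, of angle `π / r` -/
  R : ℍ
  /-- the second vertex, of angle `π / p` -/
  P : ℍ
  /-- the third vertex, of angle `π / q` -/
  Q : ℍ

namespace Triangle

/-- The triangle `T` has angles `π / r`, `π / p`, `π / q` at its three vertices. For integers
`r, p, q ≥ 3` this forces the vertices to be distinct and not on one geodesic. -/
def HasAngles (T : Triangle) (r p q : ℕ) : Prop :=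
  hypAngle T.R T.P T.Q = Real.pi / r ∧ hypAngle T.P T.Q T.R = Real.pi / p ∧
    hypAngle T.Q T.R T.P = Real.pi / q

/-- The image of a triangle under an isometry. -/
def map (T : Triangle) (g : ℍ ≃ᵢ ℍ) : Triangle :=
  ⟨g T.R, g T.P, g T.Q⟩

/-- `Γ₀`: the group generated by the reflections in the three sides of `T`. -/
def reflectionGroup (T : Triangle) : Subgroup (ℍ ≃ᵢ ℍ) :=
  Subgroup.closure
    {σ | IsReflection T.R T.P σ ∨ IsReflection T.P T.Q σ ∨ IsReflection T.Q T.R σ}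

/-- The triangle group `Γ`: the orientation-preserving elements of `Γ₀`. -/
def group (T : Triangle) : Subgroup (ℍ ≃ᵢ ℍ) :=
  T.reflectionGroup ⊓ directIsometries

/-- The circle centered at `o` through `x` is tangent at `x` to the side `[y, z]`, at a point
`x` other than the end points: `x` lies strictly inside the side, and no point of the
side lies inside the circle. -/
def TouchesSide (o x y z : ℍ) : Prop :=
  x ∈ segment y z ∧ x ≠ y ∧ x ≠ z ∧ ∀ w ∈ segment y z, dist o x ≤ dist o w

/-- `x` is the point `q*` of `T`: the point of contact of the inscribed circle of `T` with the side
that joins the vertices `R` and `P`. Here `o` is the center of this circle, and `y`, `z` are its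
points of contact with the two other sides. -/
def IsContactPoint (T : Triangle) (x : ℍ) : Prop :=
  ∃ o y z : ℍ, dist o x = dist o y ∧ dist o y = dist o z ∧
    TouchesSide o x T.R T.P ∧ TouchesSide o y T.P T.Q ∧ TouchesSide o z T.Q T.R

/-- The set `E*` of all points of type `q*`, over all triangles of the tiling
`{g T ; g ∈ Γ₀}`. -/
def contactPoints (T : Triangle) : Set ℍ :=
  {x | ∃ g ∈ T.reflectionGroup, (T.map g).IsContactPoint x}

/-- `x` and `y` are points of `E*` on a common circle centered at a vertex `v` of valence `r` of the
tiling (they are the contact points of two triangles of the tiling that have `v` as their vertex of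
angle `π / r`), consecutive on this circle: they are seen from `v` under the angle `2π / r`. -/
def NeighborsR (T : Triangle) (r : ℕ) (x y : ℍ) : Prop :=
  ∃ g ∈ T.reflectionGroup, ∃ h ∈ T.reflectionGroup, g T.R = h T.R ∧
    (T.map g).IsContactPoint x ∧ (T.map h).IsContactPoint y ∧
    hypAngle (g T.R) x y = 2 * Real.pi / r

/-- The same for circles centered at a vertex of valence `p` of the tiling. -/
def NeighborsP (T : Triangle) (p : ℕ) (x y : ℍ) : Prop :=
  ∃ g ∈ T.reflectionGroup, ∃ h ∈ T.reflectionGroup, g T.P = h T.P ∧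
    (T.map g).IsContactPoint x ∧ (T.map h).IsContactPoint y ∧
    hypAngle (g T.P) x y = 2 * Real.pi / p

/-- The graph on `E*` whose edges join neighbors; points of `ℍ` outside `E*` are isolated. -/
def contactGraph (T : Triangle) (r p : ℕ) : SimpleGraph ℍ :=
  SimpleGraph.fromRel fun x y => T.NeighborsR r x y ∨ T.NeighborsP p x y

/-- The minimal combinatorial displacement `λ*(γ)`: the infimum over `x ∈ E*` of the combinatorial
distance `D*(x, γ x)`, the least number of edges of a path from `x` to `γ x`. -/
def combDisplacement (T : Triangle) (r p : ℕ) (γ : ℍ ≃ᵢ ℍ) : ℕ∞ :=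
  ⨅ x ∈ T.contactPoints, (T.contactGraph r p).edist x (γ x)

end Triangle

end TriangleSpectrum

end

/-!
The hyperbolic plane is embedded in `ℝ^{2,1}` as a sheet of a hyperboloid. Isometries then act
linearly, sides of triangles are given by unit normals, and displacements can be bounded below by
Gram determinants. The group `Γ₀` is the Coxeter group generated by the reflections in the sides of
`T`, and a word in these reflections is a gallery of triangles of the tiling.

A hyperbolic `γ` has an axis. Among the conjugates of `γ` whose axis meets `T`, take one of minimal
word length: the gallery along one period of its axis gives an infinite word `i` of even period `N`
all of whose periods are shortest words for conjugates of `γ` (`Chamber.exists_periodicWord`). Between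
two *switches*, the places at which three consecutive letters are different, the word alternates
between two letters, so that the gallery turns around one vertex; as periods are shortest words, the
length of such a run is at most the order of the vertex (`Chamber.PeriodicWord.run_le`).

At a switch the axis passes between two disjoint walls, whose normals have the inner product
`cs y + 2 * cs x * cs z`, where `cs k` is the cosine of the angle at the vertex `k`. If there
are three disjoint switches in a period, then the translation length is hence at least three times
the smallest distance of such walls, which is more than required
(`Chamber.Ordered.two_mul_arcosh_level_lt`).

Otherwise `γ` is conjugate to a product of two powers of rotations about two
vertices of one triangle (`Chamber.PeriodicWord.eq_of_few_switches`). Such a product is also a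
product of two reflections, whose roots are given by Chebyshev quotients; the inner product of these
roots bounds its displacement (`Chamber.two_mul_arcosh_le_of_opposite` and
`Chamber.two_mul_arcosh_le_of_same`). On the other hand the rotations about the vertices of valence
`r` and `p` move contact points to neighbors, and the rotation about the third vertex is a product of
two of these; the hypothesis on `λ*` hence excludes all small exponents
(`Triangle.exists_level_lt`). For the remaining exponents the inner product exceeds
`2 cos (π / p) cos (π / q) + cos (π / r)` (`Chamber.Ordered.level_lt_of_opposite` and
`Chamber.Ordered.level_lt_of_same`).
-/

noncomputable section

namespace TriangleSpectrum

/-! ### The hyperboloid model -/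

/-- The space `ℝ^{2,1}`, in which the upper half-plane is embedded as a sheet of a hyperboloid. -/
abbrev Mink := Fin 3 → ℝ

/-- The Lorentz form of signature `(2, 1)`, in coordinates that make it minus the (polarized)
determinant of the symmetric matrix with rows `(v₂, v₀)` and `(v₀, v₁)`. -/
def mform (u v : Mink) : ℝ := u 0 * v 0 - (u 1 * v 2 + u 2 * v 1) / 2

theorem mform_comm (u v : Mink) : mform u v = mform v u := by
  simp only [mform]; ring

@[simp] theorem mform_add_left (u v w : Mink) : mform (u + v) w = mform u w + mform v w := by
  simp only [mform, Pi.add_apply]; ring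

@[simp] theorem mform_add_right (u v w : Mink) : mform w (u + v) = mform w u + mform w v := by
  simp only [mform, Pi.add_apply]; ring

@[simp] theorem mform_sub_left (u v w : Mink) : mform (u - v) w = mform u w - mform v w := by
  simp only [mform, Pi.sub_apply]; ring

@[simp] theorem mform_sub_right (u v w : Mink) : mform w (u - v) = mform w u - mform w v := by
  simp only [mform, Pi.sub_apply]; ring

@[simp] theorem mform_smul_left (c : ℝ) (u w : Mink) : mform (c • u) w = c * mform u w := by
  simp only [mform, Pi.smul_apply, smul_eq_mul]; ring

@[simp] theorem mform_smul_right (c : ℝ) (u w : Mink) : mform w (c • u) = c * mform w u := by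
  simp only [mform, Pi.smul_apply, smul_eq_mul]; ring

@[simp] theorem mform_neg_left (u w : Mink) : mform (-u) w = -mform u w := by
  simp only [mform, Pi.neg_apply]; ring

@[simp] theorem mform_neg_right (u w : Mink) : mform w (-u) = -mform w u := by
  simp only [mform, Pi.neg_apply]; ring

/-- The determinant of three vectors. -/
def triple (u v w : Mink) : ℝ :=
  u 0 * (v 1 * w 2 - v 2 * w 1) - u 1 * (v 0 * w 2 - v 2 * w 0) + u 2 * (v 0 * w 1 - v 1 * w 0)

/-- The Gram determinant of three vectors is at most `0`, as the form has signature `(2, 1)`. -/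
theorem gram_eq (u v w : Mink) :
    mform u u * (mform v v * mform w w - mform v w ^ 2)
      - mform u v * (mform u v * mform w w - mform v w * mform u w)
      + mform u w * (mform u v * mform v w - mform v v * mform u w)
      = -(triple u v w ^ 2) / 4 := by
  simp only [mform, triple]; ring

theorem gram_nonpos (u v w : Mink) :
    mform u u * (mform v v * mform w w - mform v w ^ 2)
      - mform u v * (mform u v * mform w w - mform v w * mform u w)
      + mform u w * (mform u v * mform v w - mform v v * mform u w) ≤ 0 := by
  rw [gram_eq]; nlinarith [sq_nonneg (triple u v w)]

/-- Cramer's rule. -/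
theorem cramer (a b c v : Mink) :
    triple a b c • v = triple v b c • a + triple a v c • b + triple a b v • c := by
  ext i
  fin_cases i <;> simp [triple] <;> ring

theorem exists_comb {a b c : Mink} (h : triple a b c ≠ 0) (v : Mink) :
    ∃ x y z : ℝ, v = x • a + y • b + z • c := by
  refine ⟨triple v b c / triple a b c, triple a v c / triple a b c, triple a b v / triple a b c, ?_⟩
  have := congrArg (fun w => (triple a b c)⁻¹ • w) (cramer a b c v)
  simp only [smul_smul, inv_mul_cancel₀ h, one_smul, smul_add] at this
  simpa only [div_eq_inv_mul] using this

/-- The embedding of the upper half-plane as the upper sheet of the hyperboloid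
`mform v v = -1`. -/
def hyp (z : ℍ) : Mink := ![z.re / z.im, 1 / z.im, (z.re ^ 2 + z.im ^ 2) / z.im]

theorem mform_hyp_self (z : ℍ) : mform (hyp z) (hyp z) = -1 := by
  have := z.im_pos.ne'
  simp [mform, hyp]
  field_simp
  ring

theorem mform_hyp (z w : ℍ) : mform (hyp z) (hyp w) = -Real.cosh (dist z w) := by
  have h1 := z.im_pos.ne'
  have h2 := w.im_pos.ne'
  rw [UpperHalfPlane.cosh_dist', mform, hyp, hyp]
  simp
  field_simp
  ring

theorem hyp_one_pos (z : ℍ) : 0 < hyp z 1 := by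
  simp [hyp, z.im_pos]

theorem hyp_injective : Function.Injective hyp := by
  intro z w h
  have h1 := congrFun h 1
  have h0 := congrFun h 0
  simp [hyp] at h0 h1
  have hne := w.im_pos.ne'
  rw [h1] at h0
  apply UpperHalfPlane.ext_re_im
  · field_simp at h0; exact h0
  · exact h1

theorem exists_hyp_eq {v : Mink} (h : mform v v = -1) (hv : 0 < v 1) : ∃ z, hyp z = v := by
  refine ⟨⟨⟨v 0 / v 1, 1 / v 1⟩, by simpa using hv⟩, ?_⟩
  have hne := hv.ne'
  simp only [mform] at h
  ext i
  fin_cases i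
  · simp [hyp, UpperHalfPlane.re, UpperHalfPlane.im]; field_simp
  · simp [hyp, UpperHalfPlane.im]
  · simp [hyp, UpperHalfPlane.re, UpperHalfPlane.im]; field_simp; nlinarith

theorem exists_smul_hyp {v : Mink} (h : mform v v < 0) (hv : 0 < v 1) :
    ∃ z, ∃ c : ℝ, 0 < c ∧ v = c • hyp z := by
  set c := √(-mform v v)
  have hc : 0 < c := Real.sqrt_pos.2 (by linarith)
  have hc2 : c ^ 2 = -mform v v := Real.sq_sqrt (by linarith)
  obtain ⟨z, hz⟩ := exists_hyp_eq (v := c⁻¹ • v) (by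
    simp only [mform_smul_left, mform_smul_right]
    field_simp
    linarith) (by simp; positivity)
  exact ⟨z, c, hc, by rw [hz, smul_smul, mul_inv_cancel₀ hc.ne', one_smul]⟩

theorem pos_of_mform_hyp_neg (z : ℍ) {v : Mink} (h : mform v v < 0) (hz : mform (hyp z) v < 0) :
    0 < v 1 := by
  by_contra! hv
  have h1 := hyp_one_pos z
  have hs := mform_hyp_self z
  generalize hyp z = u at *
  simp only [mform] at *
  have h2 : v 1 * v 2 > v 0 ^ 2 := by nlinarith
  have hv1 : v 1 < 0 := lt_of_le_of_ne hv (by rintro h0; rw [h0] at h2; nlinarith [sq_nonneg (v 0)])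
  have hv2 : v 2 < 0 := by
    by_contra! h3
    nlinarith [sq_nonneg (v 0), mul_nonneg h3 (neg_pos.2 hv1).le]
  have hu : u 1 * u 2 = 1 + u 0 ^ 2 := by nlinarith
  have hu2 : 0 < u 2 := by
    by_contra! h3
    nlinarith [sq_nonneg (u 0), mul_nonneg (neg_nonneg.2 h3) h1.le]
  -- arithmetic-geometric mean inequality for `u₁ |v₂|` and `u₂ |v₁|`
  have hA : 0 < u 1 * -v 2 := mul_pos h1 (by linarith)
  have hB : 0 < u 2 * -v 1 := mul_pos hu2 (by linarith)
  have hAB : (u 0 * v 0) ^ 2 ≤ (u 1 * -v 2) * (u 2 * -v 1) := by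
    have : (u 1 * -v 2) * (u 2 * -v 1) = (1 + u 0 ^ 2) * (v 1 * v 2) := by rw [← hu]; ring
    rw [this]
    nlinarith [sq_nonneg (u 0), sq_nonneg (v 0), mul_nonneg (sq_nonneg (u 0)) (sub_pos.2 h2).le]
  nlinarith [sq_nonneg (u 1 * -v 2 - u 2 * -v 1)]

theorem one_le_neg_mform_hyp (z w : ℍ) : mform (hyp z) (hyp w) ≤ -1 := by
  rw [mform_hyp]; linarith [Real.one_le_cosh (dist z w)]

theorem mform_hyp_neg (z w : ℍ) : mform (hyp z) (hyp w) < 0 := by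
  linarith [one_le_neg_mform_hyp z w]

theorem dist_eq_iff_mform {a b c d : ℍ} :
    dist a b = dist c d ↔ mform (hyp a) (hyp b) = mform (hyp c) (hyp d) := by
  rw [mform_hyp, mform_hyp, neg_inj]
  refine ⟨fun h => by rw [h], fun h => ?_⟩
  rw [← Real.arcosh_cosh (x := dist a b) dist_nonneg, h, Real.arcosh_cosh dist_nonneg]

theorem dist_le_iff_mform {a b c d : ℍ} :
    dist a b ≤ dist c d ↔ mform (hyp c) (hyp d) ≤ mform (hyp a) (hyp b) := by
  rw [mform_hyp, mform_hyp, neg_le_neg_iff, Real.cosh_le_cosh, abs_of_nonneg dist_nonneg,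
    abs_of_nonneg dist_nonneg]

/-- A vector of `Mink` is determined by the values of a linear map on the hyperboloid. -/
theorem linearMap_ext_hyp {f g : Mink →ₗ[ℝ] Mink} (h : ∀ z, f (hyp z) = g (hyp z)) : f = g := by
  obtain ⟨a, ha⟩ := exists_hyp_eq (v := ![0, 1, 1]) (by simp [mform]) (by simp)
  obtain ⟨b, hb⟩ := exists_hyp_eq (v := ![0, 1 / 2, 2]) (by simp [mform]) (by simp)
  obtain ⟨c, hc⟩ := exists_hyp_eq (v := ![1, 1, 2]) (by simp [mform]; norm_num) (by simp)
  have hne : triple (hyp a) (hyp b) (hyp c) ≠ 0 := by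
    rw [ha, hb, hc]; simp [triple]; norm_num
  refine LinearMap.ext fun v => ?_
  obtain ⟨x, y, z, rfl⟩ := exists_comb hne v
  simp only [map_add, map_smul, h]

/-! ### Isometries acting linearly -/

/-- The group of isometries of the upper half-plane together with their linear extensions to
`Mink`: pairs of a linear isometry and an isometry that correspond to each other under `hyp`. -/
def Iso : Subgroup ((Mink ≃ₗ[ℝ] Mink) × (ℍ ≃ᵢ ℍ)) where
  carrier := {g | (∀ u v, mform (g.1 u) (g.1 v) = mform u v) ∧ ∀ z, hyp (g.2 z) = g.1 (hyp z)}
  mul_mem' := by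
    rintro a b ⟨ha, ha'⟩ ⟨hb, hb'⟩
    exact ⟨fun u v => by simp [LinearEquiv.mul_apply, ha, hb], fun z => by
      simp [LinearEquiv.mul_apply, IsometryEquiv.mul_apply, ha', hb']⟩
  one_mem' := ⟨fun u v => by simp, fun z => by simp⟩
  inv_mem' := by
    rintro a ⟨ha, ha'⟩
    have hinv : ∀ v, a.1 (a.1⁻¹ v) = v := fun v => by
      rw [← LinearEquiv.mul_apply, mul_inv_cancel]; rfl
    refine ⟨fun u v => ?_, fun z => ?_⟩
    · rw [← ha]; simp only [Prod.fst_inv, hinv]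
    · apply a.1.injective
      rw [← ha']; simp only [Prod.fst_inv, Prod.snd_inv, hinv]
      rw [IsometryEquiv.apply_inv_self]

/-- The linear part of an element of `Iso`. -/
def lin : Iso →* (Mink ≃ₗ[ℝ] Mink) := (MonoidHom.fst _ _).comp Iso.subtype

/-- The isometry of the upper half-plane underlying an element of `Iso`. -/
def isom : Iso →* (ℍ ≃ᵢ ℍ) := (MonoidHom.snd _ _).comp Iso.subtype

@[simp] theorem mform_lin (g : Iso) (u v : Mink) : mform (lin g u) (lin g v) = mform u v :=
  g.2.1 u v

theorem hyp_isom (g : Iso) (z : ℍ) : hyp (isom g z) = lin g (hyp z) := g.2.2 z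

@[simp] theorem lin_mul_apply (g h : Iso) (v : Mink) : lin (g * h) v = lin g (lin h v) := by
  rw [map_mul]; rfl

@[simp] theorem lin_one_apply (v : Mink) : lin 1 v = v := by rw [map_one]; rfl

@[simp] theorem isom_mul_apply (g h : Iso) (z : ℍ) : isom (g * h) z = isom g (isom h z) := by
  rw [map_mul]; rfl

@[simp] theorem isom_one_apply (z : ℍ) : isom 1 z = z := by rw [map_one]; rfl

@[simp] theorem lin_inv_lin (g : Iso) (v : Mink) : lin g⁻¹ (lin g v) = v := by
  rw [← lin_mul_apply, inv_mul_cancel, lin_one_apply]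

@[simp] theorem lin_lin_inv (g : Iso) (v : Mink) : lin g (lin g⁻¹ v) = v := by
  rw [← lin_mul_apply, mul_inv_cancel, lin_one_apply]

theorem mform_lin_left (g : Iso) (u v : Mink) : mform (lin g u) v = mform u (lin g⁻¹ v) := by
  rw [← mform_lin g u, lin_lin_inv]

theorem mform_lin_right (g : Iso) (u v : Mink) : mform u (lin g v) = mform (lin g⁻¹ u) v := by
  rw [mform_comm, mform_lin_left, mform_comm]

theorem iso_ext {g h : Iso} (H : ∀ v, lin g v = lin h v) : g = h := by
  apply Subtype.ext
  apply Prod.ext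
  · exact LinearEquiv.ext H
  · ext1 z
    apply hyp_injective
    exact (hyp_isom g z).trans ((H _).trans (hyp_isom h z).symm)

theorem isom_injective : Function.Injective isom := by
  intro g h H
  apply iso_ext
  have : (lin g : Mink →ₗ[ℝ] Mink) = lin h := by
    apply linearMap_ext_hyp
    intro z
    exact (hyp_isom g z).symm.trans ((by rw [H] : hyp (isom g z) = hyp (isom h z)).trans (hyp_isom h z))
  intro v
  exact congrArg (fun f : Mink →ₗ[ℝ] Mink => f v) this

/-- The linear reflection in the plane orthogonal to the unit vector `e`. -/
def reflLin (e : Mink) (he : mform e e = 1) : Mink ≃ₗ[ℝ] Mink :=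
  LinearEquiv.ofInvolutive
    { toFun := fun v => v - (2 * mform v e) • e
      map_add' := fun u v => by ext i; simp; ring
      map_smul' := fun c v => by ext i; simp; ring }
    (fun v => by ext i; simp [he]; ring)

theorem reflLin_apply (e : Mink) (he : mform e e = 1) (v : Mink) :
    reflLin e he v = v - (2 * mform v e) • e := rfl

theorem mform_reflLin (e : Mink) (he : mform e e = 1) (u v : Mink) :
    mform (reflLin e he u) (reflLin e he v) = mform u v := by
  simp only [reflLin_apply, mform_sub_left, mform_sub_right, mform_smul_left, mform_smul_right, he,
    mform_comm e v]
  ring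

theorem exists_hyp_eq_reflLin (e : Mink) (he : mform e e = 1) (z : ℍ) :
    ∃ w, hyp w = reflLin e he (hyp z) := by
  have h1 : mform (reflLin e he (hyp z)) (reflLin e he (hyp z)) = -1 := by
    rw [mform_reflLin, mform_hyp_self]
  refine exists_hyp_eq h1 (pos_of_mform_hyp_neg z (by rw [h1]; norm_num) ?_)
  rw [reflLin_apply, mform_sub_right, mform_smul_right, mform_hyp_self]
  nlinarith [sq_nonneg (mform (hyp z) e)]

/-- The reflection of the upper half-plane in the geodesic orthogonal to the unit vector `e`. -/
def reflIsom (e : Mink) (he : mform e e = 1) : ℍ ≃ᵢ ℍ where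
  toEquiv := Function.Involutive.toPerm (fun z => (exists_hyp_eq_reflLin e he z).choose) (by
    intro z
    apply hyp_injective
    rw [(exists_hyp_eq_reflLin e he _).choose_spec, (exists_hyp_eq_reflLin e he z).choose_spec]
    exact (reflLin e he).left_inv _)
  isometry_toFun := by
    refine Isometry.of_dist_eq fun z w => ?_
    rw [dist_eq_iff_mform]
    simp only [Function.Involutive.toPerm, Equiv.toFun_as_coe, Equiv.coe_fn_mk]
    rw [(exists_hyp_eq_reflLin e he z).choose_spec, (exists_hyp_eq_reflLin e he w).choose_spec,
      mform_reflLin]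

theorem hyp_reflIsom (e : Mink) (he : mform e e = 1) (z : ℍ) :
    hyp (reflIsom e he z) = reflLin e he (hyp z) :=
  (exists_hyp_eq_reflLin e he z).choose_spec

/-- The reflection in the geodesic orthogonal to the unit vector `e`, as an element of `Iso`. -/
def refl (e : Mink) (he : mform e e = 1) : Iso :=
  ⟨(reflLin e he, reflIsom e he), mform_reflLin e he, hyp_reflIsom e he⟩

theorem lin_refl (e : Mink) (he : mform e e = 1) (v : Mink) :
    lin (refl e he) v = v - (2 * mform v e) • e := rfl

theorem refl_mul_self (e : Mink) (he : mform e e = 1) : refl e he * refl e he = 1 := by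
  apply iso_ext
  intro v
  rw [lin_mul_apply, lin_one_apply]
  exact (reflLin e he).left_inv v

theorem refl_inv (e : Mink) (he : mform e e = 1) : (refl e he)⁻¹ = refl e he :=
  inv_eq_of_mul_eq_one_left (refl_mul_self e he)

/-- Reflections reverse the orientation. -/
theorem triple_refl (e : Mink) (he : mform e e = 1) (u v w : Mink) :
    triple (lin (refl e he) u) (lin (refl e he) v) (lin (refl e he) w) = -triple u v w := by
  have : triple (lin (refl e he) u) (lin (refl e he) v) (lin (refl e he) w)
      = (1 - 2 * mform e e) * triple u v w := by
    simp only [lin_refl, triple, mform, Pi.sub_apply, Pi.smul_apply, smul_eq_mul]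
    ring
  rw [this, he]; ring

/-- Conjugating a reflection gives the reflection in the image geodesic. -/
theorem conj_refl (g : Iso) (e : Mink) (he : mform e e = 1)
    (he' : mform (lin g e) (lin g e) = 1) :
    g * refl e he * g⁻¹ = refl (lin g e) he' := by
  apply iso_ext
  intro v
  simp only [lin_mul_apply, lin_refl, map_sub, map_smul, lin_lin_inv]
  rw [mform_lin_right]

/-- The displacement of the product of the reflections in two disjoint geodesics at distance
`arcosh |mform β β'|` is at least twice this distance: `mform (hyp z) β` and `mform (hyp z) β'` are
constrained by the sign of the Gram determinant of `hyp z`, `β` and `β'`. -/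
theorem two_mul_arcosh_le_dist {β β' : Mink} (h : mform β β = 1) (h' : mform β' β' = 1)
    (hb : 1 ≤ |mform β β'|) (z : ℍ) :
    2 * Real.arcosh |mform β β'| ≤ dist z (isom (refl β h * refl β' h') z) := by
  have hg := gram_nonpos (hyp z) β β'
  rw [mform_hyp_self, h, h'] at hg
  have hc : mform (hyp z) (hyp (isom (refl β h * refl β' h') z))
      = -(1 + 2 * mform (hyp z) β ^ 2 + 2 * mform (hyp z) β' ^ 2
        - 4 * mform (hyp z) β * mform (hyp z) β' * mform β β') := by
    rw [hyp_isom, lin_mul_apply, lin_refl, lin_refl]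
    simp only [mform_sub_left, mform_sub_right, mform_smul_left, mform_smul_right, mform_hyp_self,
      mform_comm β' β]
    ring
  rw [mform_hyp] at hc
  rw [← abs_of_nonneg (a := dist z _) dist_nonneg,
    ← abs_of_nonneg (a := 2 * _) (by linarith [Real.arcosh_nonneg hb]), ← Real.cosh_le_cosh,
    Real.cosh_two_mul, Real.sinh_sq, Real.cosh_arcosh hb, sq_abs]
  nlinarith

/-- Two points on two disjoint geodesics are at least as far apart as these geodesics. -/
theorem arcosh_le_dist_of_mform_eq_zero {β β' : Mink} (h : mform β β = 1) (h' : mform β' β' = 1)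
    {b : ℝ} (hb1 : 1 ≤ b) (hb : b ≤ |mform β β'|) {z w : ℍ} (hz : mform (hyp z) β = 0)
    (hw : mform (hyp w) β' = 0) : Real.arcosh b ≤ dist z w := by
  have h1 := gram_nonpos (hyp z) β β'
  have h2 := gram_nonpos (hyp z) (hyp w) β'
  rw [mform_hyp_self, h, h', hz] at h1
  rw [mform_hyp_self, mform_hyp_self, h', hw, mform_hyp] at h2
  rw [← abs_of_nonneg (a := dist z _) dist_nonneg, ← abs_of_nonneg (Real.arcosh_nonneg hb1),
    ← Real.cosh_le_cosh, Real.cosh_arcosh hb1]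
  have h3 : b ^ 2 ≤ mform β β' ^ 2 := by rw [← sq_abs (mform β β')]; gcongr
  exact (abs_le_of_sq_le_sq' (by nlinarith) (Real.cosh_pos _).le).2

/-! ### Chambers and words in their reflections -/

/-- A hyperbolic triangle given by its three vertices `v i` and the unit normals `e i` of the sides
(`e i` is normal to the side opposite to `v i` and points to the side of `v i`). The angle at `v k`
is `π / m k`; the index of the third vertex is written `-(i + j)`, computed in `ZMod 3`. -/
structure Chamber (m : Fin 3 → ℕ) where
  /-- the unit normals of the sides -/
  e : Fin 3 → Mink
  /-- the vertices -/
  v : Fin 3 → ℍ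
  three_le : ∀ k, 3 ≤ m k
  e_self : ∀ i, mform (e i) (e i) = 1
  e_ne : ∀ i j, i ≠ j → mform (e i) (e j) = -Real.cos (Real.pi / m (-(i + j)))
  v_pos : ∀ i, 0 < mform (hyp (v i)) (e i)
  v_ne : ∀ i j, i ≠ j → mform (hyp (v i)) (e j) = 0

theorem third_eq {i j k : Fin 3} (hij : i ≠ j) (hki : k ≠ i) (hkj : k ≠ j) : -(i + j) = k := by
  decide +revert

theorem exists_third (i j : Fin 3) : ∃ c, c ≠ i ∧ c ≠ j := by
  decide +revert

/-- The product of two determinants as the determinant of the mutual products. -/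
theorem triple_mul_triple (a b c x y z : Mink) :
    mform a x * (mform b y * mform c z - mform b z * mform c y)
      - mform a y * (mform b x * mform c z - mform b z * mform c x)
      + mform a z * (mform b x * mform c y - mform b y * mform c x)
      = -(triple a b c * triple x y z) / 4 := by
  simp only [mform, triple]; ring

/-- The Chebyshev quotient `sin (k π / n) / sin (π / n)`. -/
def cheb (n k : ℕ) : ℝ := Real.sin (k * (Real.pi / n)) / Real.sin (Real.pi / n)

theorem sin_pi_div_pos {n : ℕ} (hn : 2 ≤ n) : 0 < Real.sin (Real.pi / n) := by
  have h2 : (2 : ℝ) ≤ n := by exact_mod_cast hn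
  apply Real.sin_pos_of_pos_of_lt_pi (by positivity)
  exact div_lt_self Real.pi_pos (by linarith)

theorem cheb_zero (n : ℕ) : cheb n 0 = 0 := by simp [cheb]

theorem cheb_one {n : ℕ} (hn : 2 ≤ n) : cheb n 1 = 1 := by
  simp [cheb, (sin_pi_div_pos hn).ne']

theorem cheb_add_two (n k : ℕ) :
    cheb n (k + 2) = 2 * Real.cos (Real.pi / n) * cheb n (k + 1) - cheb n k := by
  simp only [cheb]
  have h1 : Real.sin ((k + 2 : ℕ) * (Real.pi / n)) = 2 * Real.cos (Real.pi / n) *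
      Real.sin ((k + 1 : ℕ) * (Real.pi / n)) - Real.sin (k * (Real.pi / n)) := by
    have e1 : ((k + 2 : ℕ) : ℝ) * (Real.pi / n) = (k + 1 : ℕ) * (Real.pi / n) + Real.pi / n := by
      push_cast; ring
    have e2 : (k : ℝ) * (Real.pi / n) = (k + 1 : ℕ) * (Real.pi / n) - Real.pi / n := by
      push_cast; ring
    rw [e1, e2, Real.sin_add, Real.sin_sub]; ring
  rw [h1]; ring

theorem cheb_nonneg {n k : ℕ} (hn : 2 ≤ n) (hk : k ≤ n) : 0 ≤ cheb n k := by
  apply div_nonneg _ (sin_pi_div_pos hn).le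
  have h0 : (0 : ℝ) < n := by positivity
  apply Real.sin_nonneg_of_nonneg_of_le_pi (by positivity)
  rw [mul_div_assoc', div_le_iff₀ h0, mul_comm]
  gcongr

theorem cheb_self {n : ℕ} (hn : 2 ≤ n) : cheb n n = 0 := by
  have h0 : (n : ℝ) ≠ 0 := by positivity
  rw [cheb, mul_div_cancel₀ _ h0]; simp

theorem cheb_sub {n k : ℕ} (hn : 2 ≤ n) (hk : k ≤ n) : cheb n (n - k) = cheb n k := by
  have h0 : (n : ℝ) ≠ 0 := by positivity
  rw [cheb, cheb, Nat.cast_sub hk, sub_mul, mul_div_cancel₀ _ h0, Real.sin_pi_sub]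

theorem cheb_succ_self {n : ℕ} (hn : 2 ≤ n) : cheb n (n + 1) = -1 := by
  obtain ⟨k, rfl⟩ : ∃ k, n = k + 1 := ⟨n - 1, by omega⟩
  have h := cheb_sub (n := k + 1) (k := 1) hn (by omega)
  rw [cheb_one hn, Nat.add_sub_cancel] at h
  rw [cheb_add_two, cheb_self hn, h]; ring

namespace Chamber

variable {m : Fin 3 → ℕ} (X : Chamber m)

/-- The cosine of the angle at the vertex of index `k`. -/
def cs (_ : Chamber m) (k : Fin 3) : ℝ := Real.cos (Real.pi / m k)

theorem e_mform {i j k : Fin 3} (hij : i ≠ j) (hki : k ≠ i) (hkj : k ≠ j) :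
    mform (X.e i) (X.e j) = -X.cs k := by
  rw [X.e_ne i j hij, third_eq hij hki hkj, cs]

theorem v_e (i j : Fin 3) :
    mform (hyp (X.v i)) (X.e j) = if i = j then mform (hyp (X.v i)) (X.e i) else 0 := by
  split_ifs with h
  · rw [h]
  · exact X.v_ne i j h

theorem triple_ne_zero :
    triple (hyp (X.v 0)) (hyp (X.v 1)) (hyp (X.v 2)) * triple (X.e 0) (X.e 1) (X.e 2) ≠ 0 := by
  have h := triple_mul_triple (hyp (X.v 0)) (hyp (X.v 1)) (hyp (X.v 2)) (X.e 0) (X.e 1) (X.e 2)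
  simp only [X.v_ne 0 1 (by decide), X.v_ne 0 2 (by decide), X.v_ne 1 0 (by decide),
    X.v_ne 1 2 (by decide), X.v_ne 2 0 (by decide), X.v_ne 2 1 (by decide)] at h
  have := mul_pos (X.v_pos 0) (mul_pos (X.v_pos 1) (X.v_pos 2))
  intro h0
  rw [h0] at h
  linarith

theorem exists_comb_e (u : Mink) : ∃ a : Fin 3 → ℝ, u = ∑ i, a i • X.e i := by
  obtain ⟨x, y, z, h⟩ := exists_comb (right_ne_zero_of_mul X.triple_ne_zero) u
  exact ⟨![x, y, z], by simp [Fin.sum_univ_three, h]⟩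

theorem exists_comb_v (u : Mink) : ∃ a : Fin 3 → ℝ, u = ∑ i, a i • hyp (X.v i) := by
  obtain ⟨x, y, z, h⟩ := exists_comb (left_ne_zero_of_mul X.triple_ne_zero) u
  exact ⟨![x, y, z], by simp [Fin.sum_univ_three, h]⟩

/-- The closed cone over the triangle. -/
def cone : Set Mink := {u | ∀ i, 0 ≤ mform u (X.e i)}

/-- The vectors with nonnegative coordinates in the basis `e`, equivalently nonnegative on the
triangle. For the images of the `e i` these are the positive roots. -/
def Pos (u : Mink) : Prop := ∀ k, 0 ≤ mform u (hyp (X.v k))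

variable {X}

theorem Pos.add {u w : Mink} (hu : X.Pos u) (hw : X.Pos w) : X.Pos (u + w) := fun k => by
  rw [mform_add_left]; exact add_nonneg (hu k) (hw k)

theorem Pos.smul {u : Mink} {c : ℝ} (hc : 0 ≤ c) (hu : X.Pos u) : X.Pos (c • u) := fun k => by
  rw [mform_smul_left]; exact mul_nonneg hc (hu k)

theorem pos_e (i : Fin 3) : X.Pos (X.e i) := fun k => by
  rw [mform_comm, X.v_e]
  split_ifs with h
  · exact (X.v_pos k).le
  · rfl

theorem Pos.mform_nonneg {u x : Mink} (hu : X.Pos u) (hx : x ∈ X.cone) : 0 ≤ mform u x := by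
  obtain ⟨a, rfl⟩ := X.exists_comb_e u
  have h : ∀ k, 0 ≤ a k := fun k => by
    have := hu k
    rw [mform_comm] at this
    fin_cases k <;> simp [Fin.sum_univ_three, X.v_ne] at this <;>
      exact nonneg_of_mul_nonneg_left this (X.v_pos _)
  simp only [Fin.sum_univ_three, mform_add_left, mform_smul_left]
  have h0 := mul_nonneg (h 0) (hx 0)
  have h1 := mul_nonneg (h 1) (hx 1)
  have h2 := mul_nonneg (h 2) (hx 2)
  rw [mform_comm] at h0 h1 h2
  linarith

variable (X)

/-- The reflection in the side of index `i`. -/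
def s (i : Fin 3) : Iso := refl (X.e i) (X.e_self i)

theorem s_mul_self (i : Fin 3) : X.s i * X.s i = 1 := refl_mul_self _ _

theorem s_inv (i : Fin 3) : (X.s i)⁻¹ = X.s i := refl_inv _ _

theorem lin_s (i : Fin 3) (u : Mink) : lin (X.s i) u = u - (2 * mform u (X.e i)) • X.e i := rfl

theorem lin_s_self (i : Fin 3) : lin (X.s i) (X.e i) = -X.e i := by
  rw [lin_s, X.e_self]; ext k; simp; ring

theorem lin_s_e {i j k : Fin 3} (hij : i ≠ j) (hki : k ≠ i) (hkj : k ≠ j) :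
    lin (X.s i) (X.e j) = X.e j + (2 * X.cs k) • X.e i := by
  rw [lin_s, X.e_mform hij.symm hkj hki]; ext k; simp

theorem lin_s_v {i k : Fin 3} (h : k ≠ i) : lin (X.s i) (hyp (X.v k)) = hyp (X.v k) := by
  rw [lin_s, X.v_ne k i h]; simp

/-- The product of a word in the reflections in the sides. -/
def wprod (l : List (Fin 3)) : Iso := (l.map X.s).prod

@[simp] theorem wprod_nil : X.wprod [] = 1 := rfl

@[simp] theorem wprod_cons (i : Fin 3) (l : List (Fin 3)) :
    X.wprod (i :: l) = X.s i * X.wprod l := by simp [wprod]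

@[simp] theorem wprod_append (l l' : List (Fin 3)) :
    X.wprod (l ++ l') = X.wprod l * X.wprod l' := by simp [wprod]

theorem wprod_reverse (l : List (Fin 3)) : X.wprod l.reverse = (X.wprod l)⁻¹ := by
  induction l with
  | nil => simp
  | cons i l ih => simp [ih, X.s_inv]

/-- The group generated by the reflections in the sides. -/
def W : Subgroup Iso := Subgroup.closure (Set.range X.s)

theorem s_mem (i : Fin 3) : X.s i ∈ X.W := Subgroup.subset_closure ⟨i, rfl⟩

theorem wprod_mem (l : List (Fin 3)) : X.wprod l ∈ X.W :=
  Subgroup.list_prod_mem _ (by simp only [List.mem_map]; rintro _ ⟨i, -, rfl⟩; exact X.s_mem i)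

theorem exists_wprod {g : Iso} (hg : g ∈ X.W) : ∃ l, X.wprod l = g := by
  induction hg using Subgroup.closure_induction with
  | mem x hx => obtain ⟨i, rfl⟩ := hx; exact ⟨[i], by simp⟩
  | one => exact ⟨[], rfl⟩
  | mul x y _ _ hx hy =>
    obtain ⟨l, rfl⟩ := hx
    obtain ⟨l', rfl⟩ := hy
    exact ⟨l ++ l', by simp⟩
  | inv x _ hx =>
    obtain ⟨l, rfl⟩ := hx
    exact ⟨l.reverse, X.wprod_reverse l⟩

/-- The word length with respect to the reflections in the sides. -/
def len (g : Iso) : ℕ := sInf {n | ∃ l : List (Fin 3), l.length = n ∧ X.wprod l = g}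

theorem len_wprod_le (l : List (Fin 3)) : X.len (X.wprod l) ≤ l.length :=
  Nat.sInf_le ⟨l, rfl, rfl⟩

theorem exists_reduced {g : Iso} (hg : g ∈ X.W) : ∃ l, l.length = X.len g ∧ X.wprod l = g := by
  obtain ⟨l, hl⟩ := X.exists_wprod hg
  exact Nat.sInf_mem (s := {n | ∃ l : List (Fin 3), l.length = n ∧ X.wprod l = g})
    ⟨l.length, l, rfl, hl⟩

theorem len_mul_wprod_le {g : Iso} (hg : g ∈ X.W) (l : List (Fin 3)) :
    X.len (g * X.wprod l) ≤ X.len g + l.length := by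
  obtain ⟨l', h1, rfl⟩ := X.exists_reduced hg
  rw [← wprod_append, ← h1, ← List.length_append]
  exact X.len_wprod_le _

theorem len_mul_s_le {g : Iso} (hg : g ∈ X.W) (i : Fin 3) : X.len (g * X.s i) ≤ X.len g + 1 := by
  simpa using X.len_mul_wprod_le hg [i]

theorem len_le_mul_s {g : Iso} (hg : g ∈ X.W) (i : Fin 3) : X.len g ≤ X.len (g * X.s i) + 1 := by
  have := X.len_mul_s_le (X.W.mul_mem hg (X.s_mem i)) i
  rwa [mul_assoc, X.s_mul_self, mul_one] at this

theorem len_inv_le {g : Iso} (hg : g ∈ X.W) : X.len g⁻¹ ≤ X.len g := by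
  obtain ⟨l, h1, rfl⟩ := X.exists_reduced hg
  rw [← wprod_reverse, ← h1]
  simpa using X.len_wprod_le l.reverse

theorem len_inv {g : Iso} (hg : g ∈ X.W) : X.len g⁻¹ = X.len g :=
  le_antisymm (X.len_inv_le hg) (by simpa using X.len_inv_le (X.W.inv_mem hg))

theorem eq_one_of_len_eq_zero {g : Iso} (hg : g ∈ X.W) (h : X.len g = 0) : g = 1 := by
  obtain ⟨l, h1, rfl⟩ := X.exists_reduced hg
  rw [h, List.length_eq_zero_iff] at h1
  rw [h1]; rfl

theorem triple_wprod (l : List (Fin 3)) (u v w : Mink) :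
    triple (lin (X.wprod l) u) (lin (X.wprod l) v) (lin (X.wprod l) w)
      = (-1) ^ l.length * triple u v w := by
  induction l with
  | nil => simp
  | cons i l ih =>
    simp only [wprod_cons, lin_mul_apply, s, triple_refl, ih, List.length_cons, pow_succ]
    ring

theorem triple_lin {g : Iso} (hg : g ∈ X.W) (u v w : Mink) :
    triple (lin g u) (lin g v) (lin g w) = (-1) ^ X.len g * triple u v w := by
  obtain ⟨l, h1, rfl⟩ := X.exists_reduced hg
  rw [triple_wprod, h1]

theorem len_mul_s {g : Iso} (hg : g ∈ X.W) (i : Fin 3) :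
    X.len (g * X.s i) = X.len g + 1 ∨ X.len g = X.len (g * X.s i) + 1 := by
  have h1 := X.len_mul_s_le hg i
  have h2 := X.len_le_mul_s hg i
  rcases lt_trichotomy (X.len g) (X.len (g * X.s i)) with h | h | h
  · omega
  · exfalso
    have h3 := X.triple_lin (X.W.mul_mem hg (X.s_mem i)) (X.e 0) (X.e 1) (X.e 2)
    simp only [lin_mul_apply] at h3
    rw [X.triple_lin hg, ← h, s, triple_refl] at h3
    have h4 := right_ne_zero_of_mul X.triple_ne_zero
    have h5 : ((-1 : ℝ) ^ X.len g) ≠ 0 := pow_ne_zero _ (by norm_num)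
    have h6 := mul_ne_zero h5 h4
    apply h6
    linarith
  · omega

/-! ### Dihedral words -/

/-- The alternating product `⋯ s b * s a` of `k` reflections with `s a` as its last factor. -/
def alt : Fin 3 → Fin 3 → ℕ → Iso
  | _, _, 0 => 1
  | a, b, k + 1 => alt b a k * X.s a

theorem alt_succ (a b : Fin 3) (k : ℕ) : X.alt a b (k + 1) = X.alt b a k * X.s a := rfl

theorem alt_succ_left (a b : Fin 3) (k : ℕ) :
    X.alt a b (k + 1) = X.s (if Even k then a else b) * X.alt a b k := by
  induction k generalizing a b with
  | zero => simp [alt]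
  | succ k ih =>
    rw [alt_succ, ih, alt_succ, mul_assoc]
    by_cases h : Even k <;> simp [h, Nat.even_add_one]

theorem exists_alt_add (a b : Fin 3) (n k : ℕ) :
    ∃ l : List (Fin 3), l.length = k ∧ X.alt a b (n + k) = X.wprod l * X.alt a b n := by
  induction k with
  | zero => exact ⟨[], rfl, by simp⟩
  | succ k ih =>
    obtain ⟨l, h1, h2⟩ := ih
    exact ⟨_ :: l, by simp [h1], by rw [← add_assoc, alt_succ_left, h2, wprod_cons, mul_assoc]⟩

theorem exists_alt_eq (a b : Fin 3) (k : ℕ) :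
    ∃ l : List (Fin 3), l.length = k ∧ X.alt a b k = X.wprod l := by
  simpa [alt] using X.exists_alt_add a b 0 k

theorem alt_mem (a b : Fin 3) (k : ℕ) : X.alt a b k ∈ X.W := by
  obtain ⟨l, -, h⟩ := X.exists_alt_eq a b k
  rw [h]; exact X.wprod_mem l

variable {X}

theorem two_le (X : Chamber m) (k : Fin 3) : 2 ≤ m k := (by norm_num : 2 ≤ 3).trans (X.three_le k)

/-- The action of an alternating product on a normal of its own dihedral group. -/
theorem lin_alt_e {a b c : Fin 3} (hab : a ≠ b) (hca : c ≠ a) (hcb : c ≠ b) (k : ℕ) :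
    lin (X.alt a b k) (X.e b) =
      if Even k then cheb (m c) (k + 1) • X.e b + cheb (m c) k • X.e a
      else cheb (m c) (k + 1) • X.e a + cheb (m c) k • X.e b := by
  have h0 := cheb_zero (m c)
  have h1 := cheb_one (X.two_le c)
  induction k using Nat.twoStepInduction generalizing a b with
  | zero => simp [alt, h0, h1]
  | one =>
    have h2 := cheb_add_two (m c) 0
    simp only [zero_add, h0, h1] at h2
    simp only [alt, one_mul, X.lin_s_e hab hca hcb, h1, h2, one_add_one_eq_two, cs]
    simp [add_comm]
  | more k ih1 ih2 =>
    have h2 := cheb_add_two (m c) k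
    have h3 := cheb_add_two (m c) (k + 1)
    rw [alt_succ, lin_mul_apply, X.lin_s_e hab hca hcb, map_add, map_smul, ih2 hab.symm hcb hca,
      alt_succ, lin_mul_apply, lin_s_self, map_neg, ih1 hab hca hcb]
    by_cases h : Even k
    · simp only [h, Nat.even_add_one, not_true, not_false_iff, if_true, if_false, h2, h3, cs]
      ext i; simp; ring
    · simp only [h, Nat.even_add_one, not_true, not_false_iff, if_true, if_false, h2, h3, cs]
      ext i; simp; ring

theorem lin_alt_v {a b c : Fin 3} (hca : c ≠ a) (hcb : c ≠ b) (k : ℕ) :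
    lin (X.alt a b k) (hyp (X.v c)) = hyp (X.v c) := by
  induction k generalizing a b with
  | zero => simp [alt]
  | succ k ih => rw [alt_succ, lin_mul_apply, X.lin_s_v hca, ih hcb hca]

theorem triple_e_v_ne_zero {a b c : Fin 3} (hab : a ≠ b) (hca : c ≠ a) (hcb : c ≠ b) :
    triple (X.e a) (X.e b) (hyp (X.v c)) ≠ 0 := by
  have h := gram_eq (X.e a) (X.e b) (hyp (X.v c))
  rw [X.e_self, X.e_self, mform_hyp_self, mform_comm _ (hyp (X.v c)), mform_comm _ (hyp (X.v c)),
    X.v_ne c a hca, X.v_ne c b hcb, X.e_mform hab hca hcb] at h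
  intro h0
  rw [h0] at h
  have h1 := Real.sin_sq_add_cos_sq (Real.pi / m c)
  have h2 := sin_pi_div_pos (X.two_le c)
  simp only [cs] at h
  nlinarith

/-- The braid relation at the vertex of index `c`. -/
theorem alt_comm {a b c : Fin 3} (hab : a ≠ b) (hca : c ≠ a) (hcb : c ≠ b) :
    X.alt a b (m c) = X.alt b a (m c) := by
  obtain ⟨n, hn⟩ : ∃ n, m c = n + 1 := ⟨m c - 1, by have := X.three_le c; omega⟩
  have key : ∀ {a b : Fin 3}, a ≠ b → c ≠ a → c ≠ b →
      lin (X.alt a b (m c)) (X.e b) = lin (X.alt b a (m c)) (X.e b) := by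
    intro a b hab hca hcb
    have h1 := cheb_self (X.two_le c)
    have h2 := cheb_succ_self (X.two_le c)
    have h3 := cheb_sub (X.two_le c) (k := 1) (by omega)
    rw [cheb_one (X.two_le c)] at h3
    have h4 : lin (X.alt b a (m c)) (X.e b) = -lin (X.alt a b n) (X.e b) := by
      rw [hn, alt_succ, lin_mul_apply, lin_s_self, map_neg]
    have h5 : m c - 1 = n := by omega
    rw [h5] at h3
    rw [h4, lin_alt_e hab hca hcb, lin_alt_e hab hca hcb, h1, h2, ← hn, h1, h3]
    by_cases h : Even n
    · have : ¬ Even (m c) := by rw [hn, Nat.even_add_one]; simpa using h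
      simp [h, this]
    · have : Even (m c) := by rw [hn, Nat.even_add_one]; exact h
      simp [h, this]
  apply iso_ext
  intro u
  obtain ⟨x, y, z, rfl⟩ := exists_comb (X.triple_e_v_ne_zero hab hca hcb) u
  simp only [map_add, map_smul, lin_alt_v hca hcb, lin_alt_v hcb hca, key hab hca hcb,
    key hab.symm hcb hca]

/-! ### Positive roots and descents -/

/-- Right multiplication by `s i` increases the length only if the root `g (e i)` is positive
(Tits). The longest alternating suffix of `g` in the two reflections `s i`, `s j`, where `s j` is
a right descent of `g`, is split off; what is left has both `s i` and `s j` as right ascents, and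
the suffix is shorter than the braid relation. -/
theorem pos_of_len_lt {g : Iso} (hg : g ∈ X.W) {i : Fin 3} (hi : X.len g < X.len (g * X.s i)) :
    X.Pos (lin g (X.e i)) := by
  induction hN : X.len g using Nat.strong_induction_on generalizing g i with
  | _ N ih =>
  subst hN
  obtain ⟨l, h1, h2⟩ := X.exists_reduced hg
  rcases List.eq_nil_or_concat l with rfl | ⟨l', j, rfl⟩
  · rw [← h2]; simpa using pos_e i
  have hj : X.len (g * X.s j) < X.len g := by
    have h3 : g * X.s j = X.wprod l' := by
      rw [← h2]; simp [mul_assoc, X.s_mul_self]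
    have h4 := X.len_wprod_le l'
    rw [h3]
    simp at h1
    omega
  have hij : i ≠ j := by rintro rfl; omega
  obtain ⟨c, hci, hcj⟩ : ∃ c, c ≠ i ∧ c ≠ j := exists_third i j
  have hsuf : ∃ k, 1 ≤ k ∧ X.len (g * (X.alt j i k)⁻¹) + k = X.len g ∧
      X.len (g * (X.alt j i (k + 1))⁻¹) + (k + 1) ≠ X.len g := by
    by_contra! hcon
    have hall : ∀ k, 1 ≤ k → X.len (g * (X.alt j i k)⁻¹) + k = X.len g := by
      intro k hk
      induction k, hk using Nat.le_induction with
      | base =>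
        simp only [alt, one_mul, X.s_inv]
        rcases X.len_mul_s hg j with h | h <;> omega
      | succ k hk ih' => exact hcon k hk ih'
    have := hall (X.len g + 1) (by omega)
    omega
  obtain ⟨k, hk1, hk2, hk3⟩ := hsuf
  set w := g * (X.alt j i k)⁻¹ with hw
  have hwW : w ∈ X.W := X.W.mul_mem hg (X.W.inv_mem (X.alt_mem _ _ _))
  have hgw : g = w * X.alt j i k := by simp [hw]
  -- the letter that would lengthen the suffix
  have hd : X.len w < X.len (w * X.s (if Even k then j else i)) := by
    have h3 : w * X.s (if Even k then j else i) = g * (X.alt j i (k + 1))⁻¹ := by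
      rw [alt_succ_left, mul_inv_rev, X.s_inv, hw, mul_assoc]
    rcases X.len_mul_s hwW (if Even k then j else i) with h | h
    · omega
    · rw [h3] at h
      omega
  -- the first letter of the suffix
  have hc : X.len w < X.len (w * X.s (if Even k then i else j)) := by
    obtain ⟨n, rfl⟩ : ∃ n, k = n + 1 := ⟨k - 1, by omega⟩
    have h3 : w * X.s (if Even (n + 1) then i else j) * X.alt j i n = g := by
      have h4 : (if Even (n + 1) then i else j) = if Even n then j else i := by
        by_cases h : Even n <;> simp [h, Nat.even_add_one]
      rw [hgw, alt_succ_left, h4, mul_assoc]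
    obtain ⟨l, hl1, hl2⟩ := X.exists_alt_eq j i n
    have h5 := X.len_mul_wprod_le (X.W.mul_mem hwW (X.s_mem (if Even (n + 1) then i else j))) l
    rw [← hl2, h3, hl1] at h5
    omega
  have hpi : X.Pos (lin w (X.e i)) := by
    apply ih (X.len w) (by omega) hwW _ rfl
    by_cases h : Even k
    · simpa [h] using hc
    · simpa [h] using hd
  have hpj : X.Pos (lin w (X.e j)) := by
    apply ih (X.len w) (by omega) hwW _ rfl
    by_cases h : Even k
    · simpa [h] using hd
    · simpa [h] using hc
  have hkm : k < m c := by
    by_contra! hkm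
    obtain ⟨k', rfl⟩ := Nat.exists_eq_add_of_le hkm
    obtain ⟨l, hl1, hl2⟩ := X.exists_alt_add j i (m c) k'
    obtain ⟨n, hn⟩ : ∃ n, m c = n + 1 := ⟨m c - 1, by have := X.three_le c; omega⟩
    obtain ⟨l', hl1', hl2'⟩ := X.exists_alt_eq j i n
    have h3 : g * X.s i = w * X.wprod (l ++ l') := by
      rw [hgw, hl2, alt_comm hij.symm hcj hci, hn, alt_succ, hl2', wprod_append]
      simp only [mul_assoc, X.s_mul_self, mul_one]
    have h4 := X.len_mul_wprod_le hwW (l ++ l')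
    rw [← h3, List.length_append] at h4
    omega
  have h1 := cheb_nonneg (X.two_le c) (k := k) hkm.le
  have h2 := cheb_nonneg (X.two_le c) (k := k + 1) hkm
  rw [hgw, lin_mul_apply, lin_alt_e hij.symm hcj hci]
  split_ifs
  · rw [map_add, map_smul, map_smul]; exact (hpi.smul h2).add (hpj.smul h1)
  · rw [map_add, map_smul, map_smul]; exact (hpj.smul h2).add (hpi.smul h1)

/-- If `s i` is a left ascent of `g`, then the images under `g` of the triangle lie on the same side
of the wall of index `i` as the triangle. -/
theorem mform_e_nonneg_of_len_lt {g : Iso} (hg : g ∈ X.W) {i : Fin 3}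
    (hi : X.len g < X.len (X.s i * g)) {y : Mink} (hy : lin g⁻¹ y ∈ X.cone) :
    0 ≤ mform y (X.e i) := by
  have h1 : X.len g⁻¹ < X.len (g⁻¹ * X.s i) := by
    have : g⁻¹ * X.s i = (X.s i * g)⁻¹ := by rw [mul_inv_rev, X.s_inv]
    rwa [this, X.len_inv hg, X.len_inv (X.W.mul_mem (X.s_mem i) hg)]
  have h2 := (pos_of_len_lt (X.W.inv_mem hg) h1).mform_nonneg hy
  rwa [mform_lin, mform_comm] at h2

/-- If `s i` is a left descent of `g`, then the wall of index `i` separates the triangle from its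
image under `g`. -/
theorem mform_e_nonpos_of_lt_len {g : Iso} (hg : g ∈ X.W) {i : Fin 3}
    (hi : X.len (X.s i * g) < X.len g) {y : Mink} (hy : lin g⁻¹ y ∈ X.cone) :
    mform y (X.e i) ≤ 0 := by
  have h1 := mform_e_nonneg_of_len_lt (X.W.mul_mem (X.s_mem i) hg) (i := i)
    (by rwa [← mul_assoc, X.s_mul_self, one_mul]) (y := lin (X.s i) y) (by
      rw [mul_inv_rev, lin_mul_apply, lin_inv_lin]; exact hy)
  rw [mform_lin_left, X.s_inv, lin_s_self, mform_neg_right] at h1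
  linarith

theorem len_s_mul (X : Chamber m) {g : Iso} (hg : g ∈ X.W) (i : Fin 3) :
    X.len (X.s i * g) = X.len g + 1 ∨ X.len g = X.len (X.s i * g) + 1 := by
  have h := X.len_mul_s (X.W.inv_mem hg) i
  have h1 : g⁻¹ * X.s i = (X.s i * g)⁻¹ := by rw [mul_inv_rev, X.s_inv]
  rwa [h1, X.len_inv hg, X.len_inv (X.W.mul_mem (X.s_mem i) hg)] at h

theorem exists_left_descent {g : Iso} (hg : g ∈ X.W) (h1 : g ≠ 1) :
    ∃ i, X.len (X.s i * g) < X.len g := by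
  obtain ⟨l, hl, hp⟩ := X.exists_reduced hg
  cases l with
  | nil => exact absurd hp.symm h1
  | cons i l =>
    refine ⟨i, ?_⟩
    rw [← hp] at hl ⊢
    rw [wprod_cons, ← mul_assoc, X.s_mul_self, one_mul, ← wprod_cons, ← hl]
    exact (X.len_wprod_le l).trans_lt (by simp)

end Chamber

/-! ### The tiling covers the upper half-plane -/

/-- The open cone over the upper half-plane. -/
def Fwd (u : Mink) : Prop := ∃ z : ℍ, ∃ c : ℝ, 0 < c ∧ u = c • hyp z

theorem fwd_hyp (z : ℍ) : Fwd (hyp z) := ⟨z, 1, one_pos, (one_smul _ _).symm⟩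

theorem Fwd.smul {u : Mink} {c : ℝ} (hc : 0 < c) : Fwd u → Fwd (c • u) := by
  rintro ⟨z, d, hd, rfl⟩
  exact ⟨z, c * d, mul_pos hc hd, smul_smul _ _ _⟩

theorem Fwd.lin {u : Mink} (g : Iso) : Fwd u → Fwd (lin g u) := by
  rintro ⟨z, d, hd, rfl⟩
  exact ⟨isom g z, d, hd, by rw [map_smul, hyp_isom]⟩

theorem Fwd.add {u w : Mink} : Fwd u → Fwd w → Fwd (u + w) := by
  rintro ⟨z, c, hc, rfl⟩ ⟨z', d, hd, rfl⟩
  apply exists_smul_hyp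
  · have := mform_hyp_neg z z'
    simp only [mform_add_left, mform_add_right, mform_smul_left, mform_smul_right, mform_hyp_self,
      mform_comm (hyp z') (hyp z)]
    nlinarith [mul_pos hc hd, mul_pos hc hc, mul_pos hd hd, mul_pos (mul_pos hc hd) (neg_pos.2 this)]
  · have h1 := hyp_one_pos z
    have h2 := hyp_one_pos z'
    simp only [Pi.add_apply, Pi.smul_apply, smul_eq_mul]
    positivity

/-- Points on different sides of a wall, one of them off the wall. -/
theorem arsinh_le_dist {e : Mink} (he : mform e e = 1) {z w : ℍ} (hz : 0 ≤ mform (hyp z) e)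
    (hw : mform (hyp w) e ≤ 0) : Real.arsinh (mform (hyp z) e) ≤ dist z w := by
  have h := gram_nonpos (hyp z) (hyp w) e
  rw [mform_hyp_self, mform_hyp_self, he, mform_hyp] at h
  have hC := Real.cosh_pos (dist z w)
  have h2 : Real.cosh (Real.arsinh (mform (hyp z) e)) ≤ Real.cosh (dist z w) := by
    rw [Real.cosh_arsinh]
    apply Real.sqrt_le_iff.2 ⟨hC.le, _⟩
    nlinarith [mul_nonneg hC.le (mul_nonneg hz (neg_nonneg.2 hw)), sq_nonneg (mform (hyp w) e)]
  rwa [Real.cosh_le_cosh, abs_of_nonneg (Real.arsinh_nonneg_iff.2 hz), abs_of_nonneg dist_nonneg]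
    at h2

namespace Chamber

variable {m : Fin 3 → ℕ} (X : Chamber m)

/-- The center of the inscribed circle: it is at the same distance from the three sides. -/
theorem exists_incenter : ∃ o : ℍ, ∃ ρ : ℝ, 0 < ρ ∧ ∀ i, mform (hyp o) (X.e i) = ρ := by
  have hf : ∀ i, Fwd ((mform (hyp (X.v i)) (X.e i))⁻¹ • hyp (X.v i)) := fun i =>
    (fwd_hyp _).smul (inv_pos.2 (X.v_pos i))
  obtain ⟨o, c, hc, h⟩ := ((hf 0).add (hf 1)).add (hf 2)
  have key : ∀ i, c * mform (hyp o) (X.e i) = 1 := by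
    intro i
    rw [← mform_smul_left, ← h]
    fin_cases i <;> simp [X.v_ne, (X.v_pos _).ne']
  refine ⟨o, c⁻¹, inv_pos.2 hc, fun i => ?_⟩
  exact eq_inv_of_mul_eq_one_right (key i)

/-- The images of the triangle under the group generated by the reflections in its sides cover the
upper half-plane. The images of an interior point are uniformly separated, so that one of them is
closest to a given point. -/
theorem exists_mem_cone (y : ℍ) : ∃ g ∈ X.W, lin g⁻¹ (hyp y) ∈ X.cone := by
  obtain ⟨p, ρ, hρ, hp⟩ := X.exists_incenter
  have hsep : ∀ g ∈ X.W, g ≠ 1 → Real.arsinh ρ ≤ dist p (isom g p) := by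
    intro g hg h1
    obtain ⟨i, hi⟩ := exists_left_descent hg h1
    rw [← hp i]
    refine arsinh_le_dist (X.e_self i) (by rw [hp]; exact hρ.le) ?_
    rw [hyp_isom]
    exact mform_e_nonpos_of_lt_len hg hi (by
      rw [lin_inv_lin]; intro j; rw [hp]; exact hρ.le)
  set S : Set ℍ := {w | ∃ g ∈ X.W, isom g p = w} with hS
  have hclosed : IsClosed S := by
    apply Metric.isClosed_of_pairwise_le_dist (ε := Real.arsinh ρ) (Real.arsinh_pos_iff.2 hρ)
    rintro _ ⟨g, hg, rfl⟩ _ ⟨h, hh, rfl⟩ hne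
    have h1 : dist (isom g p) (isom h p) = dist p (isom (g⁻¹ * h) p) := by
      rw [← (isom g).isometry.dist_eq p, ← isom_mul_apply, mul_inv_cancel_left]
    rw [h1]
    apply hsep _ (X.W.mul_mem (X.W.inv_mem hg) hh)
    intro h2
    apply hne
    rw [inv_mul_eq_one.1 h2]
  obtain ⟨_, ⟨g, hg, rfl⟩, hmin⟩ := hclosed.exists_infDist_eq_dist ⟨p, 1, X.W.one_mem, by simp⟩ y
  refine ⟨g, hg, fun i => ?_⟩
  have h1 : dist y (isom g p) ≤ dist y (isom (g * X.s i) p) := by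
    rw [← hmin]
    exact Metric.infDist_le_dist_of_mem ⟨_, X.W.mul_mem hg (X.s_mem i), rfl⟩
  rw [dist_le_iff_mform, hyp_isom, hyp_isom, lin_mul_apply, lin_s, map_sub, map_smul,
    mform_sub_right, mform_smul_right, hp, mform_lin_right g _ (X.e i)] at h1
  exact le_of_mul_le_mul_left (by linarith) (mul_pos two_pos hρ)

/-! ### Galleries along a segment -/

theorem affine_nonneg {A B t₀ t t₁ : ℝ} (h0 : t₀ ≤ t) (h1 : t ≤ t₁) (hA : 0 ≤ A + t₀ * B)
    (hB : 0 ≤ A + t₁ * B) : 0 ≤ A + t * B := by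
  rcases le_total 0 B with h | h <;> nlinarith

theorem exists_affine_zero {A B t₀ t₁ : ℝ} (h : t₀ ≤ t₁) (h0 : 0 ≤ A + t₀ * B)
    (h1 : A + t₁ * B ≤ 0) : ∃ t, t₀ ≤ t ∧ t ≤ t₁ ∧ A + t * B = 0 := by
  have hc : ContinuousOn (fun t => A + t * B) (Set.Icc t₀ t₁) := by fun_prop
  obtain ⟨t, ht, h2⟩ := intermediate_value_Icc' h hc ⟨h1, h0⟩
  exact ⟨t, ht.1, ht.2, h2⟩

/-- If a segment runs from the triangle to its image under `g`, then it crosses the walls of some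
reduced gallery between them in order: `l` is a reduced word for `g`, and at the time `τ k` the
segment is in the common side of the triangles of numbers `k` and `k + 1` of the gallery. -/
theorem exists_gallery {g : Iso} (hg : g ∈ X.W) {a b : Mink} {t₀ t₁ : ℝ} (ht : t₀ ≤ t₁)
    (h0 : a + t₀ • b ∈ X.cone) (h1 : lin g⁻¹ (a + t₁ • b) ∈ X.cone) :
    ∃ l : List (Fin 3), ∃ τ : ℕ → ℝ, l.length = X.len g ∧ X.wprod l = g ∧ Monotone τ ∧
      (∀ k, t₀ ≤ τ k ∧ τ k ≤ t₁) ∧ ∀ k, ∀ hk : k < l.length,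
        lin (X.wprod (l.take k))⁻¹ (a + τ k • b) ∈ X.cone ∧
        mform (lin (X.wprod (l.take k))⁻¹ (a + τ k • b)) (X.e l[k]) = 0 := by
  induction hN : X.len g generalizing g a b t₀ with
  | zero =>
    refine ⟨[], fun _ => t₀, rfl, (X.eq_one_of_len_eq_zero hg hN).symm, monotone_const,
      fun _ => ⟨le_rfl, ht⟩, fun k hk => by simp at hk⟩
  | succ N ih =>
    have hne : g ≠ 1 := by
      rintro rfl
      have := X.len_wprod_le []
      simp at this
      omega
    have hpath : ∀ (t : ℝ) i, mform (a + t • b) (X.e i) = mform a (X.e i) + t * mform b (X.e i) := by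
      intro t i; simp
    have hz : ∀ i, ∃ t, X.len (X.s i * g) < X.len g →
        t₀ ≤ t ∧ t ≤ t₁ ∧ mform a (X.e i) + t * mform b (X.e i) = 0 := by
      intro i
      by_cases hi : X.len (X.s i * g) < X.len g
      · obtain ⟨t, h2⟩ := exists_affine_zero ht (by rw [← hpath]; exact h0 i)
          (by rw [← hpath]; exact mform_e_nonpos_of_lt_len hg hi h1)
        exact ⟨t, fun _ => h2⟩
      · exact ⟨0, fun h => absurd h hi⟩
    choose t hzt using hz
    obtain ⟨i₀, hi₀⟩ := exists_left_descent hg hne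
    -- the first wall among those of the left descents of `g` that the segment meets
    obtain ⟨i, hi, hmin⟩ := Finset.exists_min_image
      (Finset.univ.filter fun i => X.len (X.s i * g) < X.len g) t ⟨i₀, by simpa using hi₀⟩
    simp only [Finset.mem_filter, Finset.mem_univ, true_and] at hi hmin
    obtain ⟨hti0, hti1, hti⟩ := hzt i hi
    have hcone : a + t i • b ∈ X.cone := by
      intro j
      rw [hpath]
      by_cases hj : X.len (X.s j * g) < X.len g
      · exact affine_nonneg hti0 (hmin j hj) (by rw [← hpath]; exact h0 j) (hzt j hj).2.2.ge
      · refine affine_nonneg hti0 hti1 (by rw [← hpath]; exact h0 j) ?_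
        rw [← hpath]
        refine mform_e_nonneg_of_len_lt hg ?_ h1
        rcases X.len_s_mul hg j with h | h <;> omega
    have hfix : lin (X.s i) (a + t i • b) = a + t i • b := by
      rw [lin_s, hpath, hti]; simp
    have hx : ∀ u : ℝ, lin (X.s i) a + u • lin (X.s i) b = lin (X.s i) (a + u • b) := by
      intro u; rw [map_add, map_smul]
    have hg' := X.W.mul_mem (X.s_mem i) hg
    obtain ⟨l, τ, hl, hlp, hmono, hτ, hcross⟩ := ih hg' (a := lin (X.s i) a) (b := lin (X.s i) b)
      hti1 (by rw [hx, hfix]; exact hcone)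
      (by rw [hx, mul_inv_rev, lin_mul_apply, lin_inv_lin]; exact h1)
      (by rcases X.len_s_mul hg i with h | h <;> omega)
    refine ⟨i :: l, fun k => Nat.casesOn k (t i) τ, by simp [hl], ?_, ?_, ?_, ?_⟩
    · rw [wprod_cons, hlp, ← mul_assoc, X.s_mul_self, one_mul]
    · apply monotone_nat_of_le_succ
      rintro (_ | k)
      · exact (hτ 0).1
      · exact hmono (Nat.le_succ k)
    · rintro (_ | k)
      · exact ⟨hti0, hti1⟩
      · exact ⟨hti0.trans (hτ k).1, (hτ k).2⟩
    · rintro (_ | k) hk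
      · simp only [List.take_zero, wprod_nil, inv_one, lin_one_apply, List.getElem_cons_zero]
        exact ⟨hcone, by rw [hpath]; exact hti⟩
      · have := hcross k (by simpa using hk)
        simp only [List.take_succ_cons, wprod_cons, mul_inv_rev, lin_mul_apply, X.s_inv,
          List.getElem_cons_succ]
        rwa [hx] at this

end Chamber

/-! ### The axis of a hyperbolic isometry -/

/-- The linear extension to `Mink` of the Möbius transformation of a matrix `g`: with vectors viewed
as symmetric matrices `S`, this is `S ↦ g S gᵀ`. -/
def sl2Lin (g : SL(2, ℝ)) : Mink →ₗ[ℝ] Mink where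
  toFun v := ![g 0 0 * g 1 0 * v 2 + (g 0 0 * g 1 1 + g 0 1 * g 1 0) * v 0 + g 0 1 * g 1 1 * v 1,
    g 1 0 ^ 2 * v 2 + 2 * (g 1 0 * g 1 1) * v 0 + g 1 1 ^ 2 * v 1,
    g 0 0 ^ 2 * v 2 + 2 * (g 0 0 * g 0 1) * v 0 + g 0 1 ^ 2 * v 1]
  map_add' u v := by ext i; fin_cases i <;> simp <;> ring
  map_smul' c v := by ext i; fin_cases i <;> simp <;> ring

theorem det_eq (g : SL(2, ℝ)) : g 0 0 * g 1 1 - g 0 1 * g 1 0 = 1 := by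
  have := g.det_coe
  rwa [Matrix.det_fin_two] at this

theorem hyp_moebius (g : SL(2, ℝ)) (z : ℍ) : hyp (moebius g z) = sl2Lin g (hyp z) := by
  have hd := det_eq g
  have hy := z.im_pos
  have hc : (moebius g z : ℂ) = ((g 0 0 : ℂ) * z + g 0 1) / ((g 1 0 : ℂ) * z + g 1 1) := by
    have := UpperHalfPlane.coe_specialLinearGroup_apply g z
    simp only [Algebra.algebraMap_self, RingHom.id_apply] at this
    exact this
  have hN : 0 < (g 1 0 * z.re + g 1 1) ^ 2 + (g 1 0 * z.im) ^ 2 := by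
    by_contra! h
    have h1 : g 1 0 * z.im = 0 := by nlinarith [sq_nonneg (g 1 0 * z.re + g 1 1), sq_nonneg (g 1 0 * z.im)]
    have h2 : g 1 0 = 0 := by simpa [hy.ne'] using h1
    have h3 : g 1 1 = 0 := by rw [h2] at h; nlinarith [sq_nonneg (g 1 1)]
    rw [h2, h3] at hd; simp at hd
  have hre : (moebius g z).re = ((g 0 0 * z.re + g 0 1) * (g 1 0 * z.re + g 1 1)
      + g 0 0 * g 1 0 * z.im ^ 2) / ((g 1 0 * z.re + g 1 1) ^ 2 + (g 1 0 * z.im) ^ 2) := by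
    rw [← UpperHalfPlane.coe_re, hc, Complex.div_re, Complex.normSq_apply]
    simp
    field_simp
  have him : (moebius g z).im = z.im / ((g 1 0 * z.re + g 1 1) ^ 2 + (g 1 0 * z.im) ^ 2) := by
    rw [← UpperHalfPlane.coe_im, hc, Complex.div_im, Complex.normSq_apply]
    simp
    rw [← sub_div]
    congr 1
    · linear_combination z.im * hd
    · ring
  obtain ⟨N, hNdef⟩ : ∃ N, N = (g 1 0 * z.re + g 1 1) ^ 2 + (g 1 0 * z.im) ^ 2 := ⟨_, rfl⟩
  rw [← hNdef] at hN hre him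
  have hN0 := hN.ne'
  have hy0 := hy.ne'
  ext i
  fin_cases i
  · simp [hyp, sl2Lin, hre, him]
    field_simp
    ring
  · simp [hyp, sl2Lin, him]
    field_simp
    rw [hNdef]
    ring
  · simp [hyp, sl2Lin, hre, him]
    field_simp
    have h4 : (g 0 0 * g 1 1 - g 0 1 * g 1 0) ^ 2 = 1 := by rw [hd]; norm_num
    rw [hNdef]
    linear_combination (-z.im ^ 2) * h4

theorem triple_sl2Lin (g : SL(2, ℝ)) (u v w : Mink) :
    triple (sl2Lin g u) (sl2Lin g v) (sl2Lin g w) = triple u v w := by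
  have : triple (sl2Lin g u) (sl2Lin g v) (sl2Lin g w)
      = (g 0 0 * g 1 1 - g 0 1 * g 1 0) ^ 3 * triple u v w := by
    simp [sl2Lin, triple]; ring
  rw [this, det_eq]; ring

/-- The linear part of an element of `Iso` over a Möbius transformation. -/
theorem lin_eq_sl2Lin {h : Iso} {g : SL(2, ℝ)} (hg : isom h = moebius g) (v : Mink) :
    lin h v = sl2Lin g v := by
  have : (lin h : Mink →ₗ[ℝ] Mink) = sl2Lin g := linearMap_ext_hyp fun z => by
    rw [← hyp_moebius, ← hg]; exact (hyp_isom h z).symm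
  exact congrArg (fun f : Mink →ₗ[ℝ] Mink => f v) this

/-- The symmetric product of two vectors of the plane. -/
def symProd (η ζ : Fin 2 → ℝ) : Mink :=
  ![(η 0 * ζ 1 + η 1 * ζ 0) / 2, η 1 * ζ 1, η 0 * ζ 0]

theorem sl2Lin_symProd (g : SL(2, ℝ)) (η ζ : Fin 2 → ℝ) :
    sl2Lin g (symProd η ζ)
      = symProd ((g : Matrix (Fin 2) (Fin 2) ℝ).mulVec η) ((g : Matrix (Fin 2) (Fin 2) ℝ).mulVec ζ)
    := by
  ext i
  fin_cases i <;> simp [sl2Lin, symProd, Matrix.mulVec, dotProduct, Fin.sum_univ_two] <;> ring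

theorem symProd_smul (c d : ℝ) (η ζ : Fin 2 → ℝ) :
    symProd (c • η) (d • ζ) = (c * d) • symProd η ζ := by
  ext i; fin_cases i <;> simp [symProd] <;> ring

/-- An axis of `h`, with translation length `log ν`: the end points of the axis are given by the null
vectors `a` (repelling) and `b` (attracting), and the points of the axis are on the rays spanned by
the vectors `a + t • b` with `0 < t`. On these, `h` acts as `t ↦ ν ^ 2 * t`. -/
structure Axis (h : Iso) (ν : ℝ) where
  /-- the repelling end point -/
  a : Mink
  /-- the attracting end point -/
  b : Mink
  one_lt : 1 < ν
  mform_a : mform a a = 0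
  mform_b : mform b b = 0
  mform_ab : mform a b < 0
  fwd : ∀ t : ℝ, 0 < t → Fwd (a + t • b)
  lin_a : lin h a = ν⁻¹ • a
  lin_b : lin h b = ν • b

/-- The image of an axis. -/
def Axis.conj {h : Iso} {ν : ℝ} (A : Axis h ν) (g : Iso) : Axis (g⁻¹ * h * g) ν where
  a := lin g⁻¹ A.a
  b := lin g⁻¹ A.b
  one_lt := A.one_lt
  mform_a := by rw [mform_lin, A.mform_a]
  mform_b := by rw [mform_lin, A.mform_b]
  mform_ab := by rw [mform_lin]; exact A.mform_ab
  fwd t ht := by rw [← map_smul, ← map_add]; exact (A.fwd t ht).lin _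
  lin_a := by rw [lin_mul_apply, lin_lin_inv, lin_mul_apply, A.lin_a, map_smul]
  lin_b := by rw [lin_mul_apply, lin_lin_inv, lin_mul_apply, A.lin_b, map_smul]

theorem Axis.lin_path {h : Iso} {ν : ℝ} (A : Axis h ν) (t : ℝ) :
    lin h (A.a + t • A.b) = ν⁻¹ • (A.a + (ν ^ 2 * t) • A.b) := by
  have := A.one_lt
  have hν : ν ≠ 0 := by linarith
  rw [map_add, map_smul, A.lin_a, A.lin_b, smul_add, smul_smul, smul_smul]
  congr 2
  field_simp

/-- If an axis meets two walls at the times `t ≤ t'`, then the hyperbolic distance of these walls is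
at most `log (t' / t) / 2`. -/
theorem Axis.arcosh_le {h : Iso} {ν : ℝ} (A : Axis h ν) {β β' : Mink} (hβ : mform β β = 1)
    (hβ' : mform β' β' = 1) {c : ℝ} (hc1 : 1 ≤ c) (hc : c ≤ |mform β β'|) {t t' : ℝ} (ht : 0 < t)
    (htt : t ≤ t') (h1 : mform (A.a + t • A.b) β = 0) (h2 : mform (A.a + t' • A.b) β' = 0) :
    2 * Real.arcosh c ≤ Real.log t' - Real.log t := by
  have ht' := ht.trans_le htt
  obtain ⟨z, d, hd, hz⟩ := A.fwd t ht
  obtain ⟨w, d', hd', hw⟩ := A.fwd t' ht'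
  have hkey := arcosh_le_dist_of_mform_eq_zero hβ hβ' hc1 hc (z := z) (w := w)
    (by rw [hz, mform_smul_left] at h1; simpa [hd.ne'] using h1)
    (by rw [hw, mform_smul_left] at h2; simpa [hd'.ne'] using h2)
  have e1 : mform (A.a + t • A.b) (A.a + t • A.b) = d ^ 2 * -1 := by
    rw [hz, mform_smul_left, mform_smul_right, mform_hyp_self]; ring
  have e2 : mform (A.a + t' • A.b) (A.a + t' • A.b) = d' ^ 2 * -1 := by
    rw [hw, mform_smul_left, mform_smul_right, mform_hyp_self]; ring
  have e3 : mform (A.a + t • A.b) (A.a + t' • A.b) = d * d' * -Real.cosh (dist z w) := by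
    rw [hz, hw, mform_smul_left, mform_smul_right, mform_hyp]; ring
  simp only [mform_add_left, mform_add_right, mform_smul_left, mform_smul_right, A.mform_a,
    A.mform_b, mform_comm A.b A.a] at e1 e2 e3
  have hx : 0 ≤ (Real.log t' - Real.log t) / 2 := by
    have := Real.log_le_log ht htt
    linarith
  set x := (Real.log t' - Real.log t) / 2 with hxdef
  have hex : Real.exp x ^ 2 * t = t' := by
    rw [← Real.exp_nat_mul, hxdef]
    push_cast
    rw [mul_div_cancel₀ _ two_ne_zero, Real.exp_sub, Real.exp_log ht', Real.exp_log ht,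
      div_mul_cancel₀ _ ht.ne']
  have hcosh : Real.cosh (dist z w) = Real.cosh x := by
    have hE := Real.exp_pos x
    have h5 : Real.cosh x = (Real.exp x ^ 2 + 1) / (2 * Real.exp x) := by
      rw [Real.cosh_eq, Real.exp_neg]; field_simp
    rw [h5, eq_div_iff (by positivity)]
    -- both sides are positive and their squares agree
    have hd2 : d ^ 2 = -(2 * t * mform A.a A.b) := by linarith
    have hd2' : d' ^ 2 = -(2 * t' * mform A.a A.b) := by linarith
    have h6 : d' = Real.exp x * d := by
      have : d' ^ 2 = (Real.exp x * d) ^ 2 := by rw [hd2', mul_pow, hd2, ← hex]; ring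
      exact (pow_left_inj₀ hd'.le (by positivity) two_ne_zero).1 this
    rw [h6] at e3
    have h7 : d ^ 2 * (Real.cosh (dist z w) * (2 * Real.exp x)) =
        d ^ 2 * (Real.exp x ^ 2 + 1) := by
      have : d ^ 2 * (Real.cosh (dist z w) * (2 * Real.exp x)) = -(2 * ((t + t') * mform A.a A.b)) := by
        linarith
      rw [this, hd2, ← hex]; ring
    exact mul_left_cancel₀ (by positivity) h7
  have : dist z w = x := by
    rw [← Real.arcosh_cosh (x := dist z w) dist_nonneg, hcosh, Real.arcosh_cosh hx]
  rw [this, hxdef] at hkey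
  linarith

/-- A hyperbolic isometry has an axis, and displaces every point by at least the translation length
`log ν` of the axis. -/
theorem exists_axis {h : Iso} (hh : IsHyperbolic (isom h)) :
    ∃ ν : ℝ, Nonempty (Axis h ν) ∧ ∀ z, Real.log ν ≤ dist z (isom h z) := by
  obtain ⟨g, hg, hd⟩ := hh
  have hdet := det_eq g
  have hL := lin_eq_sl2Lin hg.symm
  have hD : 0 < (g 0 0 + g 1 1) ^ 2 - 4 := by
    have : (g : Matrix (Fin 2) (Fin 2) ℝ).discr = (g 0 0 + g 1 1) ^ 2 - 4 := by
      rw [Matrix.discr_fin_two, Matrix.trace_fin_two, g.det_coe]; ring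
    rw [← this]; exact hd
  -- the two eigenvalues `μ` and `μ⁻¹`, where `1 < μ ^ 2`
  obtain ⟨μ, μ', hμ1, hμ', hsum⟩ : ∃ μ μ' : ℝ, 1 < μ ^ 2 ∧ μ * μ' = 1 ∧ μ + μ' = g 0 0 + g 1 1 := by
    set r := √((g 0 0 + g 1 1) ^ 2 - 4) with hr
    have hr2 : r ^ 2 = (g 0 0 + g 1 1) ^ 2 - 4 := Real.sq_sqrt hD.le
    have hr0 : 0 < r := Real.sqrt_pos.2 hD
    rcases le_total 0 (g 0 0 + g 1 1) with h0 | h0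
    · refine ⟨(g 0 0 + g 1 1 + r) / 2, (g 0 0 + g 1 1 - r) / 2, by nlinarith, by nlinarith, by ring⟩
    · refine ⟨(g 0 0 + g 1 1 - r) / 2, (g 0 0 + g 1 1 + r) / 2, by nlinarith, by nlinarith, by ring⟩
  have heig : ∀ x : ℝ, x ^ 2 - (g 0 0 + g 1 1) * x + 1 = 0 →
      ∃ η : Fin 2 → ℝ, η ≠ 0 ∧ (g : Matrix (Fin 2) (Fin 2) ℝ).mulVec η = x • η := by
    intro x hx
    obtain ⟨η, h0, h1⟩ := (Matrix.exists_mulVec_eq_zero_iff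
      (M := (g : Matrix (Fin 2) (Fin 2) ℝ) - Matrix.scalar _ x)).2 (by
        rw [Matrix.det_fin_two]; simp; linarith)
    refine ⟨η, h0, ?_⟩
    rw [Matrix.sub_mulVec, sub_eq_zero] at h1
    rw [h1]; ext i; simp [Matrix.mulVec_diagonal]
  obtain ⟨η, hη0, hη⟩ := heig μ (by rw [← hsum, ← hμ']; ring)
  obtain ⟨ζ, hζ0, hζ⟩ := heig μ' (by rw [← hsum, ← hμ']; ring)
  have hμ0 : μ ≠ 0 := by rintro rfl; norm_num at hμ1
  have hμ'' : μ' = μ⁻¹ := eq_inv_of_mul_eq_one_right hμ'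
  have hne : μ ≠ μ' := by
    rintro rfl
    nlinarith
  -- the two eigenvectors are independent
  have hδ : η 0 * ζ 1 - η 1 * ζ 0 ≠ 0 := by
    intro h0
    have hs : ∀ i, η i • ζ = ζ i • η := by
      intro i; ext j; fin_cases i <;> fin_cases j <;> simp <;> linarith
    apply hζ0
    obtain ⟨i, hi⟩ := Function.ne_iff.1 hη0
    have h1 := congrArg (fun w => (g : Matrix (Fin 2) (Fin 2) ℝ).mulVec w) (hs i)
    simp only [Matrix.mulVec_smul, hη, hζ] at h1
    rw [smul_comm, smul_comm (ζ i), ← hs i, ← sub_eq_zero, ← sub_smul, smul_smul] at h1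
    exact (smul_eq_zero.1 h1).resolve_left (mul_ne_zero (sub_ne_zero.2 hne.symm) hi)
  have hla : lin h (symProd ζ ζ) = (μ ^ 2)⁻¹ • symProd ζ ζ := by
    rw [hL, sl2Lin_symProd, hζ, symProd_smul, hμ'']; congr 1; ring
  have hlb : lin h (symProd η η) = μ ^ 2 • symProd η η := by
    rw [hL, sl2Lin_symProd, hη, symProd_smul]; congr 1; ring
  have hln : lin h (symProd η ζ) = symProd η ζ := by
    rw [hL, sl2Lin_symProd, hη, hζ, symProd_smul, hμ', one_smul]
  set δ := η 0 * ζ 1 - η 1 * ζ 0 with hδdef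
  have haa : mform (symProd ζ ζ) (symProd ζ ζ) = 0 := by simp [mform, symProd]; ring
  have hbb : mform (symProd η η) (symProd η η) = 0 := by simp [mform, symProd]; ring
  have hnn : mform (symProd η ζ) (symProd η ζ) = δ ^ 2 / 4 := by
    simp [mform, symProd, hδdef]; ring
  have hna : mform (symProd η ζ) (symProd ζ ζ) = 0 := by simp [mform, symProd]; ring
  have hnb : mform (symProd η ζ) (symProd η η) = 0 := by simp [mform, symProd]; ring
  have hab : mform (symProd ζ ζ) (symProd η η) = -δ ^ 2 / 2 := by
    simp [mform, symProd, hδdef]; ring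
  have hδ2 : 0 < δ ^ 2 := by positivity
  clear_value δ
  refine ⟨μ ^ 2, ⟨⟨symProd ζ ζ, symProd η η, hμ1, haa, hbb, by rw [hab]; linarith, ?_, hla, hlb⟩⟩, ?_⟩
  · intro t ht
    apply exists_smul_hyp
    · simp only [mform_add_left, mform_add_right, mform_smul_left, mform_smul_right, haa, hbb,
        mform_comm (symProd η η) (symProd ζ ζ), hab]
      nlinarith
    · simp only [symProd, Pi.add_apply, Pi.smul_apply, smul_eq_mul]
      simp
      by_contra! h0
      have h1 : ζ 1 = 0 := by nlinarith [mul_self_nonneg (ζ 1), mul_nonneg ht.le (mul_self_nonneg (η 1))]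
      have h2 : η 1 = 0 := by
        rw [h1] at h0
        have : η 1 * η 1 ≤ 0 := by
          by_contra! h3
          nlinarith [mul_pos ht h3]
        nlinarith
      apply hδ; rw [hδdef, h1, h2]; ring
  · intro z
    have htr : triple (symProd ζ ζ) (symProd η η) (symProd η ζ) ≠ 0 := by
      intro h0
      have h1 := gram_eq (symProd ζ ζ) (symProd η η) (symProd η ζ)
      rw [h0, haa, hbb, hab, hnn, mform_comm _ (symProd η ζ), mform_comm _ (symProd η ζ), hna,
        hnb] at h1
      have : 0 < δ ^ 2 * δ ^ 2 * δ ^ 2 := by positivity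
      nlinarith
    obtain ⟨A, B, C, hz⟩ := exists_comb htr (hyp z)
    have h1 := mform_hyp_self z
    have h2 := mform_hyp z (isom h z)
    rw [hyp_isom] at h2
    rw [hz] at h1 h2
    simp only [map_add, map_smul, hla, hlb, hln, mform_add_left, mform_add_right, mform_smul_left,
      mform_smul_right, haa, hbb, hnn, hna, hnb, hab, mform_comm (symProd η η) (symProd ζ ζ),
      mform_comm (symProd η η) (symProd η ζ), mform_comm (symProd ζ ζ) (symProd η ζ)] at h1 h2
    have hν0 : 0 < μ ^ 2 := by linarith
    rw [← abs_of_nonneg (a := dist z _) dist_nonneg, ← abs_of_nonneg (Real.log_nonneg hμ1.le),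
      ← Real.cosh_le_cosh, Real.cosh_log hν0]
    have h3 : 1 ≤ (μ ^ 2 + (μ ^ 2)⁻¹) / 2 := by
      rw [← Real.cosh_log hν0]; exact Real.one_le_cosh _
    have hP : A * B * δ ^ 2 = 1 + C ^ 2 * δ ^ 2 / 4 := by linear_combination -h1
    have h4 : Real.cosh (dist z (isom h z)) =
        (A * B * δ ^ 2) * ((μ ^ 2 + (μ ^ 2)⁻¹) / 2) - C ^ 2 * δ ^ 2 / 4 := by
      linear_combination h2
    have h5 : 0 ≤ C ^ 2 * δ ^ 2 / 4 := by positivity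
    rw [h4, hP]
    linear_combination mul_nonneg h5 (sub_nonneg.2 h3)

/-! ### The periodic word of a hyperbolic element -/

namespace Chamber

variable {m : Fin 3 → ℕ} (X : Chamber m)

/-- The product `s (i a) * ⋯ * s (i (a + n - 1))` of `n` consecutive letters of an infinite word. -/
def segProd (i : ℕ → Fin 3) (a n : ℕ) : Iso := X.wprod ((List.range' a n).map i)

variable {X}

@[simp] theorem segProd_zero (i : ℕ → Fin 3) (a : ℕ) : X.segProd i a 0 = 1 := rfl

theorem segProd_add (i : ℕ → Fin 3) (a n k : ℕ) :
    X.segProd i a (n + k) = X.segProd i a n * X.segProd i (a + n) k := by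
  rw [segProd, segProd, segProd, ← wprod_append, ← List.map_append, List.range'_append_1]

theorem segProd_succ (i : ℕ → Fin 3) (a n : ℕ) :
    X.segProd i a (n + 1) = X.segProd i a n * X.s (i (a + n)) := by
  rw [segProd_add]; simp [segProd]

theorem segProd_mem (i : ℕ → Fin 3) (a n : ℕ) : X.segProd i a n ∈ X.W := X.wprod_mem _

theorem segProd_periodic {i : ℕ → Fin 3} {N : ℕ} (hi : ∀ n, i (n + N) = i n) (a n : ℕ) :
    X.segProd i (a + N) n = X.segProd i a n := by
  induction n with
  | zero => rfl
  | succ n ih => rw [segProd_succ, segProd_succ, ih, add_right_comm, hi]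

/-- The walls before and after three consecutive crossings of walls of different types are disjoint,
at a distance determined by the angles. -/
theorem mform_of_switch {x y z : Fin 3} (hxy : x ≠ y) (hxz : x ≠ z) (hyz : y ≠ z) (g : Iso) :
    mform (lin g (X.e x)) (lin (g * (X.s x * X.s y)) (X.e z))
      = X.cs y + 2 * X.cs x * X.cs z := by
  rw [lin_mul_apply, mform_lin, lin_mul_apply, X.lin_s_e hyz hxy hxz, mform_lin_right, X.s_inv,
    lin_s_self, mform_add_right, mform_smul_right, mform_neg_left, mform_neg_left,
    X.e_mform hxz hxy.symm hyz, X.e_mform hxy hxz.symm hyz.symm]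
  ring

variable (X)

/-- A periodic infinite word whose periods, of length `N`, represent conjugates of `h`: it lists the
types of the walls that the axis of `h` meets along a gallery. Its periods are shortest words, and
three disjoint places where the types of three consecutive walls are different contribute to the
displacement of `h`. -/
structure PeriodicWord (h : Iso) (N : ℕ) (i : ℕ → Fin 3) : Prop where
  pos : 0 < N
  even : Even N
  periodic : ∀ n, i (n + N) = i n
  conj : ∀ n, ∃ g ∈ X.W, X.segProd i n N = g⁻¹ * h * g
  le_length : ∀ n l, X.wprod l = X.segProd i n N → N ≤ l.length
  ne_self : ∀ z, isom h z ≠ z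
  three_mul_arcosh_le : ∀ c : ℝ, 1 ≤ c →
    (∀ x y z : Fin 3, x ≠ y → x ≠ z → y ≠ z → c ≤ X.cs y + 2 * X.cs x * X.cs z) →
    ∀ n₁ n₂ n₃ : ℕ, n₁ + 2 ≤ n₂ → n₂ + 2 ≤ n₃ → n₃ + 2 ≤ n₁ + N →
    (∀ n ∈ [n₁, n₂, n₃], i n ≠ i (n + 1) ∧ i n ≠ i (n + 2) ∧ i (n + 1) ≠ i (n + 2)) →
    ∀ z, 3 * Real.arcosh c ≤ dist z (isom h z)

variable {X}

theorem smul_mem_cone {c : ℝ} (hc : 0 ≤ c) {u : Mink} (hu : u ∈ X.cone) : c • u ∈ X.cone :=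
  fun i => by rw [mform_smul_left]; exact mul_nonneg hc (hu i)

/-- Every hyperbolic element of the group has a periodic word. Among the conjugates whose axis meets
the triangle, one of minimal length is taken; a gallery along one period of its axis gives the
word. -/
theorem exists_periodicWord {h : Iso} (hW : h ∈ X.W) (hdir : isom h ∈ directIsometries)
    (hh : IsHyperbolic (isom h)) : ∃ N i, X.PeriodicWord h N i := by
  classical
  obtain ⟨ν, ⟨A⟩, hdisp⟩ := exists_axis hh
  have hν1 := A.one_lt
  have hν0 : 0 < ν := by linarith
  -- a conjugate of minimal length whose axis meets the triangle
  have hex : ∃ n, ∃ g ∈ X.W, ∃ t : ℝ, 0 < t ∧ lin g⁻¹ (A.a + t • A.b) ∈ X.cone ∧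
      X.len (g⁻¹ * h * g) = n := by
    obtain ⟨z, c, hc, hz⟩ := A.fwd 1 one_pos
    obtain ⟨g, hg, hgz⟩ := X.exists_mem_cone z
    exact ⟨_, g, hg, 1, one_pos, by rw [hz, map_smul]; exact smul_mem_cone hc.le hgz, rfl⟩
  obtain ⟨g, hg, t₀, ht₀, hcone, hlen⟩ := Nat.find_spec hex
  have hmin : ∀ g' ∈ X.W, ∀ t : ℝ, 0 < t → lin g'⁻¹ (A.a + t • A.b) ∈ X.cone →
      Nat.find hex ≤ X.len (g'⁻¹ * h * g') := fun g' hg' t ht hc =>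
    Nat.find_min' hex ⟨g', hg', t, ht, hc, rfl⟩
  generalize Nat.find hex = N at hlen hmin
  set h' := g⁻¹ * h * g with hh'
  have hW' : h' ∈ X.W := X.W.mul_mem (X.W.mul_mem (X.W.inv_mem hg) hW) hg
  set A' : Axis h' ν := A.conj g with hA'
  have hpath : ∀ t : ℝ, lin g⁻¹ (A.a + t • A.b) = A'.a + t • A'.b := fun t => by
    rw [map_add, map_smul]; rfl
  rw [hpath] at hcone
  have hback : ∀ t : ℝ, lin h'⁻¹ (A'.a + (ν ^ 2 * t) • A'.b) = ν • (A'.a + t • A'.b) := by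
    intro t
    rw [← lin_inv_lin h' (ν • _), map_smul, A'.lin_path, smul_smul, mul_inv_cancel₀ hν0.ne',
      one_smul]
  obtain ⟨l, τ, hl, hlp, hmono, hτ, hcross⟩ := X.exists_gallery hW' (a := A'.a) (b := A'.b)
    (t₀ := t₀) (t₁ := ν ^ 2 * t₀) (le_mul_of_one_le_left ht₀.le (one_le_pow₀ hν1.le)) hcone
    (by rw [hback]; exact smul_mem_cone hν0.le hcone)
  rw [hlen] at hl
  have hne : ∀ z, isom h z ≠ z := by
    intro z hz
    have := hdisp z
    rw [hz, dist_self] at this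
    exact absurd (Real.log_pos hν1) (not_lt.2 this)
  have hN : 0 < N := by
    rcases Nat.eq_zero_or_pos N with h0 | h0
    · exfalso
      have h1 : h' = 1 := X.eq_one_of_len_eq_zero hW' (hlen.trans h0)
      have h2 : h = 1 := by
        have : h = g * h' * g⁻¹ := by rw [hh']; group
        rw [this, h1]; group
      exact hne UpperHalfPlane.I (by rw [h2, isom_one_apply])
    · exact h0
  have hNe : Even N := by
    rw [← hlen]
    obtain ⟨γ, hγ⟩ := hdir
    have h1 := X.triple_lin hW' (X.e 0) (X.e 1) (X.e 2)
    have h2 : ∀ u v w, triple (lin h u) (lin h v) (lin h w) = triple u v w := fun u v w => by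
      simp only [lin_eq_sl2Lin hγ.symm, triple_sl2Lin]
    have h3 := X.triple_lin hg (lin g⁻¹ (X.e 0)) (lin g⁻¹ (X.e 1)) (lin g⁻¹ (X.e 2))
    have h4 := X.triple_lin (X.W.inv_mem hg) (lin h (lin g (X.e 0))) (lin h (lin g (X.e 1)))
      (lin h (lin g (X.e 2)))
    have h5 := X.triple_lin hg (X.e 0) (X.e 1) (X.e 2)
    simp only [hh', lin_mul_apply] at h1
    rw [h4, h2, h5, X.len_inv hg, ← mul_assoc, ← pow_add, Even.neg_one_pow ⟨_, rfl⟩, one_mul] at h1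
    by_contra hodd
    rw [Nat.not_even_iff_odd.1 hodd |>.neg_one_pow] at h1
    exact right_ne_zero_of_mul X.triple_ne_zero (by linarith)
  -- the periodic extensions of the word and of the crossing times
  set i : ℕ → Fin 3 := fun n => l[n % N]'(by rw [hl]; exact Nat.mod_lt _ hN) with hi
  set τ' : ℕ → ℝ := fun n => (ν ^ 2) ^ (n / N) * τ (n % N) with hτ'
  have hper : ∀ n, i (n + N) = i n := fun n => by simp [hi]
  have hτper : ∀ n, τ' (n + N) = ν ^ 2 * τ' n := fun n => by
    simp only [hτ', Nat.add_div_right _ hN, Nat.add_mod_right, pow_succ]; ring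
  have hτ0 : ∀ k, 0 < τ k := fun k => ht₀.trans_le (hτ k).1
  have hτ'0 : ∀ n, 0 < τ' n := fun n => mul_pos (by positivity) (hτ0 _)
  have hmono' : Monotone τ' := by
    apply monotone_nat_of_le_succ
    intro n
    have hdm := Nat.div_add_mod n N
    have hml := Nat.mod_lt n hN
    have hle : τ (n % N) ≤ ν ^ 2 * τ 0 :=
      (hτ _).2.trans (mul_le_mul_of_nonneg_left (hτ 0).1 (by positivity))
    rcases Nat.lt_or_ge (n % N + 1) N with h1 | h1
    · obtain ⟨e1, e2⟩ := (Nat.div_mod_unique (a := n + 1) (d := n / N) (c := n % N + 1) hN).2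
        ⟨by omega, h1⟩
      simp only [hτ', e1, e2]
      exact mul_le_mul_of_nonneg_left (hmono (Nat.le_succ _)) (by positivity)
    · have e0 : n + 1 = N * (n / N + 1) := by rw [mul_add, mul_one]; omega
      have e1 : (n + 1) / N = n / N + 1 := by rw [e0, Nat.mul_div_cancel_left _ hN]
      have e2 : (n + 1) % N = 0 := by rw [e0, Nat.mul_mod_right]
      simp only [hτ', e1, e2]
      rw [pow_succ (ν ^ 2), mul_assoc]
      exact mul_le_mul_of_nonneg_left hle (by positivity)
  have htake : ∀ k ≤ N, X.segProd i 0 k = X.wprod (l.take k) := by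
    intro k hk
    rw [segProd]
    congr 1
    apply List.ext_getElem
    · simp; omega
    · intro j h1 h2
      have h3 : j < N := by simp at h1; omega
      simp [hi, Nat.mod_eq_of_lt h3]
  have hfull : X.segProd i 0 N = h' := by
    rw [htake N le_rfl, ← hl, List.take_length, hlp]
  have hshift : ∀ n, X.segProd i 0 (n + N) = h' * X.segProd i 0 n := by
    intro n
    rw [add_comm, segProd_add, hfull, segProd_periodic hper]
  have hall : ∀ n, lin (X.segProd i 0 n)⁻¹ (A'.a + τ' n • A'.b) ∈ X.cone ∧
      mform (lin (X.segProd i 0 n)⁻¹ (A'.a + τ' n • A'.b)) (X.e (i n)) = 0 := by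
    intro n
    induction n using Nat.strong_induction_on with
    | _ n ih =>
    rcases Nat.lt_or_ge n N with h1 | h1
    · have := hcross n (by omega)
      rw [htake n h1.le]
      simp only [hτ', hi, Nat.mod_eq_of_lt h1, Nat.div_eq_of_lt h1, pow_zero, one_mul]
      exact this
    · obtain ⟨k, rfl⟩ := Nat.exists_eq_add_of_le' h1
      obtain ⟨h2, h3⟩ := ih k (by omega)
      rw [hshift, mul_inv_rev, lin_mul_apply, hτper, hback, map_smul, hper, mform_smul_left, h3]
      exact ⟨smul_mem_cone hν0.le h2, mul_zero _⟩
  have hconj : ∀ n, X.segProd i n N = (X.segProd i 0 n)⁻¹ * h' * X.segProd i 0 n := by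
    intro n
    rw [mul_assoc, ← hshift, segProd_add, zero_add, inv_mul_cancel_left]
  refine ⟨N, i, hN, hNe, hper, fun n => ⟨g * X.segProd i 0 n, X.W.mul_mem hg (segProd_mem _ _ _),
    ?_⟩, ?_, hne, ?_⟩
  · rw [hconj, hh']; group
  · intro n l' hl'
    have h1 := hmin (g * X.segProd i 0 n) (X.W.mul_mem hg (segProd_mem _ _ _)) (τ' n) (hτ'0 n)
      (by rw [mul_inv_rev, lin_mul_apply, hpath]; exact (hall n).1)
    have h2 : (g * X.segProd i 0 n)⁻¹ * h * (g * X.segProd i 0 n) = X.segProd i n N := by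
      rw [hconj, hh']; group
    rw [h2, ← hl'] at h1
    exact h1.trans (X.len_wprod_le l')
  · intro c hc1 hc n₁ n₂ n₃ h12 h23 h31 hsw z
    have hblock : ∀ n ∈ [n₁, n₂, n₃],
        2 * Real.arcosh c ≤ Real.log (τ' (n + 2)) - Real.log (τ' n) := by
      intro n hn
      obtain ⟨hxy, hxz, hyz⟩ := hsw n hn
      have h1 : X.segProd i 0 (n + 2) = X.segProd i 0 n * (X.s (i n) * X.s (i (n + 1))) := by
        rw [segProd_succ, segProd_succ, zero_add, zero_add, mul_assoc]
      refine A'.arcosh_le (β := lin (X.segProd i 0 n) (X.e (i n)))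
        (β' := lin (X.segProd i 0 (n + 2)) (X.e (i (n + 2)))) (by rw [mform_lin, X.e_self])
        (by rw [mform_lin, X.e_self]) hc1 ?_ (hτ'0 n) (hmono' (by omega)) ?_ ?_
      · rw [h1, mform_of_switch hxy hxz hyz]
        exact (hc _ _ _ hxy hxz hyz).trans (le_abs_self _)
      · rw [mform_lin_right]; exact (hall n).2
      · rw [mform_lin_right]; exact (hall (n + 2)).2
    have b1 := hblock n₁ (by simp)
    have b2 := hblock n₂ (by simp)
    have b3 := hblock n₃ (by simp)
    have c1 := Real.log_le_log (hτ'0 _) (hmono' h12)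
    have c2 := Real.log_le_log (hτ'0 _) (hmono' h23)
    have c3 := Real.log_le_log (hτ'0 _) (hmono' h31)
    rw [hτper, Real.log_mul (by positivity) (hτ'0 _).ne', Real.log_pow] at c3
    push_cast at c3
    linarith [hdisp z]

end Chamber

/-! ### Words with few changes of vertex -/

theorem third_unique {a b c d : Fin 3} (hab : a ≠ b) (hca : c ≠ a) (hcb : c ≠ b) (hda : d ≠ a)
    (hdb : d ≠ b) : c = d := by
  decide +revert

namespace Chamber

variable {m : Fin 3 → ℕ} {X : Chamber m} {h : Iso} {N : ℕ} {i : ℕ → Fin 3}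

/-- Three consecutive letters of a word at position `n` are different. A line along which the walls
are crossed then turns from one vertex to another. -/
def Switch (i : ℕ → Fin 3) (n : ℕ) : Prop := i n ≠ i (n + 2)

/-- Between two switches a word alternates. -/
theorem alternating {p L : ℕ} (hp : ∀ k, k + 2 < L → i (p + k + 2) = i (p + k)) :
    ∀ k, k < L → i (p + k) = if Even k then i p else i (p + 1) := by
  intro k
  induction k using Nat.twoStepInduction with
  | zero => simp
  | one => simp
  | more k ih _ =>
    intro hk
    rw [← add_assoc, hp k hk, ih (by omega)]
    simp [Nat.even_add]

theorem segProd_eq_inv_alt {x y : Fin 3} {p L : ℕ}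
    (hp : ∀ k, k < L → i (p + k) = if Even k then x else y) :
    X.segProd i p L = (X.alt x y L)⁻¹ := by
  induction L with
  | zero => simp [alt]
  | succ L ih =>
    rw [segProd_succ, ih fun k hk => hp k (by omega), hp L (by omega), alt_succ_left, mul_inv_rev,
      s_inv]

theorem segProd_eq_pow {x y : Fin 3} {p : ℕ} (a : ℕ)
    (hp : ∀ k, k < 2 * a → i (p + k) = if Even k then x else y) :
    X.segProd i p (2 * a) = (X.s x * X.s y) ^ a := by
  induction a with
  | zero => simp
  | succ a ih =>
    have h1 := hp (2 * a) (by omega)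
    have h2 := hp (2 * a + 1) (by omega)
    rw [if_pos (by simp)] at h1
    rw [if_neg (by simp)] at h2
    rw [mul_add, mul_one, segProd_succ, segProd_succ, ih fun k hk => hp k (by omega), h1,
      h2, pow_succ, mul_assoc]

/-- Beyond the braid relation, an alternating product can be shortened. -/
theorem exists_short_alt {x y c : Fin 3} (hxy : x ≠ y) (hcx : c ≠ x) (hcy : c ≠ y) :
    ∃ l : List (Fin 3), l.length < m c ∧ X.wprod l = (X.alt x y (m c + 1))⁻¹ := by
  obtain ⟨n, hn⟩ : ∃ n, m c = n + 1 := ⟨m c - 1, by have := X.three_le c; omega⟩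
  obtain ⟨l, h1, h2⟩ := X.exists_alt_eq y x n
  refine ⟨l.reverse, by simp; omega, ?_⟩
  rw [wprod_reverse, ← h2, alt_succ_left, alt_comm hxy hcx hcy, hn, alt_succ_left, ← mul_assoc]
  have h3 : (if Even (n + 1) then x else y) = if Even n then y else x := by
    by_cases h : Even n <;> simp [h, Nat.even_add_one]
  rw [h3, s_mul_self, one_mul]

namespace PeriodicWord

theorem ne_succ (hw : X.PeriodicWord h N i) (n : ℕ) : i n ≠ i (n + 1) := by
  intro h0
  have hN : 2 ≤ N := by
    have := hw.pos
    have := hw.even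
    rcases this with ⟨k, hk⟩
    omega
  obtain ⟨k, rfl⟩ := Nat.exists_eq_add_of_le hN
  obtain ⟨l, h1, h2⟩ : ∃ l : List (Fin 3), l.length = k ∧ X.wprod l = X.segProd i n (2 + k) := by
    refine ⟨(List.range' (n + 2) k).map i, by simp, ?_⟩
    rw [segProd_add, segProd_succ, segProd_succ, segProd_zero, add_zero, ← h0, one_mul, s_mul_self,
      one_mul]
    rfl
  have := hw.le_length n l h2
  omega

/-- A run of letters that alternates at a vertex is at most as long as the order of this vertex, for
otherwise the braid relation shortens a period. -/
theorem run_le (hw : X.PeriodicWord h N i) {x y c : Fin 3} (hxy : x ≠ y) (hcx : c ≠ x)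
    (hcy : c ≠ y) {p L : ℕ} (hL : L ≤ N) (hp : ∀ k, k < L → i (p + k) = if Even k then x else y) :
    L ≤ m c := by
  by_contra! hlt
  obtain ⟨k, rfl⟩ := Nat.exists_eq_add_of_le (show m c + 1 ≤ N by omega)
  obtain ⟨l, h1, h2⟩ := X.exists_short_alt hxy hcx hcy
  rw [← segProd_eq_inv_alt (i := i) (p := p) (L := m c + 1) fun k hk => hp k (by omega)] at h2
  have := hw.le_length p (l ++ (List.range' (p + (m c + 1)) k).map i) (by
    rw [segProd_add, wprod_append, h2]; rfl)
  simp at this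
  omega

theorem sw (hw : X.PeriodicWord h N i) {n : ℕ} (hn : Switch i n) :
    i n ≠ i (n + 1) ∧ i n ≠ i (n + 2) ∧ i (n + 1) ≠ i (n + 2) :=
  ⟨hw.ne_succ n, hn, hw.ne_succ (n + 1)⟩

theorem switch_add (hw : X.PeriodicWord h N i) (n : ℕ) : Switch i (n + N) ↔ Switch i n := by
  rw [Switch, Switch, hw.periodic, add_right_comm, hw.periodic]

/-- The word has a switch, for otherwise it stays around one vertex, which is fixed. -/
theorem exists_switch (hw : X.PeriodicWord h N i) : ∃ n, Switch i n := by
  by_contra! hcon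
  simp only [Switch, not_not] at hcon
  obtain ⟨c, hc0, hc1⟩ := exists_third (i 0) (i 1)
  have h1 : X.segProd i 0 N = (X.alt (i 0) (i 1) N)⁻¹ :=
    segProd_eq_inv_alt fun k hk => alternating (L := N) (fun k _ => (hcon _).symm) k hk
  obtain ⟨g, -, hg⟩ := hw.conj 0
  have h2 : isom (X.segProd i 0 N) (X.v c) = X.v c := by
    apply hyp_injective
    rw [hyp_isom, h1, ← lin_alt_v hc0 hc1 N, lin_inv_lin, lin_alt_v hc0 hc1]
  apply hw.ne_self (isom g (X.v c))
  have h3 : h * g = g * X.segProd i 0 N := by rw [hg]; group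
  rw [← isom_mul_apply, h3, isom_mul_apply, h2]

/-- If there are no three disjoint switches, then there is a switch that does not follow another
switch. -/
theorem exists_first_switch (hw : X.PeriodicWord h N i)
    (hno : ∀ n₁ n₂ n₃, n₁ + 2 ≤ n₂ → n₂ + 2 ≤ n₃ → n₃ + 2 ≤ n₁ + N → Switch i n₁ → Switch i n₂ →
      Switch i n₃ → False) : ∃ n, ¬ Switch i n ∧ Switch i (n + 1) := by
  by_contra! hcon
  have hcon' : ∀ n, Switch i (n + 1) → Switch i n := fun n h1 => by
    by_contra h2; exact hcon n h2 h1
  obtain ⟨n₀, hn₀⟩ := hw.exists_switch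
  have hdown : ∀ k n, Switch i (n + k) → Switch i n := by
    intro k
    induction k with
    | zero => exact fun n h => h
    | succ k ih => exact fun n h => ih n (hcon' _ h)
  have hup : ∀ k, Switch i (n₀ + k * N) := by
    intro k
    induction k with
    | zero => simpa using hn₀
    | succ k ih => rw [add_mul, one_mul, ← add_assoc, hw.switch_add]; exact ih
  have hall : ∀ n, Switch i n := by
    intro n
    have h1 : n ≤ n₀ + n * N := le_add_left (Nat.le_mul_of_pos_right n hw.pos)
    obtain ⟨k, hk⟩ := Nat.exists_eq_add_of_le h1
    exact hdown k n (hk ▸ hup n)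
  have h3 : i 3 = i 0 := by
    obtain ⟨a1, a2, a3⟩ := hw.sw (hall 0)
    obtain ⟨b1, b2, b3⟩ := hw.sw (hall 1)
    exact third_unique a3 b2.symm b3.symm a1 a2
  have hN6 : 6 ≤ N := by
    obtain ⟨k, hk⟩ := hw.even
    have hpos := hw.pos
    by_contra! hlt
    have hp0 := hw.periodic 0
    rw [zero_add] at hp0
    have h4 : N = 2 ∨ N = 4 := by omega
    rcases h4 with rfl | rfl
    · exact hall 0 hp0.symm
    · exact hw.ne_succ 3 (h3.trans hp0.symm)
  exact hno 0 2 4 le_rfl le_rfl (by omega) (hall 0) (hall 2) (hall 4)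

/-- If a periodic word has no three disjoint switches, then its element is conjugate to a product of
two rotations about vertices of the triangle, by angles that are restricted by `run_le`: in the
first case these rotations have different directions and in the second case the same direction. -/
theorem eq_of_few_switches (hw : X.PeriodicWord h N i)
    (hno : ∀ n₁ n₂ n₃, n₁ + 2 ≤ n₂ → n₂ + 2 ≤ n₃ → n₃ + 2 ≤ n₁ + N → Switch i n₁ → Switch i n₂ →
      Switch i n₃ → False) :
    ∃ g ∈ X.W, ∃ x y z : Fin 3, x ≠ y ∧ x ≠ z ∧ y ≠ z ∧ ∃ a b : ℕ,
      (1 ≤ a ∧ 1 ≤ b ∧ 2 * a + 1 ≤ m x ∧ 2 * b + 1 ≤ m z ∧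
        (X.s y * X.s z) ^ a * (X.s y * X.s x) ^ b = g⁻¹ * h * g) ∨
      (2 ≤ a ∧ 2 ≤ b ∧ 2 * a ≤ m y + 1 ∧ 2 * b ≤ m z + 1 ∧
        (X.s z * X.s x) ^ a * (X.s x * X.s y) ^ b = g⁻¹ * h * g) := by
  classical
  obtain ⟨p, hp, ho⟩ := hw.exists_first_switch hno
  obtain ⟨o, rfl⟩ : ∃ o, o = p + 1 := ⟨_, rfl⟩
  generalize hod : p + 1 = o at ho
  obtain ⟨hxy, hxz, hyz⟩ := hw.sw ho
  have hNe := hw.even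
  have hlast : i (o + N + 1) = i (o + N - 1) := by
    have h1 : ¬ Switch i (p + N) := by rwa [hw.switch_add]
    rw [Switch, not_not] at h1
    rw [show o + N + 1 = p + N + 2 by omega, ← h1]
    congr 1; omega
  have hxN : i (o + N) = i o := hw.periodic o
  have hyN : i (o + N + 1) = i (o + 1) := by rw [add_right_comm, hw.periodic]
  have hN4 : 4 ≤ N := by
    obtain ⟨k, hk⟩ := hNe
    have hpos := hw.pos
    by_contra! hlt
    have h2 : N = 2 := by omega
    rw [h2] at hxN
    exact hxz hxN.symm
  have hex : ∃ q, 2 ≤ q ∧ q + 2 ≤ N ∧ Switch i (o + q) := by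
    by_contra! hcon
    have halt := alternating (i := i) (p := o + 2) (L := N) (by
      intro k hk
      by_cases hk2 : k + 4 ≤ N
      · have := hcon (k + 2) (by omega) (by omega)
        rw [Switch, not_not] at this
        rw [show o + 2 + k + 2 = o + (k + 2) + 2 by omega, ← this]
        congr 1; omega
      · rw [show o + 2 + k + 2 = o + N + 1 by omega, hlast]
        congr 1; omega)
    have h1 := halt (N - 2) (by omega)
    rw [show o + 2 + (N - 2) = o + N by omega, hxN, if_pos (by
      rw [Nat.even_sub (by omega)]; simp [hNe])] at h1
    exact hxz h1
  obtain ⟨hq2, hqN, hq⟩ := Nat.find_spec hex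
  have hqmin : ∀ k, 2 ≤ k → k < Nat.find hex → i (o + k + 2) = i (o + k) := by
    intro k hk2 hk
    by_contra h1
    exact Nat.find_min hex hk ⟨hk2, by omega, fun h2 => h1 h2.symm⟩
  generalize Nat.find hex = q at hq2 hqN hq hqmin
  have hqmax : ∀ k, q + 2 ≤ k → k + 1 ≤ N → i (o + k + 2) = i (o + k) := by
    intro k hk hkN
    by_cases hk2 : k + 2 ≤ N
    · by_contra h1
      exact hno o (o + q) (o + k) (by omega) (by omega) (by omega) ho hq fun h2 => h1 h2.symm
    · rw [show o + k + 2 = o + N + 1 by omega, hlast]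
      congr 1; omega
  obtain ⟨hq1, hq3, hq4⟩ := hw.sw hq
  obtain ⟨x, hx⟩ : ∃ x, x = i o := ⟨_, rfl⟩
  obtain ⟨y, hy⟩ : ∃ y, y = i (o + 1) := ⟨_, rfl⟩
  obtain ⟨z, hz⟩ : ∃ z, z = i (o + 2) := ⟨_, rfl⟩
  rw [← hx] at hxN
  rw [← hy] at hyN
  rw [← hx, ← hy] at hxy
  rw [← hx, ← hz] at hxz
  rw [show o + 1 + 1 = o + 2 by omega] at hyz
  rw [← hy, ← hz] at hyz
  have hNq : Even (N - q) ↔ Even q := by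
    rw [Nat.even_sub (by omega)]; simp [hNe]
  have hq1e : Even (q - 1) ↔ ¬ Even q := by rw [Nat.even_sub (by omega)]; simp
  have hq2e : Even (q - 2) ↔ Even q := by rw [Nat.even_sub (by omega)]; simp
  have hNq1 : Even (N - q - 1) ↔ ¬ Even q := by rw [Nat.even_sub (by omega), hNq]; simp
  have hNq2 : Even (N - q - 2) ↔ Even q := by rw [Nat.even_sub (by omega), hNq]; simp
  by_cases h1 : Switch i (o + 1)
  · -- the letters of numbers `2, ..., q + 1` alternate between `z` and `x`
    obtain ⟨-, b2, b3⟩ := hw.sw h1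
    rw [show o + 1 + 1 = o + 2 by omega, ← hz, show o + 1 + 2 = o + 3 by omega] at b3
    rw [← hy, show o + 1 + 2 = o + 3 by omega] at b2
    have h3x : i (o + 3) = x := third_unique hyz b2.symm b3.symm hxy hxz
    have halt : ∀ k, k < q → i (o + 2 + k) = if Even k then z else x := by
      intro k hk
      have := alternating (i := i) (p := o + 2) (L := q) (fun k hk => by
        have := hqmin (k + 2) (by omega) (by omega)
        rw [show o + 2 + k + 2 = o + (k + 2) + 2 by omega, this]
        congr 1; omega) k hk
      rw [this, show o + 2 + 1 = o + 3 by omega, h3x, hz]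
    have e0 := halt (q - 2) (by omega)
    have e1 := halt (q - 1) (by omega)
    rw [show o + 2 + (q - 2) = o + q by omega] at e0
    rw [show o + 2 + (q - 1) = o + q + 1 by omega] at e1
    simp only [hq1e, hq2e] at e0 e1
    have e2 : i (o + q + 2) = y := by
      by_cases hqe : Even q
      · simp [hqe] at e0 e1
        rw [e0] at hq3; rw [e1] at hq4
        exact third_unique hxz hq4.symm hq3.symm hxy.symm hyz
      · simp [hqe] at e0 e1
        rw [e0] at hq3; rw [e1] at hq4
        exact third_unique hxz hq3.symm hq4.symm hxy.symm hyz
    by_cases h2 : Switch i (o + q + 1)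
    · obtain ⟨-, c2, c3⟩ := hw.sw h2
      have e3 : i (o + q + 3) = i (o + q) := by
        rw [show o + q + 1 + 1 = o + q + 2 by omega, show o + q + 1 + 2 = o + q + 3 by omega] at c3
        rw [show o + q + 1 + 2 = o + q + 3 by omega] at c2
        exact third_unique hq4 c2.symm c3.symm hq1 hq3
      have halt2 := alternating (i := i) (p := o + q + 2) (L := N - q) (fun k hk => by
        have := hqmax (q + 2 + k) (by omega) (by omega)
        rw [show o + q + 2 + k + 2 = o + (q + 2 + k) + 2 by omega, this]
        congr 1; omega)
      rw [show o + q + 2 + 1 = o + q + 3 by omega, e3, e2] at halt2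
      by_cases hqe : Even q
      · -- the parities do not fit
        exfalso
        have h4 := halt2 (N - q - 1) (by omega)
        have h5 := halt2 (N - q - 2) (by omega)
        rw [show o + q + 2 + (N - q - 2) = o + N by omega, hxN] at h5
        simp [hqe, hNq2] at h5
        exact hxy h5
      · simp [hqe] at e0
        rw [e0] at halt2
        obtain ⟨a, ha⟩ := Nat.not_even_iff_odd.1 hqe
        obtain ⟨b, hb⟩ := Nat.not_even_iff_odd.1 (fun h => hqe (hNq.1 h))
        have hr1 := hw.run_le hxz.symm hyz hxy.symm (by omega) halt
        have hr2 := hw.run_le hxy.symm hyz.symm hxz.symm (by omega) halt2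
        obtain ⟨g, hg, hgc⟩ := hw.conj (o + 2)
        refine ⟨g, hg, x, y, z, hxy, hxz, hyz, a + 1, b + 1, Or.inr ⟨by omega, by omega, by omega,
          by omega, ?_⟩⟩
        rw [← hgc, show N = q + (N - q) by omega, segProd_add, show o + 2 + q = o + q + 2 by omega]
        have p1 : X.segProd i (o + 2) q = (X.s z * X.s x) ^ a * X.s z := by
          rw [ha, segProd_succ, segProd_eq_pow a fun k hk => halt k (by omega), halt (2 * a) (by omega)]
          simp
        have p2 : X.segProd i (o + q + 2) (N - q) = X.s y * (X.s x * X.s y) ^ b := by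
          rw [hb, show 2 * b + 1 = 1 + 2 * b by omega, segProd_add,
            segProd_eq_pow (x := x) (y := y) b]
          · have := halt2 0 (by omega)
            simp at this
            simp [segProd, this]
          · intro k hk
            rw [add_assoc, halt2 (1 + k) (by omega)]
            by_cases hk : Even k <;> simp [hk, Nat.even_add, add_comm 1 k]
        rw [p1, p2, pow_succ, pow_succ']
        have hxx : ∀ k, X.s x * (X.s x * k) = k := fun k => by
          rw [← mul_assoc, s_mul_self, one_mul]
        simp only [mul_assoc, hxx]
    · -- the parities do not fit
      exfalso
      rw [Switch, not_not] at h2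
      have halt2 := alternating (i := i) (p := o + q + 1) (L := N - q + 1) (fun k hk => by
        rcases Nat.eq_zero_or_pos k with rfl | hk0
        · exact h2.symm
        · have := hqmax (q + 1 + k) (by omega) (by omega)
          rw [show o + q + 1 + k + 2 = o + (q + 1 + k) + 2 by omega, this]
          congr 1; omega)
      have h4 := halt2 (N - q) (by omega)
      have h5 := halt2 (N - q - 1) (by omega)
      rw [show o + q + 1 + 1 = o + q + 2 by omega, e2] at h4 h5
      rw [show o + q + 1 + (N - q) = o + N + 1 by omega, hyN] at h4
      rw [show o + q + 1 + (N - q - 1) = o + N by omega, hxN] at h5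
      by_cases hqe : Even q
      · simp [hqe, hNq1] at h5; exact hxy h5
      · simp [hqe, hNq1] at h5 e1; rw [e1] at h5; exact hxz h5
  · -- the letters of numbers `1, ..., q + 1` alternate between `y` and `z`
    rw [Switch, not_not] at h1
    have halt : ∀ k, k < q + 1 → i (o + 1 + k) = if Even k then y else z := by
      intro k hk
      have := alternating (i := i) (p := o + 1) (L := q + 1) (fun k hk => by
        rcases Nat.eq_zero_or_pos k with rfl | hk0
        · exact h1.symm
        · have := hqmin (k + 1) (by omega) (by omega)
          rw [show o + 1 + k + 2 = o + (k + 1) + 2 by omega, this]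
          congr 1; omega) k hk
      rw [this, show o + 1 + 1 = o + 2 by omega, hy, hz]
    have e0 := halt (q - 1) (by omega)
    have e1 := halt q (by omega)
    rw [show o + 1 + (q - 1) = o + q by omega] at e0
    rw [show o + 1 + q = o + q + 1 by omega] at e1
    simp only [hq1e] at e0
    have e2 : i (o + q + 2) = x := by
      by_cases hqe : Even q
      · simp [hqe] at e0 e1
        rw [e0] at hq3; rw [e1] at hq4
        exact third_unique hyz hq4.symm hq3.symm hxy hxz
      · simp [hqe] at e0 e1
        rw [e0] at hq3; rw [e1] at hq4
        exact third_unique hyz hq3.symm hq4.symm hxy hxz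
    by_cases h2 : Switch i (o + q + 1)
    · -- the parities do not fit
      exfalso
      obtain ⟨-, c2, c3⟩ := hw.sw h2
      have e3 : i (o + q + 3) = i (o + q) := by
        rw [show o + q + 1 + 1 = o + q + 2 by omega, show o + q + 1 + 2 = o + q + 3 by omega] at c3
        rw [show o + q + 1 + 2 = o + q + 3 by omega] at c2
        exact third_unique hq4 c2.symm c3.symm hq1 hq3
      have halt2 := alternating (i := i) (p := o + q + 2) (L := N - q) (fun k hk => by
        have := hqmax (q + 2 + k) (by omega) (by omega)
        rw [show o + q + 2 + k + 2 = o + (q + 2 + k) + 2 by omega, this]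
        congr 1; omega)
      rw [show o + q + 2 + 1 = o + q + 3 by omega, e3, e2] at halt2
      have h4 := halt2 (N - q - 1) (by omega)
      rw [show o + q + 2 + (N - q - 1) = o + N + 1 by omega, hyN] at h4
      by_cases hqe : Even q
      · simp [hqe, hNq1] at h4 e0; rw [e0] at h4; exact hyz h4
      · simp [hqe, hNq1] at h4; exact hxy h4.symm
    · rw [Switch, not_not] at h2
      have halt2 := alternating (i := i) (p := o + q + 1) (L := N - q + 1) (fun k hk => by
        rcases Nat.eq_zero_or_pos k with rfl | hk0
        · exact h2.symm
        · have := hqmax (q + 1 + k) (by omega) (by omega)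
          rw [show o + q + 1 + k + 2 = o + (q + 1 + k) + 2 by omega, this]
          congr 1; omega)
      rw [show o + q + 1 + 1 = o + q + 2 by omega, e2] at halt2
      have hqe : Even q := by
        by_contra hqe
        have h4 := halt2 (N - q) (by omega)
        rw [show o + q + 1 + (N - q) = o + N + 1 by omega, hyN] at h4
        simp [hqe, hNq] at h4
        exact hxy h4.symm
      simp [hqe] at e1
      rw [e1] at halt2
      obtain ⟨a, ha⟩ := hqe.two_dvd
      obtain ⟨b, hb⟩ := (hNq.2 hqe).two_dvd
      have hr1 := hw.run_le hyz hxy hxz (by omega) halt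
      have hr2 := hw.run_le hxy.symm hyz.symm hxz.symm (by omega) halt2
      obtain ⟨g, hg, hgc⟩ := hw.conj (o + 1)
      refine ⟨g, hg, x, y, z, hxy, hxz, hyz, a, b, Or.inl ⟨by omega, by omega, by omega, by omega,
        ?_⟩⟩
      rw [← hgc, show N = q + (N - q) by omega, segProd_add, show o + 1 + q = o + q + 1 by omega,
        ← segProd_eq_pow (i := i) (p := o + 1) a fun k hk => halt k (by omega),
        ← segProd_eq_pow (i := i) (p := o + q + 1) b fun k hk => halt2 k (by omega), ← ha, ← hb]

end PeriodicWord

end Chamber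

/-! ### Products of two rotations -/

theorem cheb_succ {n : ℕ} (hn : 2 ≤ n) (k : ℕ) :
    cheb n (k + 1) = Real.cos (Real.pi / n) * cheb n k + Real.cos (k * (Real.pi / n)) := by
  have h := (sin_pi_div_pos hn).ne'
  rw [cheb, cheb, Nat.cast_add, Nat.cast_one, add_mul, one_mul, Real.sin_add]
  field_simp

theorem cheb_eq_sub {n : ℕ} (hn : 2 ≤ n) (k : ℕ) :
    cheb n k = Real.cos (Real.pi / n) * cheb n (k + 1) - Real.cos ((k + 1 : ℕ) * (Real.pi / n)) := by
  have h1 := cheb_succ hn (k + 1)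
  rw [cheb_add_two] at h1
  linarith

theorem cheb_mono {n k l : ℕ} (hn : 2 ≤ n) (hkl : k ≤ l) (h : k + l ≤ n) : cheb n k ≤ cheb n l := by
  rw [cheb, cheb]
  refine div_le_div_of_nonneg_right ?_ (sin_pi_div_pos hn).le
  rw [← sub_nonneg, Real.sin_sub_sin]
  have h0 : (0 : ℝ) < n := by positivity
  have hpi := Real.pi_pos
  have h1 : (k : ℝ) ≤ l := by exact_mod_cast hkl
  have h2 : (k : ℝ) + l ≤ n := by exact_mod_cast h
  have h3 : (l : ℝ) ≤ n := by exact_mod_cast (by omega : l ≤ n)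
  have h4 : n * (Real.pi / n) = Real.pi := mul_div_cancel₀ _ h0.ne'
  have h5 : 0 < Real.pi / n := by positivity
  refine mul_nonneg (mul_nonneg two_pos.le (Real.sin_nonneg_of_nonneg_of_le_pi ?_ ?_))
    (Real.cos_nonneg_of_neg_pi_div_two_le_of_le ?_ ?_)
  · nlinarith
  · nlinarith
  · nlinarith [mul_nonneg (Nat.cast_nonneg (α := ℝ) k) h5.le,
      mul_nonneg (Nat.cast_nonneg (α := ℝ) l) h5.le]
  · nlinarith

namespace Chamber

variable {m : Fin 3 → ℕ} {X : Chamber m}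

/-- The dihedral root of index `a` at the vertex `c` is a unit vector, and its reflection is
an alternating word. -/
theorem exists_refl_eq_pow_mul {y z c : Fin 3} (hyz : y ≠ z) (hcy : c ≠ y) (hcz : c ≠ z) (a : ℕ) :
    ∃ h : mform (cheb (m c) (a + 1) • X.e y + cheb (m c) a • X.e z)
        (cheb (m c) (a + 1) • X.e y + cheb (m c) a • X.e z) = 1,
      refl _ h = (X.s y * X.s z) ^ a * X.s y := by
  have h0 := cheb_zero (m c)
  have h1 := cheb_one (X.two_le c)
  have hstep : ∀ {e e' : Mink} {w : Iso} (g : Iso), lin g e = e' →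
      (∃ h : mform e e = 1, refl e h = w) → ∃ h : mform e' e' = 1, refl e' h = g * w * g⁻¹ := by
    rintro e e' w g rfl ⟨h, rfl⟩
    exact ⟨by rw [mform_lin, h], (conj_refl g e h _).symm⟩
  have hbase : ∀ i, ∃ h : mform (X.e i) (X.e i) = 1, refl (X.e i) h = X.s i :=
    fun i => ⟨X.e_self i, rfl⟩
  have hy : lin (X.s y) (X.e z) = X.e z + (2 * X.cs c) • X.e y := by
    rw [lin_s, X.e_mform hyz.symm hcz hcy]; module
  have hz : lin (X.s z) (X.e y) = X.e y + (2 * X.cs c) • X.e z := by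
    rw [lin_s, X.e_mform hyz hcy hcz]; module
  induction a using Nat.twoStepInduction with
  | zero =>
    rw [zero_add, h0, h1, one_smul, zero_smul, add_zero, pow_zero, one_mul]
    exact hbase y
  | one =>
    have h2 := cheb_add_two (m c) 0
    rw [zero_add, h0, h1] at h2
    have := hstep (X.s y) (e' := cheb (m c) (1 + 1) • X.e y + cheb (m c) 1 • X.e z)
      (by rw [hy, h1, h2, cs]; module) (hbase z)
    rwa [s_inv, ← pow_one (X.s y * X.s z)] at this
  | more a ih _ =>
    have h2 := cheb_add_two (m c) a
    have h3 := cheb_add_two (m c) (a + 1)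
    have := hstep (X.s y * X.s z)
      (e' := cheb (m c) (a + 2 + 1) • X.e y + cheb (m c) (a + 2) • X.e z) (by
        simp only [lin_mul_apply, map_add, map_smul, map_neg, lin_s_self, hy, hz]
        rw [show a + 2 + 1 = a + 1 + 2 from rfl, h3, h2, cs]
        module) ih
    refine this.imp fun h hh => hh.trans ?_
    rw [mul_inv_rev, s_inv, s_inv, pow_add, pow_two]
    have hcomm := (Commute.refl (X.s y * X.s z)).pow_right a
    have h4 : X.s y * (X.s z * X.s y) = X.s y * X.s z * X.s y := (mul_assoc _ _ _).symm
    calc X.s y * X.s z * ((X.s y * X.s z) ^ a * X.s y) * (X.s z * X.s y)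
        = X.s y * X.s z * (X.s y * X.s z) ^ a * (X.s y * X.s z) * X.s y := by
          simp only [mul_assoc]
      _ = _ := by rw [hcomm.eq]; simp only [mul_assoc]

/-- The displacement of a product of two rotations of opposite senses about two vertices. -/
theorem two_mul_arcosh_le_of_opposite {x y z : Fin 3} (hxy : x ≠ y) (hxz : x ≠ z) (hyz : y ≠ z)
    {a b : ℕ} (hb : 1 ≤ b) {B : ℝ} (hB1 : 1 ≤ B)
    (hB : B ≤ cheb (m x) a * cheb (m z) b * (X.cs y + X.cs x * X.cs z)
      + Real.cos (a * (Real.pi / m x)) * Real.cos (b * (Real.pi / m z))) (w : ℍ) :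
    2 * Real.arcosh B ≤ dist w (isom ((X.s y * X.s z) ^ a * (X.s y * X.s x) ^ b) w) := by
  obtain ⟨b, rfl⟩ : ∃ b', b = b' + 1 := ⟨b - 1, by omega⟩
  obtain ⟨h, hr⟩ := X.exists_refl_eq_pow_mul hyz hxy hxz a
  obtain ⟨h', hr'⟩ := X.exists_refl_eq_pow_mul hxy hxz.symm hyz.symm b
  have hw : (X.s y * X.s z) ^ a * (X.s y * X.s x) ^ (b + 1) = refl _ h * refl _ h' := by
    rw [hr, hr', pow_succ (X.s y * X.s x), ← mul_assoc _ (X.s y) (X.s x), mul_pow_mul]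
    simp only [mul_assoc]
  have ha1 := cheb_succ (X.two_le x) a
  have hb1 := cheb_eq_sub (X.two_le z) b
  have key : -mform (cheb (m x) (a + 1) • X.e y + cheb (m x) a • X.e z)
      (cheb (m z) (b + 1) • X.e x + cheb (m z) b • X.e y)
      = cheb (m x) a * cheb (m z) (b + 1) * (X.cs y + X.cs x * X.cs z)
      + Real.cos (a * (Real.pi / m x)) * Real.cos ((b + 1 : ℕ) * (Real.pi / m z)) := by
    simp only [mform_add_left, mform_add_right, mform_smul_left, mform_smul_right, X.e_self,
      X.e_mform hxy.symm hyz.symm hxz.symm, X.e_mform hxz.symm hyz hxy.symm,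
      X.e_mform hyz.symm hxz hxy, ha1, hb1, cs]
    ring
  rw [← key] at hB
  have hB' := hB.trans (neg_le_abs _)
  rw [hw]
  refine le_trans ?_ (two_mul_arcosh_le_dist h h' (hB1.trans hB') w)
  have := (Real.arcosh_le_arcosh (by linarith) (by linarith)).2 hB'
  linarith

/-- The displacement of a product of two rotations of the same sense about two vertices. -/
theorem two_mul_arcosh_le_of_same {x y z : Fin 3} (hxy : x ≠ y) (hxz : x ≠ z) (hyz : y ≠ z)
    {a b : ℕ} (ha : 1 ≤ a) (hb : 1 ≤ b) {B : ℝ} (hB1 : 1 ≤ B)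
    (hB : B ≤ cheb (m y) a * cheb (m z) b * (X.cs x + X.cs y * X.cs z)
      - Real.cos (a * (Real.pi / m y)) * Real.cos (b * (Real.pi / m z))) (w : ℍ) :
    2 * Real.arcosh B ≤ dist w (isom ((X.s z * X.s x) ^ a * (X.s x * X.s y) ^ b) w) := by
  obtain ⟨a, rfl⟩ : ∃ a', a = a' + 1 := ⟨a - 1, by omega⟩
  obtain ⟨b, rfl⟩ : ∃ b', b = b' + 1 := ⟨b - 1, by omega⟩
  obtain ⟨h, hr⟩ := X.exists_refl_eq_pow_mul hxz.symm hyz hxy.symm a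
  obtain ⟨h', hr'⟩ := X.exists_refl_eq_pow_mul hxy.symm hyz.symm hxz.symm b
  have hw : (X.s z * X.s x) ^ (a + 1) * (X.s x * X.s y) ^ (b + 1) = refl _ h * refl _ h' := by
    rw [hr, hr', mul_pow_mul (X.s y), pow_succ, pow_succ' (X.s x * X.s y)]
    simp only [mul_assoc]
    rw [← mul_assoc (X.s x) (X.s x), s_mul_self, one_mul,
      ← mul_pow_mul (X.s y) (X.s x) b, mul_pow_mul]
  have ha1 := cheb_eq_sub (X.two_le y) a
  have hb1 := cheb_eq_sub (X.two_le z) b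
  have key : -mform (cheb (m y) (a + 1) • X.e z + cheb (m y) a • X.e x)
      (cheb (m z) (b + 1) • X.e y + cheb (m z) b • X.e x)
      = cheb (m y) (a + 1) * cheb (m z) (b + 1) * (X.cs x + X.cs y * X.cs z)
      - Real.cos ((a + 1 : ℕ) * (Real.pi / m y)) * Real.cos ((b + 1 : ℕ) * (Real.pi / m z)) := by
    simp only [mform_add_left, mform_add_right, mform_smul_left, mform_smul_right, X.e_self,
      X.e_mform hxy hxz.symm hyz.symm, X.e_mform hxz.symm hyz hxy.symm,
      X.e_mform hyz.symm hxz hxy, ha1, hb1, cs]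
    ring
  rw [← key] at hB
  have hB' := hB.trans (neg_le_abs _)
  rw [hw]
  refine le_trans ?_ (two_mul_arcosh_le_dist h h' (hB1.trans hB') w)
  have := (Real.arcosh_le_arcosh (by linarith) (by linarith)).2 hB'
  linarith

end Chamber

/-! ### Trigonometric estimates -/

theorem eq_zero_or (i : Fin 3) : i = 0 ∨ i = 1 ∨ i = 2 := by decide +revert

theorem cos_pi_div_mono {k n : ℕ} (hk : 1 ≤ k) (h : k ≤ n) :
    Real.cos (Real.pi / k) ≤ Real.cos (Real.pi / n) := by
  have h1 : (1 : ℝ) ≤ k := by exact_mod_cast hk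
  apply Real.cos_le_cos_of_nonneg_of_le_pi (by positivity)
  · exact div_le_self Real.pi_pos.le h1
  · gcongr

theorem cheb_two {n : ℕ} (hn : 2 ≤ n) : cheb n 2 = 2 * Real.cos (Real.pi / n) := by
  rw [cheb_add_two n 0, cheb_zero, zero_add, cheb_one hn]; ring

theorem one_le_cheb {n k : ℕ} (hn : 2 ≤ n) (h1 : 1 ≤ k) (h : k + 1 ≤ n) : 1 ≤ cheb n k := by
  rw [← cheb_one hn]; exact cheb_mono hn h1 (by omega)

theorem golden_le_cos {n : ℕ} (hn : 5 ≤ n) : 1 + √5 ≤ 4 * Real.cos (Real.pi / n) := by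
  have h := cos_pi_div_mono (by norm_num) hn
  rw [Nat.cast_ofNat, Real.cos_pi_div_five] at h
  linarith

theorem golden_le_cheb {n k : ℕ} (h2 : 2 ≤ k) (h : k + 2 ≤ n) (hn : 5 ≤ n) :
    1.618 ≤ cheb n k := by
  have h1 := cheb_mono (by omega) h2 (by omega : 2 + k ≤ n)
  have h3 := golden_le_cos hn
  have h5 : (2.236 : ℝ) ≤ √5 := Real.le_sqrt_of_sq_le (by norm_num)
  rw [cheb_two (by omega)] at h1
  linarith

theorem two_le_cheb {n k : ℕ} (h3 : 3 ≤ k) (h : k + 3 ≤ n) : 2 ≤ cheb n k := by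
  refine le_trans ?_ (cheb_mono (by omega) h3 (by omega : 3 + k ≤ n))
  have h6 := cos_pi_div_mono (by norm_num) (by omega : 6 ≤ n)
  rw [Nat.cast_ofNat, Real.cos_pi_div_six] at h6
  have hs : √3 ^ 2 = 3 := Real.sq_sqrt (by norm_num)
  rw [cheb_add_two n 1, cheb_two (by omega), cheb_one (by omega)]
  nlinarith [Real.sqrt_nonneg 3]

theorem cos_mul_pi_div_nonneg {n k : ℕ} (h : 2 * k ≤ n) (hn : 0 < n) :
    0 ≤ Real.cos (k * (Real.pi / n)) := by
  have h0 : (0 : ℝ) < n := by exact_mod_cast hn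
  have h1 : (2 : ℝ) * k ≤ n := by exact_mod_cast h
  have hpi := Real.pi_pos
  apply Real.cos_nonneg_of_neg_pi_div_two_le_of_le
  · exact le_trans (by linarith) (by positivity : (0 : ℝ) ≤ _)
  · rw [mul_div_assoc', div_le_div_iff₀ h0 two_pos]; nlinarith

namespace Chamber

variable {m : Fin 3 → ℕ} (X : Chamber m)

/-- The hyperbolic cosine of half of the length to be exceeded. -/
def level : ℝ := 2 * X.cs 1 * X.cs 2 + X.cs 0

theorem half_le_cs (i : Fin 3) : 1 / 2 ≤ X.cs i := by
  have h := cos_pi_div_mono (by norm_num) (X.three_le i)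
  rwa [Nat.cast_ofNat, Real.cos_pi_div_three] at h

theorem cs_lt_one (i : Fin 3) : X.cs i < 1 := by
  have h3 : (3 : ℝ) ≤ m i := by exact_mod_cast X.three_le i
  rw [cs, ← Real.cos_zero]
  apply Real.cos_lt_cos_of_nonneg_of_le_pi le_rfl
  · exact div_le_self Real.pi_pos.le (by linarith)
  · positivity

variable {X}

/-- The orders of the vertices are listed in increasing order, and are not all equal to `3`. -/
structure Ordered (X : Chamber m) : Prop where
  le01 : m 0 ≤ m 1
  le12 : m 1 ≤ m 2
  four_le : 4 ≤ m 2

namespace Ordered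

theorem cs01 (_ : X.Ordered) : X.cs 0 ≤ X.cs 1 :=
  cos_pi_div_mono (by have := X.three_le 0; omega) (le01 ‹_›)

theorem cs12 (_ : X.Ordered) : X.cs 1 ≤ X.cs 2 :=
  cos_pi_div_mono (by have := X.three_le 1; omega) (le12 ‹_›)

theorem le_cs_two (h : X.Ordered) : 0.7 ≤ X.cs 2 := by
  have h1 := cos_pi_div_mono (by norm_num) h.four_le
  rw [Nat.cast_ofNat, Real.cos_pi_div_four] at h1
  have h2 : (1.4 : ℝ) ≤ √2 := Real.le_sqrt_of_sq_le (by norm_num)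
  rw [cs]; linarith

theorem one_le_level (h : X.Ordered) : 1 ≤ X.level := by
  have h0 := X.half_le_cs 0
  have h1 := X.half_le_cs 1
  have h2 := h.le_cs_two
  rw [level]; nlinarith

theorem le_middle (h : X.Ordered) {x y z : Fin 3} (hxy : x ≠ y) (hxz : x ≠ z) (hyz : y ≠ z) :
    X.cs 0 + X.cs 1 * X.cs 2 ≤ X.cs x + X.cs y * X.cs z := by
  have h1 := h.cs01
  have h2 := h.cs12
  have hl := X.cs_lt_one
  rcases eq_zero_or x with rfl | rfl | rfl
  · obtain ⟨rfl, rfl⟩ | ⟨rfl, rfl⟩ : (y = 1 ∧ z = 2) ∨ (y = 2 ∧ z = 1) := by decide +revert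
    · rfl
    · rw [mul_comm]
  · have : X.cs y * X.cs z = X.cs 0 * X.cs 2 := by
      obtain ⟨rfl, rfl⟩ | ⟨rfl, rfl⟩ : (y = 0 ∧ z = 2) ∨ (y = 2 ∧ z = 0) := by decide +revert
      · rfl
      · rw [mul_comm]
    rw [this]
    nlinarith [mul_nonneg (sub_nonneg.2 h1) (sub_pos.2 (hl 2)).le]
  · have : X.cs y * X.cs z = X.cs 0 * X.cs 1 := by
      obtain ⟨rfl, rfl⟩ | ⟨rfl, rfl⟩ : (y = 0 ∧ z = 1) ∨ (y = 1 ∧ z = 0) := by decide +revert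
      · rfl
      · rw [mul_comm]
    rw [this]
    nlinarith [mul_nonneg (sub_nonneg.2 (h1.trans h2)) (sub_pos.2 (hl 1)).le]

theorem level_lt_of_eq_three (h : X.Ordered) {x y z : Fin 3} (hxy : x ≠ y) (hxz : x ≠ z)
    (hyz : y ≠ z) (hx : m x = 3) : X.level < 2 * X.cs y + 2 * X.cs z - 1 := by
  have h1 := h.le01
  have h2 := h.le12
  have h4 := h.four_le
  have h7 := h.le_cs_two
  have h5 := X.half_le_cs 1
  have h6 := X.cs_lt_one 2
  have e3 : ∀ i, m i = 3 → X.cs i = 1 / 2 := fun i hi => by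
    rw [cs, hi, Nat.cast_ofNat, Real.cos_pi_div_three]
  have e0 : X.cs 0 = 1 / 2 := e3 0 (by
    have := X.three_le 0
    rcases eq_zero_or x with rfl | rfl | rfl <;> omega)
  have hyz : X.cs y + X.cs z = X.cs 1 + X.cs 2 := by
    rcases eq_zero_or x with rfl | rfl | rfl
    · obtain ⟨rfl, rfl⟩ | ⟨rfl, rfl⟩ : (y = 1 ∧ z = 2) ∨ (y = 2 ∧ z = 1) := by decide +revert
      · rfl
      · rw [add_comm]
    · have e1 := e3 1 hx
      obtain ⟨rfl, rfl⟩ | ⟨rfl, rfl⟩ : (y = 0 ∧ z = 2) ∨ (y = 2 ∧ z = 0) := by decide +revert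
      · rw [e0, e1]
      · rw [e0, e1, add_comm]
    · omega
  have : 2 * X.cs y + 2 * X.cs z - 1 = 2 * (X.cs 1 + X.cs 2) - 1 := by rw [← hyz]; ring
  rw [this, level, e0]
  nlinarith

/-- The case of three disjoint switches: `4 c³ - 3 c` and `2 level² - 1` are the hyperbolic cosines
of the lengths to compare. -/
theorem two_mul_arcosh_level_lt (h : X.Ordered) :
    2 * Real.arcosh X.level < 3 * Real.arcosh (X.cs 2 + 2 * X.cs 0 * X.cs 1) := by
  have h0 := X.half_le_cs 0
  have h1 := X.half_le_cs 1
  have h7 := h.le_cs_two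
  have h01 := h.cs01
  have h12 := h.cs12
  have hl := X.cs_lt_one 2
  have hK := h.one_le_level
  have hx : 1 < X.cs 2 + 2 * X.cs 0 * X.cs 1 := by nlinarith
  have hKx : X.level ≤ 3 / 2 * (X.cs 2 + 2 * X.cs 0 * X.cs 1) - 1 / 2 := by
    rw [level]
    nlinarith [mul_nonneg (sub_nonneg.2 h0) (sub_nonneg.2 h1),
      mul_nonneg (by linarith : 0 ≤ 1 - X.cs 2) (sub_nonneg.2 h1)]
  rw [← abs_of_nonneg (a := 3 * _) (by linarith [Real.arcosh_nonneg hx.le]),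
    ← abs_of_nonneg (a := 2 * _) (by linarith [Real.arcosh_nonneg hK]), ← Real.cosh_lt_cosh,
    Real.cosh_two_mul, Real.sinh_sq, Real.cosh_three_mul, Real.cosh_arcosh hx.le,
    Real.cosh_arcosh hK]
  set t := X.cs 2 + 2 * X.cs 0 * X.cs 1
  have h2 : X.level ^ 2 ≤ (3 / 2 * t - 1 / 2) ^ 2 := by gcongr
  nlinarith [mul_pos (sub_pos.2 hx) (by nlinarith : 0 < 4 * t ^ 2 - t / 2 - 1 / 2)]

theorem le_switch (h : X.Ordered) {x y z : Fin 3} (hxy : x ≠ y) (hxz : x ≠ z) (hyz : y ≠ z) :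
    X.cs 2 + 2 * X.cs 0 * X.cs 1 ≤ X.cs y + 2 * X.cs x * X.cs z := by
  have h1 := h.cs01
  have h2 := h.cs12
  have hl := X.half_le_cs
  rcases eq_zero_or y with rfl | rfl | rfl
  · have : X.cs x * X.cs z = X.cs 1 * X.cs 2 := by
      obtain ⟨rfl, rfl⟩ | ⟨rfl, rfl⟩ : (x = 1 ∧ z = 2) ∨ (x = 2 ∧ z = 1) := by decide +revert
      · rfl
      · rw [mul_comm]
    rw [mul_assoc, mul_assoc, this]
    nlinarith [mul_nonneg (sub_nonneg.2 (h1.trans h2)) (sub_nonneg.2 (hl 1))]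
  · have : X.cs x * X.cs z = X.cs 0 * X.cs 2 := by
      obtain ⟨rfl, rfl⟩ | ⟨rfl, rfl⟩ : (x = 0 ∧ z = 2) ∨ (x = 2 ∧ z = 0) := by decide +revert
      · rfl
      · rw [mul_comm]
    rw [mul_assoc, mul_assoc, this]
    nlinarith [mul_nonneg (sub_nonneg.2 h2) (sub_nonneg.2 (hl 0))]
  · have : X.cs x * X.cs z = X.cs 0 * X.cs 1 := by
      obtain ⟨rfl, rfl⟩ | ⟨rfl, rfl⟩ : (x = 0 ∧ z = 1) ∨ (x = 1 ∧ z = 0) := by decide +revert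
      · rfl
      · rw [mul_comm]
    rw [mul_assoc, mul_assoc, this]

end Ordered

/-- An upper bound for the displacement of a rotation `s i * s j` on the contact graph, in terms of
the third index: the rotations about the vertices of indices `0` and `1` move a contact point to a
neighbor, and the rotation about the vertex of index `2` is a product of two of them. -/
def wt : Fin 3 → ℕ := ![1, 1, 2]

namespace Ordered

/-- Two rotations of opposite senses whose word is long on the contact graph. -/
theorem level_lt_of_opposite (h : X.Ordered) {x y z : Fin 3} (hxy : x ≠ y) (hxz : x ≠ z)
    (hyz : y ≠ z) {a b : ℕ} (ha : 1 ≤ a) (hb : 1 ≤ b) (hax : 2 * a + 1 ≤ m x)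
    (hbz : 2 * b + 1 ≤ m z) (hL : 5 ≤ wt x * a + wt z * b) :
    X.level < cheb (m x) a * cheb (m z) b * (X.cs y + X.cs x * X.cs z)
      + Real.cos (a * (Real.pi / m x)) * Real.cos (b * (Real.pi / m z)) := by
  have h01 := h.cs01
  have h12 := h.cs12
  have hh := X.half_le_cs
  have hl := X.cs_lt_one
  have hmid := h.le_middle hxy.symm hyz hxz
  have hcc := mul_nonneg (cos_mul_pi_div_nonneg (by omega : 2 * a ≤ m x) (by omega))
    (cos_mul_pi_div_nonneg (by omega : 2 * b ≤ m z) (by omega))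
  have hua := one_le_cheb (X.two_le x) ha (by omega)
  have hub := one_le_cheb (X.two_le z) hb (by omega)
  by_cases hM : 2 ≤ cheb (m x) a * cheb (m z) b
  · have := mul_le_mul hM hmid (by nlinarith [hh 0, hh 1, hh 2]) (by linarith)
    rw [level]; linarith [hh 0]
  -- exponents that are large or both at least `2` make the product of the Chebyshev quotients large
  have hM' : ¬ 3 ≤ a ∧ ¬ 3 ≤ b ∧ ¬ (2 ≤ a ∧ 2 ≤ b) := by
    refine ⟨fun h3 => hM ?_, fun h3 => hM ?_, fun h3 => hM ?_⟩
    · nlinarith [two_le_cheb h3 (by omega : a + 3 ≤ m x)]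
    · nlinarith [two_le_cheb h3 (by omega : b + 3 ≤ m z)]
    · nlinarith [golden_le_cheb h3.1 (by omega) (by omega : 5 ≤ m x),
        golden_le_cheb h3.2 (by omega) (by omega : 5 ≤ m z)]
  -- one of the rotations is a double turn about the third vertex, the other one a simple turn
  have key : ∀ {w : Fin 3}, w ≠ y → w ≠ 2 → y ≠ 2 → 5 ≤ m 2 →
      X.level < 2 * X.cs 2 * (X.cs y + X.cs w * X.cs 2) + X.cs w * (2 * X.cs 2 ^ 2 - 1) := by
    intro w hwy hw2 hy2 hm2
    have hg := golden_le_cos hm2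
    have h5 : (2.236 : ℝ) ≤ √5 := Real.le_sqrt_of_sq_le (by norm_num)
    have h5' : √5 ^ 2 = 5 := Real.sq_sqrt (by norm_num)
    change 1 + √5 ≤ 4 * X.cs 2 at hg
    have hg2 : 0 ≤ 4 * X.cs 2 ^ 2 - 2 * X.cs 2 - 1 := by nlinarith
    obtain ⟨rfl, rfl⟩ | ⟨rfl, rfl⟩ : (w = 1 ∧ y = 0) ∨ (w = 0 ∧ y = 1) := by
      clear * - hwy hw2 hy2
      decide +revert
    · rw [level]; nlinarith [mul_nonneg (by linarith [hh 1] : 0 ≤ X.cs 1) hg2, hh 0]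
    · rw [level]; nlinarith [hh 0, hh 1]
  have e2 : ∀ k, Real.cos ((2 : ℕ) * (Real.pi / m k)) = 2 * X.cs k ^ 2 - 1 := fun k => by
    rw [Nat.cast_ofNat, Real.cos_two_mul, cs]
  have e1 : ∀ k, Real.cos ((1 : ℕ) * (Real.pi / m k)) = X.cs k := fun k => by
    rw [Nat.cast_one, one_mul, cs]
  have hw : (a = 1 ∧ b = 2 ∧ z = 2) ∨ (a = 2 ∧ b = 1 ∧ x = 2) := by
    have hwt : ∀ i, wt i = if i = 2 then 2 else 1 := by decide
    rw [hwt, hwt] at hL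
    by_cases hx2 : x = 2
    · by_cases hz2 : z = 2
      · omega
      · simp [hx2, hz2] at hL; omega
    · by_cases hz2 : z = 2
      · simp [hx2, hz2] at hL; omega
      · simp [hx2, hz2] at hL; omega
  rcases hw with ⟨rfl, rfl, rfl⟩ | ⟨rfl, rfl, rfl⟩
  · have := key hxy hxz hyz (by omega)
    rw [e1, e2, cheb_one (X.two_le x), cheb_two (X.two_le 2)]
    change _ < 1 * (2 * X.cs 2) * _ + _
    linarith
  · have := key hyz.symm hxz.symm hxy.symm (by omega)
    rw [e1, e2, cheb_one (X.two_le z), cheb_two (X.two_le 2)]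
    change _ < (2 * X.cs 2) * 1 * _ + _
    linarith

/-- Two rotations of the same sense, one of them of order at most `4`. -/
theorem level_lt_of_same_of_le_four (h : X.Ordered) {x y z : Fin 3} (hxy : x ≠ y) (hxz : x ≠ z)
    (hyz : y ≠ z) {a b : ℕ} (ha : 2 ≤ a) (hay : 2 * a ≤ m y + 1) (hbz : 2 * b ≤ m z + 1)
    (h4 : m y ≤ 4) (hb3 : 3 ≤ b) (hb3' : b + 3 ≤ m z) :
    X.level < cheb (m y) a * cheb (m z) b * (X.cs x + X.cs y * X.cs z)
      - Real.cos (a * (Real.pi / m y)) * Real.cos (b * (Real.pi / m z)) := by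
  have hh := X.half_le_cs
  have hub := two_le_cheb hb3 hb3'
  obtain rfl : a = 2 := by omega
  rw [cheb_two (X.two_le y), Nat.cast_ofNat, Real.cos_two_mul]
  change _ < 2 * X.cs y * _ * _ - (2 * X.cs y ^ 2 - 1) * _
  have hy : m y = 3 ∨ m y = 4 := by have := X.three_le y; omega
  rcases hy with hy | hy
  · have ey : X.cs y = 1 / 2 := by rw [cs, hy, Nat.cast_ofNat, Real.cos_pi_div_three]
    have h1 := h.level_lt_of_eq_three hxy.symm hyz hxz hy
    obtain ⟨b, rfl⟩ : ∃ b', b = b' + 1 := ⟨b - 1, by omega⟩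
    have h2 := cheb_eq_sub (X.two_le z) b
    have h3 := cheb_mono (X.two_le z) (by omega : b ≤ b + 1) (by omega)
    change cheb (m z) b = X.cs z * _ - _ at h2
    rw [ey]
    have h5 := mul_le_mul_of_nonneg_right hub (by linarith [hh x, hh z] : 0 ≤ X.cs x + X.cs z - 1 / 2)
    nlinarith
  · have ey : X.cs y ^ 2 = 1 / 2 := by
      rw [cs, hy, Nat.cast_ofNat, Real.cos_pi_div_four, div_pow, Real.sq_sqrt (by norm_num)]
      norm_num
    have hmid := h.le_middle hxy hxz hyz
    have hM : 2 ≤ 2 * X.cs y * cheb (m z) b := by nlinarith [hh y]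
    have := mul_le_mul hM hmid (by nlinarith [hh 0, hh 1, hh 2]) (by linarith)
    rw [ey, level]
    linarith [hh 0]

/-- Two rotations of the same sense whose word is long on the contact graph. -/
theorem level_lt_of_same (h : X.Ordered) {x y z : Fin 3} (hxy : x ≠ y) (hxz : x ≠ z)
    (hyz : y ≠ z) {a b : ℕ} (ha : 2 ≤ a) (hb : 2 ≤ b) (hay : 2 * a ≤ m y + 1)
    (hbz : 2 * b ≤ m z + 1) (h1 : 5 ≤ wt y * (a - 1) + wt x + wt z * (b - 1))
    (h2 : 5 ≤ wt y * (m y - a - 1) + wt x + wt z * (m z - b - 1))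
    (h3 : 5 ≤ wt y * (m y - a) + wt z * b) (h4 : 5 ≤ wt y * a + wt z * (m z - b)) :
    X.level < cheb (m y) a * cheb (m z) b * (X.cs x + X.cs y * X.cs z)
      - Real.cos (a * (Real.pi / m y)) * Real.cos (b * (Real.pi / m z)) := by
  -- a rotation of order at most `4` has exponent `2`; all ways to write the product being long, the
  -- other exponent is then at distance at least `3` from the multiples of its order
  have hle : (m y ≤ 4 → 3 ≤ b ∧ b + 3 ≤ m z) ∧ (m z ≤ 4 → 3 ≤ a ∧ a + 3 ≤ m y) := by
    have h01 := h.le01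
    have h12 := h.le12
    have h42 := h.four_le
    have hy3 := X.three_le y
    have hz3 := X.three_le z
    have : x = 0 ∨ x = 1 ∨ x = 2 := by clear * -; decide +revert
    have e0 : wt 0 = 1 := rfl
    have e1 : wt 1 = 1 := rfl
    have e2 : wt 2 = 2 := rfl
    rcases this with rfl | rfl | rfl
    · obtain ⟨rfl, rfl⟩ | ⟨rfl, rfl⟩ : (y = 1 ∧ z = 2) ∨ (y = 2 ∧ z = 1) := by
        clear * - hxy hxz hyz; decide +revert
      all_goals simp only [e0, e1, e2] at h1 h2 h3 h4; omega
    · obtain ⟨rfl, rfl⟩ | ⟨rfl, rfl⟩ : (y = 0 ∧ z = 2) ∨ (y = 2 ∧ z = 0) := by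
        clear * - hxy hxz hyz; decide +revert
      all_goals simp only [e0, e1, e2] at h1 h2 h3 h4; omega
    · obtain ⟨rfl, rfl⟩ | ⟨rfl, rfl⟩ : (y = 0 ∧ z = 1) ∨ (y = 1 ∧ z = 0) := by
        clear * - hxy hxz hyz; decide +revert
      all_goals simp only [e0, e1, e2] at h1 h2 h3 h4; omega
  rcases le_or_gt (m y) 4 with hy | hy
  · obtain ⟨hb3, hb3'⟩ := hle.1 hy
    exact h.level_lt_of_same_of_le_four hxy hxz hyz ha hay hbz hy hb3 hb3'
  rcases le_or_gt (m z) 4 with hz | hz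
  · obtain ⟨ha3, ha3'⟩ := hle.2 hz
    have := h.level_lt_of_same_of_le_four hxz hxy hyz.symm hb hbz hay hz ha3 ha3'
    linarith [mul_comm (X.cs y) (X.cs z), mul_comm (cheb (m y) a) (cheb (m z) b),
      mul_comm (Real.cos (a * (Real.pi / m y))) (Real.cos (b * (Real.pi / m z))),
      congrArg₂ (· * ·) (mul_comm (cheb (m y) a) (cheb (m z) b))
        (congrArg (X.cs x + ·) (mul_comm (X.cs y) (X.cs z)))]
  have hh := X.half_le_cs
  have h7 := h.le_cs_two
  have hM : 2.6 ≤ cheb (m y) a * cheb (m z) b := by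
    nlinarith [golden_le_cheb ha (by omega) (by omega : 5 ≤ m y),
      golden_le_cheb hb (by omega) (by omega : 5 ≤ m z)]
  have hmid := h.le_middle hxy hxz hyz
  have h5 := mul_le_mul hM hmid (by nlinarith [hh 0, hh 1, hh 2]) (by linarith)
  have h6 : Real.cos (a * (Real.pi / m y)) * Real.cos (b * (Real.pi / m z)) ≤ 1 := by
    refine (le_abs_self _).trans ?_
    rw [abs_mul]
    exact mul_le_one₀ (Real.abs_cos_le_one _) (abs_nonneg _) (Real.abs_cos_le_one _)
  rw [level]
  nlinarith [hh 0, hh 1]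

end Ordered

end Chamber

/-! ### Angles, segments and reflections in the hyperboloid model -/

theorem sinh_dist_eq (v x : ℍ) : Real.sinh (dist v x) =
    ‖(x : ℂ) - (starRingEnd ℂ) (v : ℂ)‖ ^ 2 / (2 * x.im * v.im) * ‖cayley v x‖ := by
  have hx := x.im_pos
  have hv := v.im_pos
  have hne : (x : ℂ) - (starRingEnd ℂ) (v : ℂ) ≠ 0 := by
    intro h
    have := congrArg Complex.im h
    simp at this
    linarith
  have hs : √(x.im * v.im) ^ 2 = x.im * v.im := Real.sq_sqrt (by positivity)
  have hs0 : 0 < √(x.im * v.im) := Real.sqrt_pos.2 (by positivity)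
  rw [show dist v x = 2 * (dist x v / 2) by rw [dist_comm]; ring, Real.sinh_two_mul,
    UpperHalfPlane.sinh_half_dist, UpperHalfPlane.cosh_half_dist, cayley, norm_div,
    Complex.dist_eq, Complex.dist_eq]
  have : 0 < ‖(x : ℂ) - (starRingEnd ℂ) (v : ℂ)‖ := norm_pos_iff.2 hne
  field_simp
  rw [hs]
  ring

/-- The hyperbolic law of cosines, also valid in the degenerate case where `x` or `y` is `v`. -/
theorem sinh_mul_sinh_mul_cos_hypAngle (v x y : ℍ) :
    Real.sinh (dist v x) * Real.sinh (dist v y) * Real.cos (hypAngle v x y)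
      = mform (hyp x) (hyp y) + mform (hyp v) (hyp x) * mform (hyp v) (hyp y) := by
  have hx := x.im_pos
  have hy := y.im_pos
  have hv := v.im_pos
  have key : ∀ z : ℍ, ((‖(z : ℂ) - (starRingEnd ℂ) (v : ℂ)‖ ^ 2 : ℝ) : ℂ) * cayley v z
      = ((z : ℂ) - v) * ((starRingEnd ℂ) (z : ℂ) - v) := by
    intro z
    have hz := z.im_pos
    have hne : (z : ℂ) - (starRingEnd ℂ) (v : ℂ) ≠ 0 := by
      intro h
      have := congrArg Complex.im h
      simp at this
      linarith
    rw [cayley, ← Complex.normSq_eq_norm_sq, ← Complex.mul_conj]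
    field_simp
    simp [mul_comm]
  have hin : ∀ a b : ℝ, ∀ z w : ℂ, a * b * inner ℝ z w = inner ℝ ((a : ℂ) * z) ((b : ℂ) * w) := by
    intro a b z w
    rw [← Complex.real_smul, ← Complex.real_smul, real_inner_smul_left, real_inner_smul_right]
    ring
  have hcos := InnerProductGeometry.cos_angle_mul_norm_mul_norm (cayley v x) (cayley v y)
  have h1 : Real.sinh (dist v x) * Real.sinh (dist v y) * Real.cos (hypAngle v x y)
      = (‖(x : ℂ) - (starRingEnd ℂ) (v : ℂ)‖ ^ 2 * ‖(y : ℂ) - (starRingEnd ℂ) (v : ℂ)‖ ^ 2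
        * inner ℝ (cayley v x) (cayley v y)) / (2 * x.im * v.im) / (2 * y.im * v.im) := by
    rw [← hcos, sinh_dist_eq, sinh_dist_eq, hypAngle]
    field_simp
  rw [h1, hin, key, key, Complex.inner]
  simp only [mform, hyp, Complex.mul_re, Complex.mul_im, Complex.conj_re, Complex.conj_im,
    Complex.sub_re, Complex.sub_im, UpperHalfPlane.coe_re, UpperHalfPlane.coe_im,
    map_mul, map_sub, Matrix.cons_val_zero, Matrix.cons_val_one, Matrix.cons_val]
  field_simp
  ring

theorem hypAngle_eq {v x y : ℍ} (hx : x ≠ v) (hy : y ≠ v) {θ : ℝ} (h0 : 0 ≤ θ) (hpi : θ ≤ Real.pi)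
    (h : Real.sinh (dist v x) * Real.sinh (dist v y) * Real.cos θ
      = mform (hyp x) (hyp y) + mform (hyp v) (hyp x) * mform (hyp v) (hyp y)) :
    hypAngle v x y = θ := by
  rw [← sinh_mul_sinh_mul_cos_hypAngle] at h
  have hs : ∀ {z}, z ≠ v → Real.sinh (dist v z) ≠ 0 := fun hz =>
    (Real.sinh_pos_iff.2 (dist_pos.2 hz.symm)).ne'
  exact Real.injOn_cos ⟨InnerProductGeometry.angle_nonneg _ _, InnerProductGeometry.angle_le_pi _ _⟩
    ⟨h0, hpi⟩ (mul_left_cancel₀ (mul_ne_zero (hs hx) (hs hy)) h).symm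

theorem cayley_self (v : ℍ) : cayley v v = 0 := by simp [cayley]

theorem hypAngle_self_left (v y : ℍ) : hypAngle v v y = Real.pi / 2 := by
  rw [hypAngle, cayley_self, InnerProductGeometry.angle_zero_left]

theorem hypAngle_self_right (v x : ℍ) : hypAngle v x v = Real.pi / 2 := by
  rw [hypAngle, cayley_self, InnerProductGeometry.angle_zero_right]

/-- The cross product for the Lorentz form. -/
def cross (u v : Mink) : Mink :=
  ![(u 1 * v 2 - u 2 * v 1) / 2, u 1 * v 0 - u 0 * v 1, u 0 * v 2 - u 2 * v 0]

theorem mform_cross (u v w : Mink) : mform w (cross u v) = triple u v w / 2 := by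
  simp [mform, cross, triple]; ring

theorem mform_cross_cross (a b c d : Mink) :
    mform (cross a b) (cross c d) = mform a d * mform b c - mform a c * mform b d := by
  simp [mform, cross]; ring

theorem triple_eq_zero_of_mem_segment {x y z : ℍ} (h : z ∈ segment x y) :
    triple (hyp x) (hyp y) (hyp z) = 0 := by
  have hg := gram_eq (hyp x) (hyp y) (hyp z)
  simp only [mform_hyp_self, mform_hyp] at hg
  have hc := Real.cosh_add (dist x z) (dist z y)
  have h1 := Real.cosh_sq (dist x z)
  have h2 := Real.cosh_sq (dist z y)
  rw [show dist x z + dist z y = dist x y from h] at hc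
  rw [dist_comm y z] at hg
  have : triple (hyp x) (hyp y) (hyp z) ^ 2 = 0 := by
    rw [hc] at hg
    nlinarith
  exact pow_eq_zero_iff two_ne_zero |>.1 this

theorem triple_eq_zero_of_mem_line {x y z : ℍ} (h : z ∈ line x y) :
    triple (hyp x) (hyp y) (hyp z) = 0 := by
  rcases h with h | h | h
  · exact triple_eq_zero_of_mem_segment h
  · rw [← neg_eq_zero, ← triple_eq_zero_of_mem_segment h]; simp only [triple]; ring
  · rw [← neg_eq_zero, ← triple_eq_zero_of_mem_segment h]; simp only [triple]; ring

theorem mem_segment_of_comb {x y z : ℍ} {a b : ℝ} (ha : 0 ≤ a) (hb : 0 ≤ b)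
    (h : hyp z = a • hyp x + b • hyp y) : z ∈ segment x y := by
  have h1 := mform_hyp z z
  have hx := mform_hyp x z
  have hy := mform_hyp z y
  have hxy := mform_hyp x y
  rw [dist_self, Real.cosh_zero, h] at h1
  rw [h] at hx hy
  simp only [mform_add_left, mform_add_right, mform_smul_left, mform_smul_right, mform_hyp_self,
    mform_comm (hyp y) (hyp x), hxy] at h1 hx hy
  have sx : Real.sinh (dist x z) = b * Real.sinh (dist x y) := by
    have h2 := Real.sinh_sq (dist x z)
    have h3 := Real.sinh_sq (dist x y)
    refine (pow_left_inj₀ (Real.sinh_nonneg_iff.2 dist_nonneg)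
      (mul_nonneg hb (Real.sinh_nonneg_iff.2 dist_nonneg)) two_ne_zero).1 ?_
    rw [h2, mul_pow, h3, ← neg_neg (Real.cosh (dist x z)), ← hx]
    linarith
  have sy : Real.sinh (dist z y) = a * Real.sinh (dist x y) := by
    have h2 := Real.sinh_sq (dist z y)
    have h3 := Real.sinh_sq (dist x y)
    refine (pow_left_inj₀ (Real.sinh_nonneg_iff.2 dist_nonneg)
      (mul_nonneg ha (Real.sinh_nonneg_iff.2 dist_nonneg)) two_ne_zero).1 ?_
    rw [h2, mul_pow, h3, ← neg_neg (Real.cosh (dist z y)), ← hy]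
    linarith
  have hc : Real.cosh (dist x z + dist z y) = Real.cosh (dist x y) := by
    have h3 := Real.sinh_sq (dist x y)
    rw [Real.cosh_add, sx, sy, ← neg_neg (Real.cosh (dist x z)), ← neg_neg (Real.cosh (dist z y)),
      ← hx, ← hy]
    linear_combination (-Real.cosh (dist x y)) * h1 + a * b * h3
  have := congrArg Real.arcosh hc
  rwa [Real.arcosh_cosh (by positivity), Real.arcosh_cosh dist_nonneg] at this

theorem sum_fin_three_eq {M : Type*} [AddCommMonoid M] {i j k : Fin 3} (hij : i ≠ j) (hki : k ≠ i)
    (hkj : k ≠ j) (f : Fin 3 → M) : ∑ l, f l = f i + (f j + f k) := by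
  have huniv : (Finset.univ : Finset (Fin 3)) = {i, j, k} := by
    clear * - hij hki hkj
    decide +revert
  rw [huniv, Finset.sum_insert (by simp [hij, hki.symm]), Finset.sum_pair hkj.symm]

namespace Chamber

variable {m : Fin 3 → ℕ} (X : Chamber m)

theorem mform_eq_zero_of_mem_line {i j k : Fin 3} (hij : i ≠ j) (hki : k ≠ i) (hkj : k ≠ j) {z : ℍ}
    (h : z ∈ line (X.v i) (X.v j)) : mform (hyp z) (X.e k) = 0 := by
  have h1 := triple_mul_triple (hyp (X.v i)) (hyp (X.v j)) (hyp z) (X.e i) (X.e j) (X.e k)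
  rw [triple_eq_zero_of_mem_line h, X.v_ne i j hij, X.v_ne i k hki.symm, X.v_ne j k hkj.symm] at h1
  have := mul_pos (X.v_pos i) (X.v_pos j)
  have h2 : mform (hyp (X.v i)) (X.e i) * mform (hyp (X.v j)) (X.e j) * mform (hyp z) (X.e k) = 0 := by
    linarith
  exact (mul_eq_zero.1 h2).resolve_left this.ne'

theorem eq_smul_e {i j k : Fin 3} (hij : i ≠ j) (hki : k ≠ i) (hkj : k ≠ j) {u : Mink}
    (hi : mform (hyp (X.v i)) u = 0) (hj : mform (hyp (X.v j)) u = 0) :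
    ∃ t : ℝ, u = t • X.e k := by
  obtain ⟨a, rfl⟩ := X.exists_comb_e u
  rw [sum_fin_three_eq hij hki hkj] at hi hj ⊢
  simp only [mform_add_right, mform_smul_right, X.v_ne i j hij, X.v_ne i k hki.symm,
    X.v_ne j i hij.symm, X.v_ne j k hkj.symm, mul_zero, add_zero, zero_add, mul_eq_zero,
    (X.v_pos i).ne', (X.v_pos j).ne', or_false] at hi hj
  exact ⟨a k, by rw [hi, hj]; simp⟩

theorem isReflection_iff {i j k : Fin 3} (hij : i ≠ j) (hki : k ≠ i) (hkj : k ≠ j) {σ : ℍ ≃ᵢ ℍ} :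
    IsReflection (X.v i) (X.v j) σ ↔ σ = isom (X.s k) := by
  constructor
  · rintro ⟨h1, hfix⟩
    have hvi : σ (X.v i) = X.v i := hfix _ (Or.inl (by simp [segment]))
    have hvj : σ (X.v j) = X.v j := hfix _ (Or.inl (by simp [segment]))
    have hdist : ∀ z w, mform (hyp (σ z)) (hyp (σ w)) = mform (hyp z) (hyp w) := fun z w => by
      rw [← dist_eq_iff_mform, σ.dist_eq]
    have hor : ∀ z, σ z = z ∨ (σ z = isom (X.s k) z ∧ mform (hyp z) (X.e k) ≠ 0) := by
      intro z
      have hi := hdist (X.v i) z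
      have hj := hdist (X.v j) z
      rw [hvi] at hi
      rw [hvj] at hj
      obtain ⟨t, ht⟩ := X.eq_smul_e hij hki hkj (u := hyp (σ z) - hyp z)
        (by rw [mform_sub_right, hi, sub_self]) (by rw [mform_sub_right, hj, sub_self])
      rw [sub_eq_iff_eq_add'] at ht
      have hn := mform_hyp_self (σ z)
      rw [ht] at hn
      simp only [mform_add_left, mform_add_right, mform_smul_left, mform_smul_right, X.e_self,
        mform_hyp_self, mform_comm (X.e k) (hyp z)] at hn
      have h0 : t * (t + 2 * mform (hyp z) (X.e k)) = 0 := by linarith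
      rcases eq_or_ne t 0 with rfl | ht0
      · left; apply hyp_injective; rw [ht, zero_smul, add_zero]
      · have ht' := (mul_eq_zero.1 h0).resolve_left ht0
        right
        refine ⟨hyp_injective ?_, fun h => ht0 (by rw [h] at ht'; linarith)⟩
        rw [ht, hyp_isom, lin_s, eq_neg_of_add_eq_zero_left ht']
        module
    obtain ⟨z₀, hz₀⟩ : ∃ z, σ z ≠ z := by
      by_contra! h
      exact h1 (IsometryEquiv.ext h)
    obtain ⟨h2, h3⟩ := (hor z₀).resolve_left hz₀
    ext1 z
    rcases hor z with h | h
    · have h4 := hdist z₀ z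
      rw [h, h2, hyp_isom, lin_s] at h4
      simp only [mform_sub_left, mform_smul_left] at h4
      have h5 : mform (hyp z₀) (X.e k) * mform (X.e k) (hyp z) = 0 := by linarith
      have h6 := (mul_eq_zero.1 h5).resolve_left h3
      apply hyp_injective
      rw [h, hyp_isom, lin_s, mform_comm, h6, mul_zero, zero_smul, sub_zero]
    · exact h.1
  · rintro rfl
    constructor
    · intro h
      rw [← map_one isom] at h
      have h2 := X.lin_s_self k
      rw [isom_injective h, lin_one_apply] at h2
      have h3 := X.e_self k
      have h4 : mform (X.e k) (X.e k) = -mform (X.e k) (X.e k) := by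
        conv_lhs => rw [h2]
        rw [mform_neg_left, ← h2]
      linarith
    · intro z hz
      apply hyp_injective
      rw [hyp_isom, lin_s, X.mform_eq_zero_of_mem_line hij hki hkj hz]
      simp

end Chamber

/-! ### The chamber of a triangle -/

namespace Triangle

variable {T : Triangle} {r p q : ℕ}

theorem pi_div_ne_pi_div_two {n : ℕ} (hn : 3 ≤ n) : Real.pi / 2 ≠ Real.pi / n := by
  have h : (3 : ℝ) ≤ n := by exact_mod_cast hn
  have hpi := Real.pi_pos
  intro h1
  rw [div_eq_div_iff (by norm_num) (by positivity)] at h1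
  nlinarith

/-- The unit normals of the sides are the normalized cross products of the vertices, with a common
sign given by the orientation of the triangle. -/
theorem HasAngles.exists_chamber (hT : T.HasAngles r p q) (hr : 3 ≤ r) (hp : 3 ≤ p) (hq : 3 ≤ q) :
    ∃ X : Chamber ![r, p, q], X.v = ![T.R, T.P, T.Q] := by
  obtain ⟨hR, hP, hQ⟩ := hT
  have hRP : T.P ≠ T.R := fun h => pi_div_ne_pi_div_two hr (by
    rw [← hR, h, hypAngle_self_left])
  have hRQ : T.Q ≠ T.R := fun h => pi_div_ne_pi_div_two hr (by
    rw [← hR, h, hypAngle_self_right])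
  have hPQ : T.Q ≠ T.P := fun h => pi_div_ne_pi_div_two hp (by
    rw [← hP, h, hypAngle_self_left])
  have lR := sinh_mul_sinh_mul_cos_hypAngle T.R T.P T.Q
  have lP := sinh_mul_sinh_mul_cos_hypAngle T.P T.Q T.R
  have lQ := sinh_mul_sinh_mul_cos_hypAngle T.Q T.R T.P
  rw [hR] at lR
  rw [hP] at lP
  rw [hQ] at lQ
  have hs : ∀ {x y : ℍ}, y ≠ x → 0 < Real.sinh (dist x y) := fun h =>
    Real.sinh_pos_iff.2 (dist_pos.2 h.symm)
  have hsq : ∀ x y : ℍ, Real.sinh (dist x y) ^ 2 = mform (hyp x) (hyp y) ^ 2 - 1 := fun x y => by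
    rw [mform_hyp, Real.sinh_sq]; ring
  have a0 := hs hPQ
  have a1 := hs hRQ.symm
  have a2 := hs hRP
  have q0 := hsq T.P T.Q
  have q1 := hsq T.Q T.R
  have q2 := hsq T.R T.P
  rw [dist_comm T.R T.Q] at lR
  rw [dist_comm T.P T.R] at lP
  rw [dist_comm T.Q T.P] at lQ
  have sR := mform_hyp_self T.R
  have sP := mform_hyp_self T.P
  have sQ := mform_hyp_self T.Q
  have hg := gram_eq (hyp T.R) (hyp T.P) (hyp T.Q)
  have hsin := sin_pi_div_pos (by omega : 2 ≤ r)
  have hsc := Real.sin_sq_add_cos_sq (Real.pi / r)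
  generalize Real.sinh (dist T.P T.Q) = d0 at *
  generalize Real.sinh (dist T.Q T.R) = d1 at *
  generalize Real.sinh (dist T.R T.P) = d2 at *
  generalize hu0 : hyp T.R = u0 at *
  generalize hu1 : hyp T.P = u1 at *
  generalize hu2 : hyp T.Q = u2 at *
  rw [mform_comm u2 u1] at lQ
  rw [mform_comm u2 u0] at lQ q1
  rw [mform_comm u2 u0, mform_comm u1 u0] at lP
  have ht : 0 < triple u0 u1 u2 ^ 2 := by
    have h1 : triple u0 u1 u2 ^ 2 = 4 * (d1 * d2 * Real.sin (Real.pi / r)) ^ 2 := by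
      rw [sR, sP, sQ] at hg
      have h2 : (d1 * d2 * Real.sin (Real.pi / r)) ^ 2
        = d1 ^ 2 * d2 ^ 2 - (d2 * d1 * Real.cos (Real.pi / r)) ^ 2 := by
        linear_combination d1 ^ 2 * d2 ^ 2 * hsc
      rw [h2, lR, q1, q2]
      linear_combination 4 * hg
    rw [h1]; positivity
  obtain ⟨ε, hε, hεt⟩ : ∃ ε : ℝ, ε * ε = 1 ∧ 0 < ε * triple u0 u1 u2 := by
    rcases lt_or_gt_of_ne (pow_ne_zero_iff two_ne_zero |>.1 ht.ne') with h | h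
    · exact ⟨-1, by norm_num, by linarith⟩
    · exact ⟨1, by norm_num, by linarith⟩
  have hcr : ∀ {a b c d : Mink} {x y z : ℝ}, 0 < x → 0 < y →
      x * y * z = mform a c * mform b d - mform a d * mform b c →
      mform ((ε / x) • cross a b) ((ε / y) • cross c d) = -z := by
    intro a b c d x y z hx hy h
    have h' : mform a d * mform b c - mform a c * mform b d = x * y * (-z) := by linarith
    rw [mform_smul_left, mform_smul_right, mform_cross_cross, h']
    field_simp
    linear_combination (-z) * hε
  have e01 := hcr (a := u1) (b := u2) (c := u2) (d := u0) a0 a1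
    (z := Real.cos (Real.pi / q)) (by rw [mform_comm u2 u0, mform_comm u1 u0, sQ]; linarith)
  have e12 := hcr (a := u2) (b := u0) (c := u0) (d := u1) a1 a2
    (z := Real.cos (Real.pi / r)) (by
      rw [mform_comm u2 u0, mform_comm u2 u1, sR]; linarith)
  have e02 := hcr (a := u1) (b := u2) (c := u0) (d := u1) a0 a2
    (z := Real.cos (Real.pi / p)) (by
      rw [mform_comm u2 u0, mform_comm u2 u1, mform_comm u1 u0, sP]; linarith)
  have hself : ∀ {a b : Mink} {x : ℝ}, 0 < x → mform a a = -1 → mform b b = -1 →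
      x ^ 2 = mform a b ^ 2 - 1 →
      mform ((ε / x) • cross a b) ((ε / x) • cross a b) = 1 := by
    intro a b x hx ha hb h
    rw [← neg_neg (1 : ℝ)]
    exact hcr hx hx (by rw [ha, hb, mform_comm b a]; linarith)
  have hpos : ∀ {a b c : Mink} {x : ℝ}, 0 < x → triple a b c = triple u0 u1 u2 →
      0 < mform c ((ε / x) • cross a b) := by
    intro a b c x hx h
    rw [mform_smul_right, mform_cross, h]
    have : ε / x * (triple u0 u1 u2 / 2) = ε * triple u0 u1 u2 / (2 * x) := by field_simp
    rw [this]
    positivity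
  have hzero : ∀ (a b : Mink) (x : ℝ), mform a ((ε / x) • cross a b) = 0 ∧
      mform b ((ε / x) • cross a b) = 0 := by
    intro a b x
    rw [mform_smul_right, mform_smul_right, mform_cross, mform_cross]
    constructor <;> (simp only [triple]; ring)
  refine ⟨⟨![(ε / d0) • cross u1 u2, (ε / d1) • cross u2 u0, (ε / d2) • cross u0 u1],
    ![T.R, T.P, T.Q], ?_, ?_, ?_, ?_, ?_⟩, rfl⟩
  · intro k; fin_cases k <;> assumption
  · intro k
    fin_cases k
    · exact hself a0 sP sQ q0
    · exact hself a1 sQ sR (by rw [mform_comm u2 u0]; exact q1)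
    · exact hself a2 sR sP q2
  · intro i j hij
    fin_cases i <;> fin_cases j <;> first
      | exact absurd rfl hij
      | exact e01
      | exact e12
      | exact e02
      | exact (mform_comm _ _).trans e01
      | exact (mform_comm _ _).trans e12
      | exact (mform_comm _ _).trans e02
  · intro i
    fin_cases i
    · change 0 < mform (hyp T.R) _
      rw [hu0]; exact hpos a0 (by simp only [triple]; ring)
    · change 0 < mform (hyp T.P) _
      rw [hu1]; exact hpos a1 (by simp only [triple]; ring)
    · change 0 < mform (hyp T.Q) _
      rw [hu2]; exact hpos a2 rfl
  · intro i j hij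
    fin_cases i <;> fin_cases j
    · exact absurd rfl hij
    · change mform (hyp T.R) ((ε / d1) • cross u2 u0) = 0
      rw [hu0]; exact (hzero _ _ _).2
    · change mform (hyp T.R) ((ε / d2) • cross u0 u1) = 0
      rw [hu0]; exact (hzero _ _ _).1
    · change mform (hyp T.P) ((ε / d0) • cross u1 u2) = 0
      rw [hu1]; exact (hzero _ _ _).1
    · exact absurd rfl hij
    · change mform (hyp T.P) ((ε / d2) • cross u0 u1) = 0
      rw [hu1]; exact (hzero _ _ _).2
    · change mform (hyp T.Q) ((ε / d0) • cross u1 u2) = 0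
      rw [hu2]; exact (hzero _ _ _).2
    · change mform (hyp T.Q) ((ε / d1) • cross u2 u0) = 0
      rw [hu2]; exact (hzero _ _ _).1
    · exact absurd rfl hij

variable {X : Chamber ![r, p, q]}

theorem reflectionGroup_eq (hX : X.v = ![T.R, T.P, T.Q]) :
    T.reflectionGroup = X.W.map isom := by
  rw [reflectionGroup, Chamber.W, MonoidHom.map_closure]
  congr 1
  have h0 : X.v 0 = T.R := by rw [hX]; rfl
  have h1 : X.v 1 = T.P := by rw [hX]; rfl
  have h2 : X.v 2 = T.Q := by rw [hX]; rfl
  ext σ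
  rw [Set.mem_ofPred_eq, ← h0, ← h1, ← h2,
    X.isReflection_iff (k := 2) (by decide) (by decide) (by decide),
    X.isReflection_iff (k := 0) (by decide) (by decide) (by decide),
    X.isReflection_iff (k := 1) (by decide) (by decide) (by decide)]
  constructor
  · rintro (rfl | rfl | rfl)
    · exact ⟨_, ⟨2, rfl⟩, rfl⟩
    · exact ⟨_, ⟨0, rfl⟩, rfl⟩
    · exact ⟨_, ⟨1, rfl⟩, rfl⟩
  · rintro ⟨_, ⟨k, rfl⟩, rfl⟩
    rcases eq_zero_or k with rfl | rfl | rfl <;> simp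

end Triangle

/-! ### Contact points -/

namespace Chamber

variable {m : Fin 3 → ℕ} (X : Chamber m)

/-- The points of contact `t k` of the inscribed circle with the sides: the orthogonal projections
of its center `o` to the sides. -/
theorem exists_contact : ∃ (o : ℍ) (t : Fin 3 → ℍ), (∀ i j, dist o (t i) = dist o (t j)) ∧
    (∀ k, mform (hyp (t k)) (X.e k) = 0) ∧
    (∀ i k, i ≠ k → 0 < mform (hyp (t k)) (X.e i)) ∧
    ∀ k w, mform (hyp w) (X.e k) = 0 → dist o (t k) ≤ dist o w := by
  obtain ⟨o, ρ, hρ, ho⟩ := X.exists_incenter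
  have hself : ∀ k, mform (hyp o - ρ • X.e k) (hyp o - ρ • X.e k) = -(1 + ρ ^ 2) := by
    intro k
    simp only [mform_sub_left, mform_sub_right, mform_smul_left, mform_smul_right, mform_hyp_self,
      X.e_self, ho, mform_comm (X.e k) (hyp o)]
    ring
  have hex : ∀ k, ∃ z, ∃ c : ℝ, 0 < c ∧ hyp o - ρ • X.e k = c • hyp z := by
    intro k
    apply exists_smul_hyp
    · rw [hself]; nlinarith
    · refine pos_of_mform_hyp_neg o (by rw [hself]; nlinarith) ?_
      rw [mform_sub_right, mform_smul_right, mform_hyp_self, ho]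
      nlinarith
  choose t c hc ht using hex
  have hc2 : ∀ k, c k ^ 2 = 1 + ρ ^ 2 := by
    intro k
    have h := hself k
    rw [ht, mform_smul_left, mform_smul_right, mform_hyp_self] at h
    linarith
  have hot : ∀ k, mform (hyp o) (hyp (t k)) = -c k := by
    intro k
    have h : c k * mform (hyp o) (hyp (t k)) = -(1 + ρ ^ 2) := by
      rw [← mform_smul_right, ← ht, mform_sub_right, mform_smul_right, mform_hyp_self, ho]
      ring
    rw [← hc2] at h
    exact mul_left_cancel₀ (hc k).ne' (by linarith)
  have hce : ∀ i k, c k * mform (hyp (t k)) (X.e i) = ρ - ρ * mform (X.e k) (X.e i) := by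
    intro i k
    rw [← mform_smul_left, ← ht, mform_sub_left, mform_smul_left, ho]
  refine ⟨o, t, fun i j => ?_, fun k => ?_, fun i k hik => ?_, fun k w hw => ?_⟩
  · rw [dist_eq_iff_mform, hot, hot, neg_inj]
    exact (pow_left_inj₀ (hc i).le (hc j).le two_ne_zero).1 (by rw [hc2, hc2])
  · have h := hce k k
    rw [X.e_self, mul_one, sub_self] at h
    exact (mul_eq_zero.1 h).resolve_left (hc k).ne'
  · have h := hce i k
    obtain ⟨l, hl1, hl2⟩ := exists_third k i
    rw [X.e_mform hik.symm hl1 hl2] at h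
    have := X.half_le_cs l
    rw [← mul_pos_iff_of_pos_left (hc k), h]
    nlinarith
  · rw [dist_le_iff_mform, hot]
    have h : mform (hyp o) (hyp w) = c k * mform (hyp (t k)) (hyp w) := by
      rw [← mform_smul_left, ← ht, mform_sub_left, mform_smul_left, mform_comm (X.e k), hw]
      ring
    rw [h]
    nlinarith [one_le_neg_mform_hyp (t k) w, hc k]

theorem touchesSide {o t : ℍ} {i j k : Fin 3} (hij : i ≠ j) (hki : k ≠ i) (hkj : k ≠ j)
    (hk : mform (hyp t) (X.e k) = 0) (hi : 0 < mform (hyp t) (X.e i))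
    (hj : 0 < mform (hyp t) (X.e j))
    (hmin : ∀ w, mform (hyp w) (X.e k) = 0 → dist o t ≤ dist o w) :
    Triangle.TouchesSide o t (X.v i) (X.v j) := by
  have hvi := X.v_pos i
  have hvj := X.v_pos j
  refine ⟨?_, ?_, ?_, fun w hw => hmin w (X.mform_eq_zero_of_mem_line hij hki hkj (Or.inl hw))⟩
  · refine mem_segment_of_comb (div_pos hi hvi).le (div_pos hj hvj).le ?_
    obtain ⟨a, ha⟩ := X.exists_comb_v (hyp t)
    rw [sum_fin_three_eq hij hki hkj] at ha
    rw [ha] at hi hj hk ⊢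
    simp only [mform_add_left, mform_smul_left, X.v_ne i j hij, X.v_ne i k hki.symm,
      X.v_ne j i hij.symm, X.v_ne j k hkj.symm, X.v_ne k i hki, X.v_ne k j hkj, mul_zero, add_zero,
      zero_add, mul_eq_zero, (X.v_pos k).ne', or_false] at hi hj hk ⊢
    rw [hk, zero_smul, add_zero, mul_div_cancel_right₀ _ hvi.ne', mul_div_cancel_right₀ _ hvj.ne']
  · rintro rfl
    rw [X.v_ne i j hij] at hj
    exact hj.false
  · rintro rfl
    rw [X.v_ne j i hij.symm] at hi
    exact hi.false

end Chamber

/-! ### The graph of contact points -/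

theorem mem_segment_isometry (g : ℍ ≃ᵢ ℍ) {x y z : ℍ} :
    g z ∈ segment (g x) (g y) ↔ z ∈ segment x y := by
  simp only [segment, Set.mem_ofPred_eq, g.dist_eq]

theorem Triangle.TouchesSide.map (g : ℍ ≃ᵢ ℍ) {o x y z : ℍ} (h : TouchesSide o x y z) :
    TouchesSide (g o) (g x) (g y) (g z) := by
  obtain ⟨h1, h2, h3, h4⟩ := h
  refine ⟨(mem_segment_isometry g).2 h1, g.injective.ne h2, g.injective.ne h3, fun w hw => ?_⟩
  obtain ⟨w, rfl⟩ := g.surjective w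
  rw [g.dist_eq, g.dist_eq]
  exact h4 w ((mem_segment_isometry g).1 hw)

theorem Triangle.IsContactPoint.map {T : Triangle} {x : ℍ} (h : T.IsContactPoint x) (g : ℍ ≃ᵢ ℍ) :
    (T.map g).IsContactPoint (g x) := by
  obtain ⟨o, y, z, h1, h2, h3, h4, h5⟩ := h
  exact ⟨g o, g y, g z, by rw [g.dist_eq, g.dist_eq, h1], by rw [g.dist_eq, g.dist_eq, h2],
    h3.map g, h4.map g, h5.map g⟩

namespace Chamber

variable {m : Fin 3 → ℕ} (X : Chamber m)

/-- The law of sines in the right-angled triangle with the vertices `X.v i`, `t` and the foot of the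
perpendicular from `t` to the wall `j`, squared. -/
theorem mform_e_sq {i j k : Fin 3} (hij : i ≠ j) (hki : k ≠ i) (hkj : k ≠ j) {t : ℍ}
    (hk : mform (hyp t) (X.e k) = 0) : mform (hyp t) (X.e j) ^ 2
      = (1 - X.cs i ^ 2) * (mform (hyp (X.v i)) (hyp t) ^ 2 - 1) := by
  set u := hyp (X.v i)
  have h1 := triple_mul_triple u (X.e j) (X.e k) u (hyp t) (X.e k)
  have h2 := triple_mul_triple u (X.e j) (X.e k) u (X.e j) (X.e k)
  have h3 := triple_mul_triple u (hyp t) (X.e k) u (hyp t) (X.e k)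
  have hui : mform u u = -1 := mform_hyp_self _
  have huj : mform u (X.e j) = 0 := X.v_ne i j hij
  have huk : mform u (X.e k) = 0 := X.v_ne i k hki.symm
  rw [mform_comm (X.e j) u, mform_comm (X.e k) u] at h1 h2
  rw [mform_comm (X.e k) (hyp t), mform_comm (hyp t) u, mform_comm (X.e k) u] at h3
  rw [mform_comm (X.e k) (hyp t), mform_comm (X.e j) (hyp t)] at h1
  rw [mform_comm (X.e k) (X.e j)] at h2
  simp only [hui, huj, huk, X.e_self, hk, mform_hyp_self,
    X.e_mform hkj.symm hij hki.symm] at h1 h2 h3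
  have h4 : triple u (X.e j) (X.e k) * triple u (hyp t) (X.e k) = 4 * mform (hyp t) (X.e j) := by
    linarith
  have h5 : triple u (X.e j) (X.e k) ^ 2 = 4 * (1 - X.cs i ^ 2) := by linarith
  have h6 : triple u (hyp t) (X.e k) ^ 2 = 4 * (mform u (hyp t) ^ 2 - 1) := by linarith
  have h7 := congrArg (· ^ 2) h4
  simp only [mul_pow, h5, h6] at h7
  linarith

/-- A point of the side `k` and its image under the reflection in the side `j` are seen from the
common vertex under twice the angle of the triangle. -/
theorem hypAngle_reflect {i j k : Fin 3} (hij : i ≠ j) (hki : k ≠ i) (hkj : k ≠ j) {t : ℍ}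
    (hk : mform (hyp t) (X.e k) = 0) (hj : 0 < mform (hyp t) (X.e j)) (g : Iso) :
    hypAngle (isom g (X.v i)) (isom g t) (isom (g * X.s j) t) = 2 * Real.pi / m i := by
  have h3 : (3 : ℝ) ≤ m i := by exact_mod_cast X.three_le i
  have hpi := Real.pi_pos
  have hv : isom (X.s j) (X.v i) = X.v i :=
    hyp_injective (by rw [hyp_isom, X.lin_s_v hij])
  have hne : t ≠ X.v i := by
    rintro rfl
    rw [X.v_ne i j hij] at hj
    exact hj.false
  have hm : mform (hyp (X.v i)) (hyp (isom (X.s j) t)) = mform (hyp (X.v i)) (hyp t) := by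
    conv_lhs => rw [← hv]
    rw [hyp_isom, hyp_isom, mform_lin]
  have hmt : mform (hyp t) (hyp (isom (X.s j) t)) = -1 - 2 * mform (hyp t) (X.e j) ^ 2 := by
    rw [hyp_isom, lin_s, mform_sub_right, mform_smul_right, mform_hyp_self]
    ring
  rw [isom_mul_apply]
  refine hypAngle_eq ((isom g).injective.ne hne) ?_ (by positivity) ?_ ?_
  · refine (isom g).injective.ne fun h => hne ((isom (X.s j)).injective (h.trans hv.symm))
  · rw [div_le_iff₀ (by linarith)]; nlinarith
  · have hd : dist (X.v i) (isom (X.s j) t) = dist (X.v i) t := dist_eq_iff_mform.2 hm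
    rw [(isom g).dist_eq, (isom g).dist_eq, hd, hyp_isom g, hyp_isom g, hyp_isom g, mform_lin,
      mform_lin, mform_lin, hm, hmt, X.mform_e_sq hij hki hkj hk,
      show Real.sinh (dist (X.v i) t) * Real.sinh (dist (X.v i) t)
        = Real.sinh (dist (X.v i) t) ^ 2 by ring, Real.sinh_sq, mul_div_assoc, Real.cos_two_mul,
      mform_hyp, cs]
    ring

end Chamber

namespace Triangle

variable {T : Triangle} {r p q : ℕ} {X : Chamber ![r, p, q]}

theorem exists_isContactPoint (hX : X.v = ![T.R, T.P, T.Q]) :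
    ∃ t, T.IsContactPoint t ∧ mform (hyp t) (X.e 2) = 0 ∧ 0 < mform (hyp t) (X.e 0) ∧
      0 < mform (hyp t) (X.e 1) := by
  obtain ⟨o, t, h1, h2, h3, h4⟩ := X.exists_contact
  have h0 : X.v 0 = T.R := by rw [hX]; rfl
  have h1' : X.v 1 = T.P := by rw [hX]; rfl
  have h2' : X.v 2 = T.Q := by rw [hX]; rfl
  have key : ∀ {i j k : Fin 3}, i ≠ j → k ≠ i → k ≠ j → TouchesSide o (t k) (X.v i) (X.v j) :=
    fun hij hki hkj => X.touchesSide hij hki hkj (h2 _) (h3 _ _ hki.symm) (h3 _ _ hkj.symm) (h4 _)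
  refine ⟨t 2, ⟨o, t 0, t 1, h1 _ _, h1 _ _, ?_, ?_, ?_⟩, h2 2, h3 0 2 (by decide),
    h3 1 2 (by decide)⟩
  · rw [← h0, ← h1']; exact key (by decide) (by decide) (by decide)
  · rw [← h1', ← h2']; exact key (by decide) (by decide) (by decide)
  · rw [← h2', ← h0]; exact key (by decide) (by decide) (by decide)

/-- The contact points `h t` and `h w t` are at combinatorial distance at most `n` for every `h` in the
reflection group. The element `w` multiplies from the right, so that this notion is compatible with
products: `w * w'` is the step `w` followed by the step `w'`. -/
def Near (T : Triangle) (X : Chamber ![r, p, q]) (t : ℍ) (w : Iso) (n : ℕ) : Prop :=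
  w ∈ X.W ∧ ∀ h ∈ X.W, (T.contactGraph r p).edist (isom h t) (isom (h * w) t) ≤ n

variable {t : ℍ}

theorem near_one : Near T X t 1 0 := ⟨one_mem _, fun h _ => by simp⟩

theorem Near.mul {w w' : Iso} {n n' : ℕ} (hw : Near T X t w n) (hw' : Near T X t w' n') :
    Near T X t (w * w') (n + n') := by
  refine ⟨mul_mem hw.1 hw'.1, fun h hh => ?_⟩
  rw [← mul_assoc, Nat.cast_add]
  exact (SimpleGraph.edist_triangle).trans (add_le_add (hw.2 h hh) (hw'.2 _ (mul_mem hh hw.1)))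

theorem Near.inv {w : Iso} {n : ℕ} (hw : Near T X t w n) : Near T X t w⁻¹ n := by
  refine ⟨inv_mem hw.1, fun h hh => ?_⟩
  have := hw.2 (h * w⁻¹) (mul_mem hh (inv_mem hw.1))
  rwa [inv_mul_cancel_right, SimpleGraph.edist_comm] at this

theorem Near.pow {w : Iso} {n : ℕ} (hw : Near T X t w n) (k : ℕ) : Near T X t (w ^ k) (n * k) := by
  induction k with
  | zero => exact near_one
  | succ k ih => rw [pow_succ, mul_add_one]; exact ih.mul hw

theorem near_of_neighbors (hX : X.v = ![T.R, T.P, T.Q]) (ht : T.IsContactPoint t)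
    (ht2 : mform (hyp t) (X.e 2) = 0) (ht0 : 0 < mform (hyp t) (X.e 0))
    (ht1 : 0 < mform (hyp t) (X.e 1)) {j : Fin 3} (hj : j ≠ 2) :
    Near T X t (X.s j * X.s 2) 1 := by
  have h0 : X.v 0 = T.R := by rw [hX]; rfl
  have h1 : X.v 1 = T.P := by rw [hX]; rfl
  have hs2 : isom (X.s 2) t = t := hyp_injective (by rw [hyp_isom, Chamber.lin_s, ht2]; simp)
  have hv : ∀ {i}, i ≠ j → ∀ g, isom (g * X.s j) (X.v i) = isom g (X.v i) := fun hi g => by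
    rw [isom_mul_apply]
    exact congrArg _ (hyp_injective (by rw [hyp_isom, X.lin_s_v hi]))
  refine ⟨mul_mem (X.s_mem _) (X.s_mem _), fun h hh => ?_⟩
  rw [← mul_assoc, isom_mul_apply (h * X.s j), hs2, Nat.cast_one,
    SimpleGraph.edist_le_one_iff_adj_or_eq]
  by_cases hne : isom h t = isom (h * X.s j) t
  · exact Or.inr hne
  have hm : ∀ g ∈ X.W, isom g ∈ T.reflectionGroup := fun g hg => by
    rw [reflectionGroup_eq hX]; exact ⟨g, hg, rfl⟩
  have hhj := mul_mem hh (X.s_mem j)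
  left
  rw [contactGraph, SimpleGraph.fromRel_adj]
  refine ⟨hne, Or.inl ?_⟩
  obtain rfl | rfl : j = 1 ∨ j = 0 := by clear * - hj; decide +revert
  · refine Or.inl ⟨_, hm _ hh, _, hm _ hhj, ?_, ht.map _, ht.map _, ?_⟩
    · rw [← h0, hv (by decide)]
    · rw [← h0]; exact X.hypAngle_reflect (by decide) (by decide) (by decide) ht2 ht1 h
  · refine Or.inr ⟨_, hm _ hh, _, hm _ hhj, ?_, ht.map _, ht.map _, ?_⟩
    · rw [← h1, hv (by decide)]
    · rw [← h1]; exact X.hypAngle_reflect (by decide) (by decide) (by decide) ht2 ht0 h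

theorem near_rotation (hX : X.v = ![T.R, T.P, T.Q]) (ht : T.IsContactPoint t)
    (ht2 : mform (hyp t) (X.e 2) = 0) (ht0 : 0 < mform (hyp t) (X.e 0))
    (ht1 : 0 < mform (hyp t) (X.e 1)) {i j k : Fin 3} (hij : i ≠ j) (hki : k ≠ i) (hkj : k ≠ j) :
    Near T X t (X.s i * X.s j) (Chamber.wt k) := by
  have key : ∀ {l}, l ≠ 2 → Near T X t (X.s l * X.s 2) 1 :=
    fun hl => near_of_neighbors hX ht ht2 ht0 ht1 hl
  have key' : ∀ {l}, l ≠ 2 → Near T X t (X.s 2 * X.s l) 1 := fun hl => by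
    have := (key hl).inv
    rwa [mul_inv_rev, X.s_inv, X.s_inv] at this
  have hwt : ∀ l, Chamber.wt l = if l = 2 then 2 else 1 := by decide
  by_cases hj : j = 2
  · subst hj
    rw [hwt, if_neg hkj]
    exact key hij
  by_cases hi : i = 2
  · subst hi
    rw [hwt, if_neg hki]
    exact key' hij.symm
  obtain rfl : k = 2 := by clear * - hij hki hkj hi hj; decide +revert
  have := (key hi).mul (key' hj)
  rwa [mul_assoc, ← mul_assoc (X.s 2), X.s_mul_self, one_mul] at this

theorem Near.combDisplacement_le (hX : X.v = ![T.R, T.P, T.Q]) (ht : T.IsContactPoint t)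
    {h g : Iso} {n : ℕ} (hg : g ∈ X.W) (hw : Near T X t (g⁻¹ * h * g) n) :
    T.combDisplacement r p (isom h) ≤ n := by
  have hmem : isom g t ∈ T.contactPoints :=
    ⟨isom g, by rw [reflectionGroup_eq hX]; exact ⟨g, hg, rfl⟩, ht.map _⟩
  refine (iInf₂_le _ hmem).trans ?_
  have := hw.2 g hg
  rwa [show g * (g⁻¹ * h * g) = h * g by group, isom_mul_apply] at this

end Triangle

/-! ### Comparison of lengths -/

namespace Chamber

variable {m : Fin 3 → ℕ} {X : Chamber m}

theorem rotation_pow {y z c : Fin 3} (hyz : y ≠ z) (hcy : c ≠ y) (hcz : c ≠ z) :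
    (X.s y * X.s z) ^ m c = 1 := by
  obtain ⟨h, hr⟩ := X.exists_refl_eq_pow_mul hyz hcy hcz (m c)
  rw [← mul_eq_right (b := X.s y), ← hr]
  apply iso_ext
  intro v
  rw [lin_refl, lin_s, cheb_succ_self (X.two_le c), cheb_self (X.two_le c), zero_smul, add_zero,
    neg_one_smul, mform_neg_right]
  module

theorem rotation_pow_eq {y z c : Fin 3} (hyz : y ≠ z) (hcy : c ≠ y) (hcz : c ≠ z) {a : ℕ}
    (ha : a ≤ m c) : (X.s y * X.s z) ^ a = (X.s z * X.s y) ^ (m c - a) := by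
  have h : X.s y * X.s z = (X.s z * X.s y)⁻¹ := by rw [mul_inv_rev, X.s_inv, X.s_inv]
  rw [h, inv_pow, inv_eq_iff_mul_eq_one, ← pow_add, Nat.add_sub_cancel' ha,
    rotation_pow hyz.symm hcz hcy]

end Chamber

namespace Triangle

variable {T : Triangle} {r p q : ℕ} {X : Chamber ![r, p, q]} {t : ℍ}

open Chamber

/-- An element without three disjoint switches is conjugate to a product of two powers of rotations.
Several ways to write this product bound the displacement on the graph of contact points from above,
which excludes small exponents. -/
theorem exists_level_lt (hord : X.Ordered)
    (hrot : ∀ {i j k : Fin 3}, i ≠ j → k ≠ i → k ≠ j → Near T X t (X.s i * X.s j) (wt k)) {h : Iso}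
    (hlev : ∀ g ∈ X.W, ∀ n, Near T X t (g⁻¹ * h * g) n → 5 ≤ n) {N : ℕ} {i : ℕ → Fin 3}
    (hw : X.PeriodicWord h N i)
    (hno : ∀ n₁ n₂ n₃, n₁ + 2 ≤ n₂ → n₂ + 2 ≤ n₃ → n₃ + 2 ≤ n₁ + N → Switch i n₁ → Switch i n₂ →
      Switch i n₃ → False) :
    ∃ B, X.level < B ∧ ∀ z, 2 * Real.arcosh B ≤ dist z (isom h z) := by
  obtain ⟨g, hg, x, y, z, hxy, hxz, hyz, a, b, hcase⟩ := hw.eq_of_few_switches hno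
  have hconj : ∀ {B : ℝ}, (∀ z, 2 * Real.arcosh B ≤ dist z (isom (g⁻¹ * h * g) z)) →
      ∀ z, 2 * Real.arcosh B ≤ dist z (isom h z) := by
    intro B hB z
    have := hB (isom g⁻¹ z)
    rwa [← isom_mul_apply, mul_assoc, mul_inv_cancel, mul_one, isom_mul_apply,
      (isom g⁻¹).dist_eq] at this
  have h1 := hord.one_le_level
  rcases hcase with ⟨ha, hb, hax, hbz, heq⟩ | ⟨ha, hb, hay, hbz, heq⟩
  · have hL := hlev g hg _ (heq ▸ ((hrot hyz hxy hxz).pow a).mul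
      ((hrot hxy.symm hyz.symm hxz.symm).pow b))
    have hlt := hord.level_lt_of_opposite hxy hxz hyz ha hb hax hbz hL
    refine ⟨_, hlt, hconj fun w => ?_⟩
    rw [← heq]
    exact two_mul_arcosh_le_of_opposite hxy hxz hyz hb (h1.trans hlt.le) le_rfl w
  · have hy3 := X.three_le y
    have hz3 := X.three_le z
    have hzx := hrot hxz.symm hyz hxy.symm
    have hxz' := hrot hxz hxy.symm hyz
    have hxy' := hrot hxy hxz.symm hyz.symm
    have hyx := hrot hxy.symm hyz.symm hxz.symm
    have ea := X.rotation_pow_eq (a := a) hxz.symm hyz hxy.symm (by omega)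
    have eb := X.rotation_pow_eq (a := b) hxy hxz.symm hyz.symm (by omega)
    -- where the two powers meet, two letters cancel
    have hcancel : ∀ {u v w : Fin 3} {k l : ℕ}, u ≠ v → u ≠ w → v ≠ w → 1 ≤ k → 1 ≤ l →
        Near T X t ((X.s w * X.s u) ^ k * (X.s u * X.s v) ^ l)
          (wt v * (k - 1) + wt u + wt w * (l - 1)) := by
      intro u v w k l huv huw hvw hk hl
      obtain ⟨k, rfl⟩ : ∃ k', k = k' + 1 := ⟨k - 1, by omega⟩
      obtain ⟨l, rfl⟩ : ∃ l', l = l' + 1 := ⟨l - 1, by omega⟩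
      have := ((hrot huw.symm hvw huv.symm).pow k).mul (hrot hvw.symm huw huv)
        |>.mul ((hrot huv huw.symm hvw.symm).pow l)
      rw [Nat.add_sub_cancel, Nat.add_sub_cancel]
      convert this using 1
      rw [pow_succ, pow_succ']
      simp only [mul_assoc]
      rw [← mul_assoc (X.s u) (X.s u), X.s_mul_self, one_mul]
    have hL1 := hlev g hg _ (heq ▸ hcancel hxy hxz hyz (by omega) (by omega))
    have hL2 := hlev (g * (X.s x * X.s z) ^ (![r, p, q] y - a)) (mul_mem hg (hxz'.pow _).1) _ (by
      have := hcancel (k := ![r, p, q] z - b) (l := ![r, p, q] y - a) hxz hxy hyz.symm (by omega)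
        (by omega)
      rw [mul_inv_rev, mul_assoc _ g⁻¹, mul_assoc _ (g⁻¹ * h), ← mul_assoc (g⁻¹ * h), ← heq, ea, eb,
        mul_assoc (_ ^ _) _ (_ ^ _), inv_mul_cancel_left]
      exact this)
    rw [add_right_comm, add_comm (wt z * _), add_right_comm] at hL2
    have hL3 := hlev g hg _ (heq ▸ ea ▸ (hxz'.pow _).mul (hxy'.pow b))
    have hL4 := hlev g hg _ (heq ▸ eb ▸ (hzx.pow a).mul (hyx.pow _))
    have hlt := hord.level_lt_of_same hxy hxz hyz ha hb hay hbz hL1 hL2 hL3 hL4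
    refine ⟨_, hlt, hconj fun w => ?_⟩
    rw [← heq]
    exact two_mul_arcosh_le_of_same hxy hxz hyz (by omega) (by omega) (h1.trans hlt.le) le_rfl w

end Triangle

end TriangleSpectrum

end

theorem proposition12 (r p q : ℕ) (hr : 3 ≤ r) (hrp : r ≤ p) (hpq : p ≤ q)
    (hyp : (1 : ℝ) / r + 1 / p + 1 / q < 1)
    (hexc : (r, p, q) ≠ (3, 4, 4) ∧ (r, p, q) ≠ (4, 4, 4) ∧ (r, p, q) ≠ (5, 5, 5))
    (T : TriangleSpectrum.Triangle) (hT : T.HasAngles r p q)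
    (γ : ℍ ≃ᵢ ℍ) (hγ : γ ∈ T.group) (hγhyp : TriangleSpectrum.IsHyperbolic γ)
    (hlevel : 5 ≤ T.combDisplacement r p γ) :
    2 * Real.arcosh (2 * Real.cos (Real.pi / p) * Real.cos (Real.pi / q) + Real.cos (Real.pi / r))
      < TriangleSpectrum.translationLength γ := by
  open TriangleSpectrum Triangle in
  obtain ⟨X, hX⟩ := hT.exists_chamber hr (hr.trans hrp) (hr.trans (hrp.trans hpq))
  have hord : X.Ordered := by
    refine ⟨hrp, hpq, ?_⟩
    change 4 ≤ q
    by_contra! hq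
    obtain rfl : r = 3 := by omega
    obtain rfl : p = 3 := by omega
    obtain rfl : q = 3 := by omega
    norm_num at hyp
  obtain ⟨hγ0, hdir⟩ := hγ
  rw [reflectionGroup_eq hX] at hγ0
  obtain ⟨h, hh, rfl⟩ := hγ0
  obtain ⟨t, ht, ht2, ht0, ht1⟩ := exists_isContactPoint hX
  obtain ⟨N, i, hw⟩ := X.exists_periodicWord hh hdir hγhyp
  have h1 := hord.one_le_level
  change 2 * Real.arcosh X.level < _
  -- a uniform strict lower bound for the displacement suffices
  have hinf : ∀ l, 2 * Real.arcosh X.level < l → (∀ z, l ≤ dist z (isom h z)) →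
      2 * Real.arcosh X.level < translationLength (isom h) := fun l hl hz =>
    haveI : Nonempty ℍ := ⟨t⟩
    hl.trans_le (le_ciInf hz)
  by_cases hsw : ∀ n₁ n₂ n₃, n₁ + 2 ≤ n₂ → n₂ + 2 ≤ n₃ → n₃ + 2 ≤ n₁ + N → Chamber.Switch i n₁ →
      Chamber.Switch i n₂ → Chamber.Switch i n₃ → False
  · obtain ⟨B, hB, hz⟩ := exists_level_lt (T := T) (t := t) hord
      (fun hij hki hkj => near_rotation hX ht ht2 ht0 ht1 hij hki hkj)
      (fun g hg n hn => by
        exact_mod_cast hlevel.trans (hn.combDisplacement_le hX ht hg)) hw hsw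
    refine hinf _ ?_ hz
    have := (Real.arcosh_lt_arcosh (by linarith) (by linarith)).2 hB
    linarith
  · push Not at hsw
    obtain ⟨n₁, n₂, n₃, h12, h23, h31, s1, s2, s3, -⟩ := hsw
    have hc : 1 ≤ X.cs 2 + 2 * X.cs 0 * X.cs 1 := by
      nlinarith [X.half_le_cs 0, X.half_le_cs 1, X.half_le_cs 2]
    refine hinf _ hord.two_mul_arcosh_level_lt (hw.three_mul_arcosh_le _ hc
      (fun x y z hxy hxz hyz => hord.le_switch hxy hxz hyz) n₁ n₂ n₃ h12 h23 h31 fun n hn => ?_)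
    simp only [List.mem_cons, List.not_mem_nil, or_false] at hn
    rcases hn with rfl | rfl | rfl
    · exact hw.sw s1
    · exact hw.sw s2
    · exact hw.sw s3
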